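/- Let $\ell\ge 1$ be an integer and let $\rho,m_\mu,M_\mu>0$. **Setting.** Let $\Omega\subset\mathbb R^2$ be a (bounded) polygonal domain, and let $\mu\in C^0(\overline\Omega\times[0,\infty))$ satisfy $$m_\mu(t-s)\le \mu(x,t)t-\mu(x,s)s\le M_\mu(t-s)\qquad\text{for all } t\ge s\ge 0,\ x\in\overline\Omega .$$ Let $\mathcal T_h$ be a finite tessellation of $\Omega$ into nonoverlapping simple polygons $E$ (consecutive edges of a polygon may be collinear), such that every $E\in\mathcal T_h$, with diameter $h_E$, is star-shaped with respect to a ball of radius $\rho h_E$ and every edge $e\subset\partial E$ has length $h_e\ge\rho h_E$. $\mathbb P_k$ denotes polynomials of degree at most $k$, with $\mathbb P_{-1}=\{0\}$, and $(\cdot,\cdot)_E$ is the $L^2(E)$ inner product. **Degrees of freedom and projections.** On each $E$ let $$\widetilde V_h^E=\{v\in H^1(E):\Delta v\in\mathbb P_\ell(E),\ v|_e\in\mathbb P_\ell(e)\ \text{for every edge } e\subset\partial E\}.$$ The set $\Lambda^E$ of degrees of freedom consists of the values at the vertices of $E$; the edge moments $\frac1{h_e}\int_e v\,\big(\tfrac{s-s_e}{h_e}\big)^k\,ds$,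 $0\le k\le \ell-2$, for each edge $e$ (arc length $s$, midpoint $s_e$); and the interior moments $\frac1{|E|}\int_E v\,\big(\tfrac{x-x_E}{h_E}\big)^{\alpha}dx$, $|\alpha|\le\ell-2$ ($x_E$ the centroid of $E$). Let $\Pi_0^E:\widetilde V_h^E\to\mathbb P_\ell(E)$ and $\Pi_0^e:\widetilde V_h^E\to\mathbb P_\ell(e)$ be any value and edge projections that are linear combinations of the degrees of freedom in $\Lambda^E$ and satisfy: * $(\Pi_0^Ev,p)_E=(v,p)_E$ for all $p\in\mathbb P_{\ell-2}(E)$, and $\Pi_0^Eq=q$ for all $q\in\mathbb P_\ell(E)$; * $\Pi_0^ev=v$ at the two endpoints of $e$, $\int_e\Pi_0^ev\,p\,ds=\int_e v\,p\,ds$ for all $p\in\mathbb P_{\ell-2}(e)$, and $\Pi_0^eq=q|_e$ for all $q\in\mathbb P_\ell(E)$. The gradient projection $\Pi_1^Ev\in[\mathbb P_{\ell-1}(E)]^2$ is defined by $$\int_E\Pi_1^Ev\cdot p\,dx=-\int_E\Pi_0^Ev\,\nabla\!\cdot p\,dx+\sum_{e\subset\partial E}\int_e\Pi_0^ev\;p\cdot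 n\,ds\qquad\forall p\in[\mathbb P_{\ell-1}(E)]^2,$$ with $n$ the unit outward normal. **Spaces and form.** Let $$V_h^E=\{v\in\widetilde V_h^E:(v-\Pi_0^Ev,p)_E=0\ \ \forall p\in\mathbb P_\ell(E)\setminus\mathbb P_{\ell-2}(E)\},\qquad V_h=\{v\in H^1_0(\Omega):v|_E\in V_h^E\ \ \forall E\in\mathcal T_h\},$$ $$a_h(z;v,w)=\sum_{E\in\mathcal T_h}\Big[\big(\mu(\cdot,|\Pi_1^Ez|)\,\Pi_1^Ev,\Pi_1^Ew\big)_E+M_\mu m_\mu\sum_{\lambda\in\Lambda^E}\lambda\big((I-\Pi_0^E)v\big)\,\lambda\big((I-\Pi_0^E)w\big)\Big].$$ Write $|v|_1=\|\nabla v\|_{L^2(\Omega)}$. **Claim.** There are constants $C,C'>0$, depending only on $\ell,\rho,m_\mu,M_\mu$ (in particular independent of $h$), such that in every such setting: (a) (Lipschitz continuity) $|a_h(w_h;w_h,v_h)-a_h(z_h;z_h,v_h)|\le C\,|w_h-z_h|_1\,|v_h|_1$ for all $w_h,z_h,v_h\in V_h$; (b) (strong monotonicity) $a_h(w_h;w_h,w_h-z_h)-a_h(z_h;z_h,w_h-z_h)\ge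 C'\,|w_h-z_h|_1^2$ for all $w_h,z_h\in V_h$. -/

import Mathlib

open MeasureTheory Set Filter Topology
open scoped ContDiff

noncomputable section

namespace VEM

/-- The plane with its Euclidean norm. -/
abbrev Plane : Type := EuclideanSpace ℝ (Fin 2)

/-- Bivariate real polynomials. -/
abbrev Poly : Type := MvPolynomial (Fin 2) ℝ

/-- The polynomial function on the plane given by `p`. -/
def polyFun (p : Poly) (x : Plane) : ℝ := MvPolynomial.eval (fun j => x j) p

/-! ### Sobolev spaces -/

/-- `φ` is a smooth function with compact support contained in `U`. -/
def IsTestFunction (U : Set Plane) (φ : Plane → ℝ) : Prop :=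
  ContDiff ℝ ∞ φ ∧ HasCompactSupport φ ∧ tsupport φ ⊆ U

/-- `g` is square integrable on `U` and is the weak gradient of `v` on `U`. -/
def IsWeakGradient (U : Set Plane) (v : Plane → ℝ) (g : Plane → Plane) : Prop :=
  MemLp g 2 (volume.restrict U) ∧
    ∀ φ : Plane → ℝ, IsTestFunction U φ →
      ∫ x in U, v x • gradient φ x = -∫ x in U, φ x • g x

/-- The Sobolev space `H¹(U)`. -/
def MemH1 (U : Set Plane) (v : Plane → ℝ) : Prop :=
  MemLp v 2 (volume.restrict U) ∧ ∃ g, IsWeakGradient U v g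

open Classical in
/-- The weak gradient on `U` of a function in `H¹(U)`
(unique up to null sets; zero by convention for other functions). -/
def weakGrad (U : Set Plane) (v : Plane → ℝ) : Plane → Plane :=
  if h : ∃ g, IsWeakGradient U v g then h.choose else 0

/-- The seminorm `|v|_{1,U}`. -/
def h1Seminorm (U : Set Plane) (v : Plane → ℝ) : ℝ :=
  Real.sqrt (∫ x in U, ‖weakGrad U v x‖ ^ 2)

/-- The smooth functions `φ n` converge to `v` in `H¹(U)`. -/
def TendstoH1 (U : Set Plane) (φ : ℕ → Plane → ℝ) (v : Plane → ℝ) : Prop :=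
  Tendsto (fun n => ∫ x in U, (φ n x - v x) ^ 2) atTop (𝓝 0) ∧
    Tendsto (fun n => ∫ x in U, ‖gradient (φ n) x - weakGrad U v x‖ ^ 2) atTop (𝓝 0)

/-- The space `H¹₀(U)`: the closure of the test functions in `H¹(U)`. -/
def MemH10 (U : Set Plane) (v : Plane → ℝ) : Prop :=
  MemH1 U v ∧ ∃ φ : ℕ → Plane → ℝ, (∀ n, IsTestFunction U (φ n)) ∧ TendstoH1 U φ v

/-! ### Domains, polygons and meshes -/

/-- A bounded domain whose boundary consists of finitely many segments. -/
def IsPolygonalDomain (Ω : Set Plane) : Prop :=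
  IsOpen Ω ∧ IsConnected Ω ∧ Bornology.IsBounded Ω ∧
    ∃ s : Finset (Plane × Plane), frontier Ω = ⋃ e ∈ s, segment ℝ e.1 e.2

/-- A simple polygon, with `n + 3` cyclically labelled vertices. Consecutive edges may be collinear,
so hanging nodes are allowed. `carrier` is the open region enclosed by the polygon: the bounded
connected open set whose boundary is the closed polygonal curve. -/
structure Polygon where
  n : ℕ
  vertex : Fin (n + 3) → Plane
  carrier : Set Plane
  vertex_injective : Function.Injective vertex
  adjacent_edges : ∀ i, segment ℝ (vertex i) (vertex (i + 1)) ∩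
    segment ℝ (vertex (i + 1)) (vertex (i + 1 + 1)) = {vertex (i + 1)}
  disjoint_edges : ∀ i j, j ≠ i → j ≠ i + 1 → i ≠ j + 1 →
    Disjoint (segment ℝ (vertex i) (vertex (i + 1))) (segment ℝ (vertex j) (vertex (j + 1)))
  isOpen_carrier : IsOpen carrier
  isConnected_carrier : IsConnected carrier
  isBounded_carrier : Bornology.IsBounded carrier
  frontier_carrier : frontier carrier = ⋃ i, segment ℝ (vertex i) (vertex (i + 1))

namespace Polygon

variable (E : Polygon)

/-- Labels of the vertices; label `i` also stands for the edge from vertex `i` to vertex `i + 1`. -/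
abbrev Idx : Type := Fin (E.n + 3)

/-- The diameter `h_E`. -/
def diam : ℝ := Metric.diam E.carrier

/-- The length `h_e` of an edge. -/
def edgeLength (i : E.Idx) : ℝ := dist (E.vertex i) (E.vertex (i + 1))

/-- The affine parametrisation of an edge over `[0, 1]`. -/
def edgePoint (i : E.Idx) (t : ℝ) : Plane :=
  AffineMap.lineMap (E.vertex i) (E.vertex (i + 1)) t

/-- The integral with respect to arc length over an edge of a function given in terms of the
parameter `t ∈ [0, 1]`. -/
def edgeIntegral (i : E.Idx) (f : ℝ → ℝ) : ℝ := E.edgeLength i * ∫ t in (0 : ℝ)..1, f t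

/-- One of the two unit normals of an edge. -/
def edgeNormal (i : E.Idx) : Plane :=
  (E.edgeLength i)⁻¹ •
    !₂[(E.vertex (i + 1) - E.vertex i) 1, -((E.vertex (i + 1) - E.vertex i) 0)]

open Classical in
/-- The unit outward normal on an edge. -/
def outwardNormal (i : E.Idx) : Plane :=
  if ∀ᶠ t in 𝓝[>] (0 : ℝ), E.edgePoint i (1 / 2) - t • E.edgeNormal i ∈ E.carrier then
    E.edgeNormal i
  else -E.edgeNormal i

/-- The area `|E|`. -/
def area : ℝ := (volume E.carrier).toReal

/-- The centroid of `E`. -/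
def centroid : Plane := E.area⁻¹ • ∫ x in E.carrier, x

/-- Shape regularity: `E` is star-shaped with respect to a ball of radius `ρ h_E` and every edge has
length at least `ρ h_E`. -/
def IsRegular (ρ : ℝ) : Prop :=
  (∃ c : Plane, Metric.ball c (ρ * E.diam) ⊆ E.carrier ∧
      ∀ y ∈ Metric.ball c (ρ * E.diam), StarConvex ℝ y E.carrier) ∧
    ∀ i, ρ * E.diam ≤ E.edgeLength i

/-- The trace on edge `i` of `v ∈ H¹(E)` is `g`, in terms of the parameter `t ∈ [0, 1]`: some
sequence of smooth functions converges to `v` in `H¹(E)` and has restrictions to the edge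
converging to `g` in `L²`. -/
def HasEdgeTrace (v : Plane → ℝ) (i : E.Idx) (g : ℝ → ℝ) : Prop :=
  ∃ φ : ℕ → Plane → ℝ, (∀ k, ContDiff ℝ ∞ (φ k)) ∧ TendstoH1 E.carrier φ v ∧
    Tendsto (fun k => ∫ t in (0 : ℝ)..1, (φ k (E.edgePoint i t) - g t) ^ 2) atTop (𝓝 0)

open Classical in
/-- The trace on edge `i` of a function whose trace on that edge is polynomial, as a polynomial in
the parameter `t ∈ [0, 1]`. -/
def edgeTrace (v : Plane → ℝ) (i : E.Idx) : Polynomial ℝ :=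
  if h : ∃ q : Polynomial ℝ, E.HasEdgeTrace v i (fun t => q.eval t) then h.choose else 0

/-- The enlarged virtual element space on `E`: functions in `H¹(E)` whose distributional Laplacian
is a polynomial of degree at most `ℓ` and whose trace on each edge is a polynomial of degree
at most `ℓ`. -/
def MemEnlarged (ℓ : ℕ) (v : Plane → ℝ) : Prop :=
  MemH1 E.carrier v ∧
    (∃ q : Poly, q.totalDegree ≤ ℓ ∧ ∀ φ : Plane → ℝ, IsTestFunction E.carrier φ →
      ∫ x in E.carrier, inner ℝ (weakGrad E.carrier v x) (gradient φ x) =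
        -∫ x in E.carrier, polyFun q x * φ x) ∧
    ∀ i, ∃ q : Polynomial ℝ, q.natDegree ≤ ℓ ∧ E.HasEdgeTrace v i (fun t => q.eval t)

/-! ### Degrees of freedom -/

/-- Labels of the degrees of freedom: vertices, edge moments of order `k ≤ ℓ - 2`, and
interior moments of order `a + b ≤ ℓ - 2` (there are no moments when `ℓ = 1`). -/
inductive DofIdx (ℓ : ℕ) : Type
  | vertexValue (i : E.Idx) : DofIdx ℓ
  | edgeMoment (i : E.Idx) (k : Fin (ℓ - 1)) : DofIdx ℓ
  | interiorMoment (a : Fin (ℓ - 1)) (b : Fin (ℓ - 1 - a)) : DofIdx ℓ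

/-- The labels of the degrees of freedom as a disjoint sum. -/
def dofEquiv (ℓ : ℕ) :
    (E.Idx ⊕ (E.Idx × Fin (ℓ - 1)) ⊕ (Σ a : Fin (ℓ - 1), Fin (ℓ - 1 - a))) ≃ E.DofIdx ℓ where
  toFun
    | .inl i => .vertexValue i
    | .inr (.inl (i, k)) => .edgeMoment i k
    | .inr (.inr ⟨a, b⟩) => .interiorMoment a b
  invFun
    | .vertexValue i => .inl i
    | .edgeMoment i k => .inr (.inl (i, k))
    | .interiorMoment a b => .inr (.inr ⟨a, b⟩)
  left_inv := by rintro (i | ⟨i, k⟩ | ⟨a, b⟩) <;> rfl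
  right_inv := by rintro (i | ⟨i, k⟩ | ⟨a, b⟩) <;> rfl

instance instFintypeDofIdx (ℓ : ℕ) : Fintype (E.DofIdx ℓ) := Fintype.ofEquiv _ (E.dofEquiv ℓ)

/-- The degrees of freedom: values at the vertices, scaled edge moments against the monomials
`((s - s_e) / h_e) ^ k` (arc length `s`, midpoint `s_e`), and scaled interior moments against
the monomials `((x - x_E) / h_E) ^ (a, b)` (centroid `x_E`). In terms of the parameter
`t ∈ [0, 1]` of the edge, `(s - s_e) / h_e = t - 1 / 2`. -/
def dof (ℓ : ℕ) (v : Plane → ℝ) : E.DofIdx ℓ → ℝ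
  | .vertexValue i => (E.edgeTrace v i).eval 0
  | .edgeMoment i k => (E.edgeLength i)⁻¹ *
      E.edgeIntegral i (fun t => (E.edgeTrace v i).eval t * (t - 1 / 2) ^ (k : ℕ))
  | .interiorMoment a b => E.area⁻¹ *
      ∫ x in E.carrier, v x * (((x 0 - E.centroid 0) / E.diam) ^ (a : ℕ) *
        ((x 1 - E.centroid 1) / E.diam) ^ (b : ℕ))

/-! ### Projections -/

/-- `P` is an admissible value projection from the enlarged space to polynomials of degree `≤ ℓ`.
Polynomials of degree `≤ ℓ - 2` are those with `deg p + 2 ≤ ℓ` (only zero when `ℓ = 1`). -/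
def IsValueProjection (ℓ : ℕ) (P : (Plane → ℝ) → Poly) : Prop :=
  (∃ c : E.DofIdx ℓ → Poly, ∀ v, E.MemEnlarged ℓ v → P v = ∑ d, E.dof ℓ v d • c d) ∧
    (∀ v, E.MemEnlarged ℓ v → (P v).totalDegree ≤ ℓ) ∧
    (∀ v, E.MemEnlarged ℓ v → ∀ p : Poly, p.totalDegree + 2 ≤ ℓ →
      ∫ x in E.carrier, polyFun (P v) x * polyFun p x = ∫ x in E.carrier, v x * polyFun p x) ∧
    ∀ q : Poly, q.totalDegree ≤ ℓ → P (polyFun q) = q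

/-- `Q` is an admissible edge projection from the enlarged space to polynomials of degree `≤ ℓ` on
edge `i`, in terms of the parameter `t ∈ [0, 1]`. -/
def IsEdgeProjection (ℓ : ℕ) (i : E.Idx) (Q : (Plane → ℝ) → Polynomial ℝ) : Prop :=
  (∃ c : E.DofIdx ℓ → Polynomial ℝ,
      ∀ v, E.MemEnlarged ℓ v → Q v = ∑ d, E.dof ℓ v d • c d) ∧
    (∀ v, E.MemEnlarged ℓ v → (Q v).natDegree ≤ ℓ) ∧
    (∀ v, E.MemEnlarged ℓ v → (Q v).eval 0 = (E.edgeTrace v i).eval 0 ∧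
      (Q v).eval 1 = (E.edgeTrace v i).eval 1) ∧
    (∀ v, E.MemEnlarged ℓ v → ∀ p : Polynomial ℝ, p.natDegree + 2 ≤ ℓ →
      E.edgeIntegral i (fun t => (Q v).eval t * p.eval t) =
        E.edgeIntegral i (fun t => (E.edgeTrace v i).eval t * p.eval t)) ∧
    ∀ q : Poly, q.totalDegree ≤ ℓ →
      ∀ t ∈ Icc (0 : ℝ) 1, (Q (polyFun q)).eval t = polyFun q (E.edgePoint i t)

/-- The defining property of the gradient projection `g` of a function with value projection `p₀` and
edge projections `q₀ i`. -/
def IsGradProjection (ℓ : ℕ) (p₀ : Poly) (q₀ : E.Idx → Polynomial ℝ) (g : Fin 2 → Poly) : Prop :=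
  (∀ j, (g j).totalDegree ≤ ℓ - 1) ∧
    ∀ p : Fin 2 → Poly, (∀ j, (p j).totalDegree ≤ ℓ - 1) →
      ∫ x in E.carrier, ∑ j, polyFun (g j) x * polyFun (p j) x =
        -(∫ x in E.carrier, polyFun p₀ x * polyFun (∑ j, MvPolynomial.pderiv j (p j)) x) +
        ∑ i, E.edgeIntegral i (fun t => (q₀ i).eval t *
          ∑ j, polyFun (p j) (E.edgePoint i t) * E.outwardNormal i j)

open Classical in
/-- The gradient projection of `v`, as a vector field, for the value projection `P` and the
edge projections `Q`. -/
def gradProj (ℓ : ℕ) (P : (Plane → ℝ) → Poly) (Q : E.Idx → (Plane → ℝ) → Polynomial ℝ)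
    (v : Plane → ℝ) : Plane → Plane :=
  if h : ∃ g, E.IsGradProjection ℓ (P v) (fun i => Q i v) g then
    fun x => !₂[polyFun (h.choose 0) x, polyFun (h.choose 1) x]
  else 0

/-- The local virtual element space. -/
def MemLocal (ℓ : ℕ) (P : (Plane → ℝ) → Poly) (v : Plane → ℝ) : Prop :=
  E.MemEnlarged ℓ v ∧
    ∀ p : Poly, p.totalDegree ≤ ℓ → ¬ p.totalDegree + 2 ≤ ℓ →
      ∫ x in E.carrier, (v x - polyFun (P v) x) * polyFun p x = 0

/-- The dofi-dofi stabilisation `S^E(v, w)`, which does not depend on the nonlinear argument. -/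
def stab (ℓ : ℕ) (m M : ℝ) (v w : Plane → ℝ) : ℝ :=
  M * m * ∑ d, E.dof ℓ v d * E.dof ℓ w d

/-- The local discrete form `a_h^E(z; v, w)`. -/
def localForm (ℓ : ℕ) (μ : Plane → ℝ → ℝ) (m M : ℝ) (P : (Plane → ℝ) → Poly)
    (Q : E.Idx → (Plane → ℝ) → Polynomial ℝ) (z v w : Plane → ℝ) : ℝ :=
  (∫ x in E.carrier, μ x ‖E.gradProj ℓ P Q z x‖ *
      inner ℝ (E.gradProj ℓ P Q v x) (E.gradProj ℓ P Q w x)) +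
    E.stab ℓ m M (fun x => v x - polyFun (P v) x) (fun x => w x - polyFun (P w) x)

end Polygon

/-- A tessellation of `Ω` into finitely many nonoverlapping simple polygons. -/
structure Mesh (Ω : Set Plane) where
  size : ℕ
  elem : Fin size → Polygon
  subset_domain : ∀ K, (elem K).carrier ⊆ Ω
  nonoverlapping : ∀ K L, K ≠ L → Disjoint (elem K).carrier (elem L).carrier
  cover : closure Ω = ⋃ K, closure (elem K).carrier

namespace Mesh

variable {Ω : Set Plane} (T : Mesh Ω)

/-- Mesh regularity with constant `ρ`. -/
def IsRegular (ρ : ℝ) : Prop := ∀ K, (T.elem K).IsRegular ρ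

/-- A choice of a value projection and of edge projections on every element of the mesh. -/
structure Projections where
  value : Fin T.size → (Plane → ℝ) → Poly
  edge : (K : Fin T.size) → (T.elem K).Idx → (Plane → ℝ) → Polynomial ℝ

variable {T}

/-- All value and edge projections are admissible. -/
def Projections.IsAdmissible (R : T.Projections) (ℓ : ℕ) : Prop :=
  ∀ K, (T.elem K).IsValueProjection ℓ (R.value K) ∧
    ∀ i, (T.elem K).IsEdgeProjection ℓ i (R.edge K i)

/-- The global virtual element space. -/
def Projections.space (R : T.Projections) (ℓ : ℕ) : Set (Plane → ℝ) :=
  {v | MemH10 Ω v ∧ ∀ K, (T.elem K).MemLocal ℓ (R.value K) v}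

/-- The discrete form `a_h(z; v, w)`. -/
def Projections.form (R : T.Projections) (ℓ : ℕ) (μ : Plane → ℝ → ℝ) (m M : ℝ)
    (z v w : Plane → ℝ) : ℝ :=
  ∑ K, (T.elem K).localForm ℓ μ m M (R.value K) (R.edge K) z v w

end Mesh

/-- The assumptions on the nonlinearity, with constants `m` and `M`. -/
def NonlinearityAssumption (Ω : Set Plane) (μ : Plane → ℝ → ℝ) (m M : ℝ) : Prop :=
  ContinuousOn (fun y : Plane × ℝ => μ y.1 y.2) (closure Ω ×ˢ Ici 0) ∧
    ∀ x ∈ closure Ω, ∀ s t : ℝ, 0 ≤ s → s ≤ t →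
      m * (t - s) ≤ μ x t * t - μ x s * s ∧ μ x t * t - μ x s * s ≤ M * (t - s)

end VEM

end

noncomputable section

namespace VEM

/-! ### Triangles and collapsed coordinates -/

/-! Both estimates are proved on a single element, with constants depending only on `ℓ, ρ, m, M`,
and then summed over the mesh. For the sum, the squared seminorm over `Ω` is the sum of its values
over the elements (`Mesh.h1Seminorm_sq`), because element boundaries are null sets. The local
estimates are `Polygon.exists_local_lipschitz` and `Polygon.exists_local_monotone`.

On the local space the computable projections are the genuine ones. The value projection is
prescribed against degree at most `ℓ - 2`, and the local space supplies the two remaining degrees,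
so `P v` is the full `L²` projection onto polynomials of degree at most `ℓ`
(`MemLocal.integral_eq`). A trace is a polynomial of degree at most `ℓ`, hence determined by its end
values and its moments, so the edge projection is the trace itself (`StarBall.edgeProjection_eq`).
By Green's formula the gradient projection is then the `L²` projection of the weak gradient
(`StarBall.exists_gradProj_eq`). The consistent part of the form is therefore governed by the
pointwise inequalities for the flux `ξ ↦ μ(|ξ|) ξ`, which is `M`-Lipschitz and strongly monotone
with constant `m` (`norm_flux_sub_le`, `le_inner_flux_sub`).

What remains is to compare the stabilisation with the energy. Let `u = v - P v`, which is orthogonal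
to all polynomials of degree at most `ℓ`.

Upper bound (`exists_stab_le`): the interior moments of `u` vanish, and the vertex values and edge
moments are controlled by the `L²` norm of the trace of `u`. A trace inequality, the Poincaré
inequality and an inverse inequality for `P v` bound this by the energy of `v`.

Lower bound (`exists_energy_le`): join a centre `c` of the star-shaped polygon to its edges, and let
`W` be the function which on each of the resulting fan triangles is the homogeneous polynomial of
degree `ℓ` extending the trace of `u`. It is continuous across the triangles because the polynomial
traces on consecutive edges agree at the common vertex (`edgeTrace_vertex`). Then `u - W` has zero
trace, is a limit of test functions, and may be inserted in `Δu = q`. Since `u` is orthogonal to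
`q`, this gives `‖∇u‖² = ∫ ∇u · ∇W + ∫ q W`. Here `‖q‖ ≤ (C / h) ‖∇u‖`, by testing the equation with
a bump function times `q`, while `W` and `∇W` are bounded by the coefficients of the traces, hence
by the degrees of freedom.

Monotonicity combines the lower bound with best approximation: `‖∇v‖` is at most `‖Π₁ v‖ + 2 ‖∇(v -
P v)‖`.

Uniformity has two sources. Polynomial estimates come from compactness on a fixed reference ball,
whose radius depends on `ρ` only, followed by scaling. Sums over edges use the disjointness of the
fan triangles, so the number of edges never enters. -/

/-- The determinant of two plane vectors. -/
def cr (a b : Plane) : ℝ := a 0 * b 1 - a 1 * b 0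

lemma cr_add_left (a b c : Plane) : cr (a + b) c = cr a c + cr b c := by simp [cr]; ring
lemma cr_add_right (a b c : Plane) : cr a (b + c) = cr a b + cr a c := by simp [cr]; ring
lemma cr_smul_left (t : ℝ) (a b : Plane) : cr (t • a) b = t * cr a b := by simp [cr]; ring
lemma cr_smul_right (t : ℝ) (a b : Plane) : cr a (t • b) = t * cr a b := by simp [cr]; ring
lemma cr_sub_left (a b c : Plane) : cr (a - b) c = cr a c - cr b c := by simp [cr]; ring
lemma cr_sub_right (a b c : Plane) : cr a (b - c) = cr a b - cr a c := by simp [cr]; ring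
@[simp] lemma cr_self (a : Plane) : cr a a = 0 := by simp [cr]; ring
lemma cr_swap (a b : Plane) : cr b a = -cr a b := by simp [cr]; ring

/-- Cramer's rule in the plane, stated without division. -/
lemma cr_smul_eq (a b x : Plane) : cr a b • x = cr x b • a + cr a x • b := by
  ext j; fin_cases j <;> simp [cr] <;> ring

lemma norm_sq_eq (x : Plane) : ‖x‖ ^ 2 = x 0 ^ 2 + x 1 ^ 2 := by
  simp [EuclideanSpace.norm_sq_eq]

lemma inner_eq (x y : Plane) : inner ℝ x y = x 0 * y 0 + x 1 * y 1 := by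
  simp [PiLp.inner_apply, mul_comm]

/-- Lagrange's identity: the squares of the two sides differ by the square of the inner product. -/
lemma abs_cr_le (a b : Plane) : |cr a b| ≤ ‖a‖ * ‖b‖ := by
  apply abs_le_of_sq_le_sq _ (by positivity)
  rw [mul_pow, norm_sq_eq, norm_sq_eq, cr]
  nlinarith [sq_nonneg (a 0 * b 0 + a 1 * b 1)]

/-- Collapsed coordinates on the triangle with apex `p` and edge vectors `a`, `b` at `p`. -/
def duffy (p a b : Plane) (q : ℝ × ℝ) : Plane := p + q.1 • (a + q.2 • (b - a))

/-- The open unit square. -/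
def square : Set (ℝ × ℝ) := Ioo 0 1 ×ˢ Ioo 0 1

/-- The open triangle with apex `p` and edge vectors `a`, `b` at `p`. -/
def tri (p a b : Plane) : Set Plane := duffy p a b '' square

lemma measurableSet_square : MeasurableSet square := measurableSet_Ioo.prod measurableSet_Ioo

lemma square_subset : square ⊆ Icc (0 : ℝ) 1 ×ˢ Icc (0 : ℝ) 1 :=
  prod_mono Ioo_subset_Icc_self Ioo_subset_Icc_self

lemma contDiff_duffy (p a b : Plane) : ContDiff ℝ ∞ (duffy p a b) := by
  unfold duffy; fun_prop

lemma continuous_duffy (p a b : Plane) : Continuous (duffy p a b) := (contDiff_duffy p a b).continuous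

/-- The plane as a product, preserving the measure. -/
def planeEquiv : Plane ≃ᵐ ℝ × ℝ :=
  (MeasurableEquiv.toLp 2 (Fin 2 → ℝ)).symm.trans MeasurableEquiv.finTwoArrow

lemma planeEquiv_apply (x : Plane) : planeEquiv x = (x 0, x 1) := rfl

lemma planeEquiv_preserving : MeasurePreserving planeEquiv volume volume :=
  (EuclideanSpace.volume_preserving_symm_measurableEquiv_toLp (Fin 2)).trans
    (volume_preserving_finTwoArrow ℝ)

/-- Collapsed coordinates, in terms of pairs. -/
def duffyPair (p a b : Plane) (q : ℝ × ℝ) : ℝ × ℝ :=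
  (p 0 + q.1 * (a 0 + q.2 * (b 0 - a 0)), p 1 + q.1 * (a 1 + q.2 * (b 1 - a 1)))

lemma planeEquiv_duffy (p a b : Plane) (q : ℝ × ℝ) :
    planeEquiv (duffy p a b q) = duffyPair p a b q := by
  simp [planeEquiv_apply, duffy, duffyPair, mul_add]

/-- The derivative of the collapsed coordinates. -/
def duffyDeriv (a b : Plane) (q : ℝ × ℝ) : ℝ × ℝ →L[ℝ] ℝ × ℝ :=
  (Matrix.toLin (.finTwoProd ℝ) (.finTwoProd ℝ)
    !![a 0 + q.2 * (b 0 - a 0), q.1 * (b 0 - a 0);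
       a 1 + q.2 * (b 1 - a 1), q.1 * (b 1 - a 1)]).toContinuousLinearMap

lemma hasFDerivAt_duffyPair (p a b : Plane) (q : ℝ × ℝ) :
    HasFDerivAt (duffyPair p a b) (duffyDeriv a b q) q := by
  unfold duffyDeriv
  rw [Matrix.toLin_finTwoProd_toContinuousLinearMap]
  have h1 : HasFDerivAt (fun q : ℝ × ℝ => q.1) (ContinuousLinearMap.fst ℝ ℝ ℝ) q := hasFDerivAt_fst
  have h2 : HasFDerivAt (fun q : ℝ × ℝ => q.2) (ContinuousLinearMap.snd ℝ ℝ ℝ) q := hasFDerivAt_snd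
  unfold duffyPair
  convert HasFDerivAt.prodMk
    ((h1.mul ((h2.mul_const (b 0 - a 0)).const_add (a 0))).const_add (p 0))
    ((h1.mul ((h2.mul_const (b 1 - a 1)).const_add (a 1))).const_add (p 1)) using 2 <;>
  · ext <;> simp

lemma det_duffyDeriv (a b : Plane) (q : ℝ × ℝ) : (duffyDeriv a b q).det = q.1 * cr a b := by
  unfold duffyDeriv
  simp only [LinearMap.det_toContinuousLinearMap, LinearMap.det_toLin, Matrix.det_fin_two_of, cr]
  ring

/-- Pairing with `a` and with `b` recovers `r * t` and `r * (1 - t)`, hence `r`, and then `t`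
because `r > 0`. -/
lemma duffy_injOn {p a b : Plane} (h : cr a b ≠ 0) : InjOn (duffy p a b) square := by
  rintro ⟨r, t⟩ ⟨⟨hr, -⟩, -⟩ ⟨r', t'⟩ - heq
  simp only [duffy, add_right_inj] at heq hr
  have e1 := congrArg (fun x => cr x b) heq
  have e2 := congrArg (fun x => cr a x) heq
  simp only [cr_smul_left, cr_add_left, cr_sub_left, cr_self, cr_smul_right, cr_add_right,
    cr_sub_right] at e1 e2
  have e3 : r * t = r' * t' := by
    apply mul_right_cancel₀ h; linarith
  have e4 : r = r' := by
    apply mul_right_cancel₀ h; linear_combination e1 + cr a b * e3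
  subst e4
  rw [Prod.mk.injEq]
  exact ⟨rfl, mul_left_cancel₀ hr.ne' e3⟩

lemma duffyPair_injOn {p a b : Plane} (h : cr a b ≠ 0) : InjOn (duffyPair p a b) square := by
  have := (planeEquiv.injective.injOn).comp (duffy_injOn (p := p) h) (mapsTo_univ _ _)
  exact this.congr fun q _ => planeEquiv_duffy p a b q

lemma preimage_duffyPair (p a b : Plane) :
    planeEquiv ⁻¹' (duffyPair p a b '' square) = tri p a b := by
  have : duffyPair p a b = planeEquiv ∘ duffy p a b := funext fun q => (planeEquiv_duffy p a b q).symm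
  rw [this, image_comp, preimage_image_eq _ planeEquiv.injective]; rfl

lemma measurableSet_tri {p a b : Plane} (h : cr a b ≠ 0) : MeasurableSet (tri p a b) :=
  measurableSet_square.image_of_continuousOn_injOn (continuous_duffy p a b).continuousOn
    (duffy_injOn h)

variable {F : Type*} [NormedAddCommGroup F] [NormedSpace ℝ F]

/-- Change of variables: the Jacobian of the collapsed coordinates is `r * cr a b`, and `r > 0` on
the open square. -/
lemma integral_tri {p a b : Plane} (h : cr a b ≠ 0) (f : Plane → F) :
    ∫ x in tri p a b, f x = |cr a b| • ∫ q in square, q.1 • f (duffy p a b q) := by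
  rw [← preimage_duffyPair]
  have e : ∀ x, f x = (f ∘ planeEquiv.symm) (planeEquiv x) := fun x => by simp
  simp_rw [e]
  rw [planeEquiv_preserving.setIntegral_preimage_emb planeEquiv.measurableEmbedding,
    integral_image_eq_integral_abs_det_fderiv_smul volume measurableSet_square
      (fun x _ => (hasFDerivAt_duffyPair p a b x).hasFDerivWithinAt) (duffyPair_injOn h),
    ← integral_smul]
  refine setIntegral_congr_fun measurableSet_square fun q hq => ?_
  have : 0 < q.1 := hq.1.1
  simp only [Function.comp, det_duffyDeriv, abs_mul, abs_of_pos this, ← planeEquiv_duffy,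
    MeasurableEquiv.symm_apply_apply, smul_smul, mul_comm]

lemma integrableOn_tri {p a b : Plane} (h : cr a b ≠ 0) (f : Plane → F) :
    IntegrableOn f (tri p a b) ↔ IntegrableOn (fun q => q.1 • f (duffy p a b q)) square := by
  rw [← preimage_duffyPair]
  have e : f = (f ∘ planeEquiv.symm) ∘ planeEquiv := by ext x; simp
  rw [e, planeEquiv_preserving.integrableOn_comp_preimage planeEquiv.measurableEmbedding,
    integrableOn_image_iff_integrableOn_abs_det_fderiv_smul volume measurableSet_square
      (fun x _ => (hasFDerivAt_duffyPair p a b x).hasFDerivWithinAt) (duffyPair_injOn h)]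
  have h2 : IntegrableOn (fun x : ℝ × ℝ => |(duffyDeriv a b x).det| •
      (f ∘ planeEquiv.symm) (duffyPair p a b x)) square ↔
      IntegrableOn (fun q => |cr a b| • (q.1 • f (duffy p a b q))) square := by
    refine integrableOn_congr_fun (fun q hq => ?_) measurableSet_square
    have : 0 < q.1 := hq.1.1
    simp only [Function.comp, det_duffyDeriv, abs_mul, abs_of_pos this, ← planeEquiv_duffy,
      MeasurableEquiv.symm_apply_apply, smul_smul, mul_comm]
  rw [h2]
  simp only [Function.comp, MeasurableEquiv.symm_apply_apply]
  exact integrable_smul_iff (abs_pos.2 h).ne' _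

lemma integral_square_eq (f : ℝ × ℝ → F) (hf : Continuous f) :
    ∫ q in square, f q = ∫ r in (0 : ℝ)..1, ∫ t in (0 : ℝ)..1, f (r, t) := by
  have hI : IntegrableOn f (Ioo (0:ℝ) 1 ×ˢ Ioo (0:ℝ) 1) :=
    (hf.continuousOn.integrableOn_compact
      (isCompact_Icc.prod isCompact_Icc)).mono_set square_subset
  rw [square, Measure.volume_eq_prod, setIntegral_prod _ hI]
  simp_rw [intervalIntegral.integral_of_le zero_le_one, integral_Ioc_eq_integral_Ioo]

omit [NormedSpace ℝ F] in
lemma integrableOn_square_of_continuous {f : ℝ × ℝ → F} (hf : Continuous f) : IntegrableOn f square :=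
  (hf.continuousOn.integrableOn_compact (isCompact_Icc.prod isCompact_Icc)).mono_set square_subset

lemma integrableOn_tri_of_continuous {p a b : Plane} (h : cr a b ≠ 0) {f : Plane → F}
    (hf : Continuous f) : IntegrableOn f (tri p a b) :=
  (integrableOn_tri h f).2 (integrableOn_square_of_continuous
    (continuous_fst.smul (hf.comp (continuous_duffy p a b))))

/-- Green's formula on a triangle in collapsed coordinates. -/
lemma green_duffy (p a b ξ : Plane) {f : Plane → ℝ} (hf : ContDiff ℝ 1 f) :
    cr a b * ∫ q in square, q.1 * fderiv ℝ f (duffy p a b q) ξ =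
      cr ξ (b - a) * (∫ t in (0 : ℝ)..1, f (p + (a + t • (b - a)))) -
        cr ξ b * (∫ r in (0 : ℝ)..1, f (p + r • b)) +
        cr ξ a * (∫ r in (0 : ℝ)..1, f (p + r • a)) := by
  have hd : Differentiable ℝ f := hf.differentiable (by norm_num)
  have hc : Continuous (fderiv ℝ f) := hf.continuous_fderiv (by norm_num)
  have hD : ∀ q : ℝ × ℝ, HasFDerivAt (duffy p a b)
      ((ContinuousLinearMap.fst ℝ ℝ ℝ).smulRight (a + q.2 • (b - a)) +
        (ContinuousLinearMap.snd ℝ ℝ ℝ).smulRight (q.1 • (b - a))) q := by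
    intro q
    have h1 : HasFDerivAt (fun q : ℝ × ℝ => q.1) (ContinuousLinearMap.fst ℝ ℝ ℝ) q := hasFDerivAt_fst
    have h2 : HasFDerivAt (fun q : ℝ × ℝ => q.2) (ContinuousLinearMap.snd ℝ ℝ ℝ) q := hasFDerivAt_snd
    unfold duffy
    convert! (h1.smul ((h2.smul_const (b - a)).const_add a)).const_add p using 1
    ext <;> simp
  have hF : ∀ q : ℝ × ℝ, HasFDerivAt (fun q : ℝ × ℝ => f (duffy p a b q))
      ((fderiv ℝ f (duffy p a b q)).comp _) q := fun q =>
    (hd _).hasFDerivAt.comp q (hD q)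
  have h1 : ∀ q : ℝ × ℝ, HasFDerivAt (fun q : ℝ × ℝ => q.1) (ContinuousLinearMap.fst ℝ ℝ ℝ) q :=
    fun q => hasFDerivAt_fst
  have h2 : ∀ q : ℝ × ℝ, HasFDerivAt (fun q : ℝ × ℝ => q.2) (ContinuousLinearMap.snd ℝ ℝ ℝ) q :=
    fun q => hasFDerivAt_snd
  -- The two components are the Piola transform of the constant-direction field `f ξ`, that is, the
  -- adjugate of the Jacobian matrix applied to it. The first vanishes at `r = 0`, so the collapsed
  -- side contributes nothing.
  have key := integral2_divergence_prod_of_hasFDerivAt_off_countable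
    (fun q : ℝ × ℝ => (q.1 * f (duffy p a b q)) * cr ξ (b - a))
    (fun q : ℝ × ℝ => -(f (duffy p a b q) * (cr ξ a + q.2 * cr ξ (b - a))))
    _ _ 0 0 1 1 ∅ countable_empty
    (Continuous.continuousOn (by have := hd.continuous; have := continuous_duffy p a b; fun_prop))
    (Continuous.continuousOn (by have := hd.continuous; have := continuous_duffy p a b; fun_prop))
    (fun q _ => ((h1 q).mul (hF q)).mul_const _)
    (fun q _ => ((hF q).mul (((h2 q).mul_const _).const_add (cr ξ a))).neg)
    (by
      refine ContinuousOn.integrableOn_compact (isCompact_uIcc.prod isCompact_uIcc) ?_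
      refine Continuous.continuousOn ?_
      simp only [smul_apply, add_apply,
        ContinuousLinearMap.comp_apply, neg_apply,
        ContinuousLinearMap.smulRight_apply, ContinuousLinearMap.coe_fst',
        ContinuousLinearMap.coe_snd']
      have := hd.continuous; have := continuous_duffy p a b
      fun_prop)
  -- The divergence of the transformed field is the Jacobian times the derivative along `ξ`; this is
  -- Cramer's rule under a linear form.
  have e0 : ∀ (L : Plane →L[ℝ] ℝ) (r t : ℝ),
      L (a + t • (b - a)) * cr ξ (b - a) * r - (L (b - a) * r) * (cr ξ a + t * cr ξ (b - a)) =
        cr a b * (r * L ξ) := by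
    intro L r t
    have : L (cr a b • ξ) = cr ξ b * L a + cr a ξ * L b := by
      rw [cr_smul_eq a b ξ]; simp
    simp only [map_smul, smul_eq_mul] at this
    simp only [map_add, map_smul, map_sub, smul_eq_mul, cr_sub_right]
    rw [cr_swap ξ a] at this
    linear_combination (-r) * this
  simp only [smul_apply, add_apply,
        ContinuousLinearMap.comp_apply, neg_apply,
        ContinuousLinearMap.smulRight_apply, ContinuousLinearMap.coe_fst',
        ContinuousLinearMap.coe_snd', smul_eq_mul] at key
  rw [integral_square_eq _ (by have := continuous_duffy p a b; fun_prop),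
    ← intervalIntegral.integral_const_mul]
  simp_rw [← intervalIntegral.integral_const_mul]
  rw [intervalIntegral.integral_congr (g := fun r => ∫ t in (0:ℝ)..1, cr a b * (r *
    fderiv ℝ f (duffy p a b (r, t)) ξ))] at key
  · rw [key]
    have ee : ∀ r : ℝ, p + r • (a + (b - a)) = p + r • b := fun r => by simp
    simp only [duffy, one_smul, zero_smul, add_zero, one_mul, zero_mul, intervalIntegral.integral_zero,
      intervalIntegral.integral_neg, intervalIntegral.integral_mul_const, cr_sub_right, ee,
      intervalIntegral.integral_const_mul]
    ring
  · intro r _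
    refine intervalIntegral.integral_congr fun t _ => ?_
    beta_reduce
    rw [← e0]
    simp
    ring

end VEM

end

noncomputable section

namespace VEM

/-! ### Geometry of star-shaped polygons -/

lemma volume_segment (a b : Plane) : volume (segment ℝ a b) = 0 := by
  have h : segment ℝ a b ⊆ (affineSpan ℝ {a, b} : Set Plane) := by
    rw [segment_eq_image_lineMap]
    rintro _ ⟨t, -, rfl⟩
    exact AffineMap.lineMap_mem_affineSpan_pair t a b
  refine measure_mono_null h (Measure.addHaar_affineSubspace _ _ fun htop => ?_)
  have h1 : Module.finrank ℝ (vectorSpan ℝ ({a, b} : Set Plane)) ≤ 1 :=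
    (collinear_iff_finrank_le_one).1 (collinear_pair ℝ a b)
  rw [← direction_affineSpan, htop, AffineSubspace.direction_top, finrank_top] at h1
  simp at h1

/-- Otherwise `U` and the complement of its closure would disconnect `S`. -/
lemma inter_frontier_nonempty_of_isPreconnected {X : Type*} [TopologicalSpace X] {S U : Set X}
    (hS : IsPreconnected S) (hU : IsOpen U) {x y : X} (hxS : x ∈ S) (hxU : x ∈ U) (hyS : y ∈ S)
    (hyU : y ∉ U) : (S ∩ frontier U).Nonempty := by
  by_contra! hemp
  have hcl : ∀ z ∈ S, z ∉ U → z ∉ closure U := fun z hz hzU hzc =>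
    (hemp ▸ (⟨hz, hzc, fun hi => hzU (interior_subset hi)⟩ : z ∈ S ∩ frontier U) : z ∈ (∅ : Set X))
  obtain ⟨z, -, hz1, hz2⟩ := hS U (closure U)ᶜ hU isClosed_closure.isOpen_compl
    (fun z hz => or_iff_not_imp_left.2 (hcl z hz)) ⟨x, hxS, hxU⟩ ⟨y, hyS, hcl y hyS hyU⟩
  exact hz2 (subset_closure hz1)

namespace Polygon

variable {E : Polygon}

lemma edgePoint_eq (i : E.Idx) (t : ℝ) :
    E.edgePoint i t = E.vertex i + t • (E.vertex (i + 1) - E.vertex i) := by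
  simp [edgePoint, AffineMap.lineMap_apply, add_comm]

@[simp] lemma edgePoint_zero (i : E.Idx) : E.edgePoint i 0 = E.vertex i := by simp [edgePoint_eq]

@[simp] lemma edgePoint_one (i : E.Idx) : E.edgePoint i 1 = E.vertex (i + 1) := by
  simp [edgePoint_eq]

lemma edgePoint_mem_segment (i : E.Idx) {t : ℝ} (ht : t ∈ Icc (0 : ℝ) 1) :
    E.edgePoint i t ∈ segment ℝ (E.vertex i) (E.vertex (i + 1)) := by
  rw [segment_eq_image_lineMap]; exact ⟨t, ht, rfl⟩

lemma edgePoint_mem_frontier (i : E.Idx) {t : ℝ} (ht : t ∈ Icc (0 : ℝ) 1) :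
    E.edgePoint i t ∈ frontier E.carrier := by
  rw [E.frontier_carrier]; exact mem_iUnion.2 ⟨i, edgePoint_mem_segment i ht⟩

lemma exists_edgePoint {x : Plane} (hx : x ∈ frontier E.carrier) :
    ∃ i, ∃ t ∈ Icc (0 : ℝ) 1, x = E.edgePoint i t := by
  rw [E.frontier_carrier] at hx
  obtain ⟨i, hi⟩ := mem_iUnion.1 hx
  rw [segment_eq_image_lineMap] at hi
  obtain ⟨t, ht, rfl⟩ := hi
  exact ⟨i, t, ht, rfl⟩

lemma notMem_of_frontier {x : Plane} (hx : x ∈ frontier E.carrier) : x ∉ E.carrier := fun h =>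
  (E.isOpen_carrier.inter_frontier_eq ▸ (⟨h, hx⟩ : x ∈ E.carrier ∩ frontier E.carrier) : x ∈ (∅ : Set Plane))

lemma edgePoint_notMem (i : E.Idx) {t : ℝ} (ht : t ∈ Icc (0 : ℝ) 1) :
    E.edgePoint i t ∉ E.carrier := notMem_of_frontier (edgePoint_mem_frontier i ht)

lemma edgePoint_mem_closure (i : E.Idx) {t : ℝ} (ht : t ∈ Icc (0 : ℝ) 1) :
    E.edgePoint i t ∈ closure E.carrier := frontier_subset_closure (edgePoint_mem_frontier i ht)

lemma vertex_mem_frontier (i : E.Idx) : E.vertex i ∈ frontier E.carrier := by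
  simpa using edgePoint_mem_frontier i (t := 0) (by simp)

lemma vertex_mem_closure (i : E.Idx) : E.vertex i ∈ closure E.carrier :=
  frontier_subset_closure (vertex_mem_frontier i)

lemma vertex_ne (i : E.Idx) : E.vertex i ≠ E.vertex (i + 1) := fun h => by
  have := E.vertex_injective h
  simp at this

lemma edgeLength_pos (i : E.Idx) : 0 < E.edgeLength i := dist_pos.2 (vertex_ne i)

lemma edgeLength_eq (i : E.Idx) : E.edgeLength i = ‖E.vertex (i + 1) - E.vertex i‖ := by
  rw [edgeLength, dist_comm, dist_eq_norm]

lemma edgePoint_injective (i : E.Idx) : Function.Injective (E.edgePoint i) := fun s t h => by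
  rw [edgePoint_eq, edgePoint_eq, add_right_inj] at h
  exact smul_left_injective ℝ (sub_ne_zero.2 (vertex_ne i).symm) h

lemma volume_frontier (E : Polygon) : volume (frontier E.carrier) = 0 := by
  rw [E.frontier_carrier]
  exact measure_iUnion_null fun i => volume_segment _ _

lemma measurableSet_carrier (E : Polygon) : MeasurableSet E.carrier := E.isOpen_carrier.measurableSet

lemma volume_lt_top (E : Polygon) : volume E.carrier < ⊤ := E.isBounded_carrier.measure_lt_top

instance (E : Polygon) : IsFiniteMeasure (volume.restrict E.carrier) :=
  ⟨by rw [Measure.restrict_apply_univ]; exact E.volume_lt_top⟩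

lemma isCompact_closure (E : Polygon) : IsCompact (closure E.carrier) :=
  E.isBounded_carrier.isCompact_closure

lemma dist_le_diam {x y : Plane} (hx : x ∈ closure E.carrier) (hy : y ∈ closure E.carrier) :
    dist x y ≤ E.diam := by
  rw [Polygon.diam, ← Metric.diam_closure]
  exact Metric.dist_le_diam_of_mem E.isBounded_carrier.closure hx hy

lemma diam_pos (E : Polygon) : 0 < E.diam :=
  lt_of_lt_of_le (dist_pos.2 (vertex_ne 0)) (dist_le_diam (vertex_mem_closure _) (vertex_mem_closure _))

lemma edgeLength_le (i : E.Idx) : E.edgeLength i ≤ E.diam :=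
  dist_le_diam (vertex_mem_closure _) (vertex_mem_closure _)

/-- The polygon is star-shaped with respect to all points of a ball that it contains. -/
structure StarBall (E : Polygon) (c : Plane) (r : ℝ) : Prop where
  pos : 0 < r
  ball_subset : Metric.ball c r ⊆ E.carrier
  star : ∀ y ∈ Metric.ball c r, StarConvex ℝ y E.carrier

/-- Twice the signed area of the triangle spanned by `c` and an edge. -/
def fanDet (E : Polygon) (c : Plane) (i : E.Idx) : ℝ := cr (E.vertex i - c) (E.vertex (i + 1) - c)

/-- The open triangle spanned by `c` and an edge. -/
def fanTri (E : Polygon) (c : Plane) (i : E.Idx) : Set Plane :=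
  tri c (E.vertex i - c) (E.vertex (i + 1) - c)

lemma duffy_fan (c : Plane) (i : E.Idx) (r t : ℝ) :
    duffy c (E.vertex i - c) (E.vertex (i + 1) - c) (r, t) = c + r • (E.edgePoint i t - c) := by
  rw [duffy, edgePoint_eq]; congr 2; simp; abel

lemma fanDet_eq (c : Plane) (i : E.Idx) :
    E.fanDet c i = cr (E.vertex i - c) (E.vertex (i + 1) - E.vertex i) := by
  simp [fanDet, cr]; ring

namespace StarBall

variable {c : Plane} {r : ℝ}

lemma center_mem (h : E.StarBall c r) : c ∈ E.carrier := h.ball_subset (Metric.mem_ball_self h.pos)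

/-- Approximate `z` by `z'` inside the polygon and move `y` to `y + (s / (1 - s)) (z - z')`: the
combination with weights `1 - s` and `s` is unchanged, and for `z'` close to `z` the moved point is
still in the ball. So boundary points are visible from the ball through the open polygon. -/
lemma add_smul_mem (h : E.StarBall c r) {y z : Plane} (hy : y ∈ Metric.ball c r)
    (hz : z ∈ closure E.carrier) {s : ℝ} (hs : 0 ≤ s) (hs1 : s < 1) :
    y + s • (z - y) ∈ E.carrier := by
  have hs2 : 0 < 1 - s := by linarith
  have hcont : Tendsto (fun z' : Plane => y + (s / (1 - s)) • (z - z')) (𝓝 z) (𝓝 y) := by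
    have : Continuous fun z' : Plane => y + (s / (1 - s)) • (z - z') := by fun_prop
    simpa using this.tendsto z
  have hev := hcont.eventually (Metric.isOpen_ball.mem_nhds hy)
  obtain ⟨z', hz', hzE⟩ := (mem_closure_iff_frequently.1 hz).and_eventually hev |>.exists
  have := h.star _ hzE hz' hs2.le hs (by ring)
  convert this using 1
  rw [smul_add, smul_smul, mul_div_cancel₀ _ hs2.ne']
  module

/-- The determinant is the edge length times the distance from `c` to the line of the edge. If that
line met the ball in a point `y`, then either `y` would lie on the edge or one endpoint would lie
strictly between `y` and the other; each places a boundary point inside the open polygon. -/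
lemma r_mul_edgeLength_le (h : E.StarBall c r) (i : E.Idx) :
    r * E.edgeLength i ≤ |E.fanDet c i| := by
  by_contra! hlt
  set e := E.vertex (i + 1) - E.vertex i with he
  have hpos := edgeLength_pos i
  have hL : E.edgeLength i ^ 2 = e 0 ^ 2 + e 1 ^ 2 := by rw [edgeLength_eq, norm_sq_eq]
  set L := E.edgeLength i with hLdef
  set D := E.fanDet c i with hD
  have hL2 : 0 < L ^ 2 := by positivity
  -- The foot of the perpendicular from `c` to the line of the edge.
  set y : Plane := c + (D / L ^ 2) • !₂[e 1, -e 0] with hy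
  have hyc : cr (y - c) e = D := by
    simp only [hy, add_sub_cancel_left, cr_smul_left]
    rw [div_mul_eq_mul_div, div_eq_iff hL2.ne', hL, cr]
    simp only [Matrix.cons_val_zero, Matrix.cons_val_one]; ring
  have hyb : y ∈ Metric.ball c r := by
    rw [Metric.mem_ball, dist_eq_norm]
    have : ‖y - c‖ ^ 2 = (|D| / L) ^ 2 := by
      rw [norm_sq_eq, div_pow, sq_abs]
      simp only [hy, add_sub_cancel_left]
      simp only [PiLp.smul_apply, smul_eq_mul]
      simp only [Matrix.cons_val_zero, Matrix.cons_val_one]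
      field_simp
      rw [hL]; ring
    rw [(sq_eq_sq₀ (norm_nonneg _) (by positivity)).1 this, div_lt_iff₀ hpos]
    exact hlt
  have hcr : cr (E.vertex i - y) e = 0 := by
    have : E.vertex i - y = (E.vertex i - c) - (y - c) := by abel
    rw [this, cr_sub_left, hyc, hD, fanDet_eq, sub_self]
  obtain ⟨τ, hτ⟩ : ∃ τ : ℝ, E.vertex i - y = τ • e := by
    refine ⟨((E.vertex i - y) 0 * e 0 + (E.vertex i - y) 1 * e 1) / L ^ 2, ?_⟩
    rw [cr] at hcr
    ext j
    rw [PiLp.smul_apply, smul_eq_mul, div_mul_eq_mul_div, eq_div_iff hL2.ne', hL]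
    fin_cases j
    · simp only [Fin.zero_eta]; linear_combination (e 1) * hcr
    · simp only [Fin.mk_one]; linear_combination (-e 0) * hcr
  have hyE := h.ball_subset hyb
  have h0 : E.vertex i = y + τ • e := by rw [← hτ]; abel
  have h1 : E.vertex (i + 1) = y + (τ + 1) • e := by
    have : E.vertex (i + 1) = E.vertex i + e := by rw [he]; abel
    rw [this, h0]; module
  rcases lt_or_ge 0 τ with hp | hn
  · have := h.add_smul_mem hyb (vertex_mem_closure (i + 1)) (s := τ / (τ + 1)) (by positivity)
      (by rw [div_lt_one (by positivity)]; linarith)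
    rw [h1, add_sub_cancel_left, smul_smul, div_mul_cancel₀ _ (by positivity), ← h0] at this
    exact notMem_of_frontier (vertex_mem_frontier i) this
  · rcases lt_or_ge τ (-1) with hm | hm
    · have hτ0 : τ ≠ 0 := by linarith
      have := h.add_smul_mem hyb (vertex_mem_closure i) (s := (τ + 1) / τ)
        (div_nonneg_of_nonpos (by linarith) (by linarith))
        (by rw [div_lt_one_of_neg (by linarith)]; linarith)
      rw [hτ, smul_smul, div_mul_cancel₀ _ hτ0, ← h1] at this
      exact notMem_of_frontier (vertex_mem_frontier (i + 1)) this
    · refine edgePoint_notMem i (t := -τ) ⟨by linarith, by linarith⟩ ?_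
      rw [edgePoint_eq, ← he, h0]
      convert hyE using 1
      module

lemma fanDet_ne_zero (h : E.StarBall c r) (i : E.Idx) : E.fanDet c i ≠ 0 :=
  abs_pos.1 (lt_of_lt_of_le (mul_pos h.pos (edgeLength_pos i)) (h.r_mul_edgeLength_le i))

lemma measurableSet_fanTri (h : E.StarBall c r) (i : E.Idx) : MeasurableSet (E.fanTri c i) :=
  measurableSet_tri (h.fanDet_ne_zero i)

lemma center_add_mem (h : E.StarBall c r) (i : E.Idx) {s t : ℝ} (hs : 0 ≤ s) (hs1 : s < 1)
    (ht : t ∈ Icc (0 : ℝ) 1) : c + s • (E.edgePoint i t - c) ∈ E.carrier :=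
  h.add_smul_mem (Metric.mem_ball_self h.pos) (edgePoint_mem_closure i ht) hs hs1

lemma fanTri_subset (h : E.StarBall c r) (i : E.Idx) : E.fanTri c i ⊆ E.carrier := by
  rintro _ ⟨⟨s, t⟩, ⟨hs, ht⟩, rfl⟩
  rw [duffy_fan]
  exact h.center_add_mem i hs.1.le hs.2 ⟨ht.1.le, ht.2.le⟩

/-- A common point lies on one ray from `c` to two edge points. If these are at different distances,
the nearer one is interior to the polygon. If they coincide, two edges meet at a point that is not
an endpoint, against simplicity. -/
lemma fanTri_disjoint (h : E.StarBall c r) : Pairwise (Function.onFun Disjoint (E.fanTri c)) := by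
  intro i j hij
  rw [Function.onFun, Set.disjoint_left]
  rintro _ ⟨⟨s, t⟩, ⟨hs, ht⟩, rfl⟩ ⟨⟨s', t'⟩, ⟨hs', ht'⟩, heq⟩
  rw [duffy_fan, duffy_fan, add_right_inj] at heq
  dsimp only at hs ht hs' ht'
  have hti : t ∈ Icc (0 : ℝ) 1 := ⟨ht.1.le, ht.2.le⟩
  have hti' : t' ∈ Icc (0 : ℝ) 1 := ⟨ht'.1.le, ht'.2.le⟩
  rcases lt_trichotomy s s' with hlt | rfl | hlt
  · apply edgePoint_notMem j hti'
    have := h.center_add_mem i (s := s / s') (div_nonneg hs.1.le hs'.1.le)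
      ((div_lt_one hs'.1).2 hlt) hti
    rw [div_eq_inv_mul, mul_smul, ← heq, smul_smul, inv_mul_cancel₀ hs'.1.ne', one_smul] at this
    simpa using this
  · have hpt : E.edgePoint j t' = E.edgePoint i t := by
      have := smul_right_injective Plane hs.1.ne' heq
      simpa using this
    have hi := edgePoint_mem_segment i hti
    have hj := edgePoint_mem_segment j hti'
    rw [hpt] at hj
    by_cases h1 : j = i + 1
    · subst h1
      have : E.edgePoint i t ∈ ({E.vertex (i + 1)} : Set Plane) :=
        (E.adjacent_edges i).le ⟨hi, hj⟩
      rw [mem_singleton_iff, ← edgePoint_one] at this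
      exact ht.2.ne (edgePoint_injective i this)
    · by_cases h2 : i = j + 1
      · subst h2
        have : E.edgePoint (j + 1) t ∈ ({E.vertex (j + 1)} : Set Plane) :=
          (E.adjacent_edges j).le ⟨hj, hi⟩
        rw [mem_singleton_iff, ← edgePoint_zero (j + 1)] at this
        exact ht.1.ne' (edgePoint_injective (j + 1) this)
      · exact Set.disjoint_left.1 (E.disjoint_edges i j hij.symm h1 h2) hi hj
  · apply edgePoint_notMem i hti
    have := h.center_add_mem j (s := s' / s) (div_nonneg hs'.1.le hs.1.le)
      ((div_lt_one hs.1).2 hlt) hti'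
    rw [div_eq_inv_mul, mul_smul, heq, smul_smul, inv_mul_cancel₀ hs.1.ne', one_smul] at this
    simpa using this

/-- The ray from `c` through `x` must leave the bounded polygon beyond `x`, and it does so on an
edge. -/
lemma exists_polar (h : E.StarBall c r) {x : Plane} (hx : x ∈ E.carrier) (hxc : x ≠ c) :
    ∃ i, ∃ s ∈ Ioo (0 : ℝ) 1, ∃ t ∈ Icc (0 : ℝ) 1, x = c + s • (E.edgePoint i t - c) := by
  -- `R` is chosen so that `c + R (x - c)` has distance `diam + 1` from `c`, hence is outside.
  have hn : 0 < ‖x - c‖ := norm_pos_iff.2 (sub_ne_zero.2 hxc)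
  set R := (E.diam + 1) / ‖x - c‖ with hR
  have hd := E.diam_pos
  have hRpos : 0 < R := by positivity
  have hout : c + R • (x - c) ∉ E.carrier := fun hm => by
    have := dist_le_diam (subset_closure hm) (subset_closure h.center_mem)
    rw [dist_eq_norm, add_sub_cancel_left, norm_smul, Real.norm_of_nonneg hRpos.le, hR,
      div_mul_cancel₀ _ hn.ne'] at this
    linarith
  obtain ⟨y, hyS, hyF⟩ := inter_frontier_nonempty_of_isPreconnected
    (convex_segment (𝕜 := ℝ) x (c + R • (x - c))).isPreconnected E.isOpen_carrier
    (left_mem_segment _ _ _) hx (right_mem_segment _ _ _) hout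
  have hR1 : 1 < R := by
    rw [hR, lt_div_iff₀ hn, one_mul]
    have := dist_le_diam (subset_closure hx) (subset_closure h.center_mem)
    rw [dist_eq_norm] at this; linarith
  rw [segment_eq_image_lineMap] at hyS
  obtain ⟨τ, hτ, rfl⟩ := hyS
  obtain ⟨i, t, ht, hit⟩ := exists_edgePoint hyF
  have heq : AffineMap.lineMap x (c + R • (x - c)) τ = c + (1 + τ * (R - 1)) • (x - c) := by
    rw [AffineMap.lineMap_apply]; simp only [vsub_eq_sub, vadd_eq_add]; module
  have hk : 1 < 1 + τ * (R - 1) := by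
    rcases hτ.1.eq_or_lt with h0 | h0
    · exfalso
      rw [← h0, AffineMap.lineMap_apply_zero] at hyF
      exact notMem_of_frontier hyF hx
    · nlinarith [mul_pos h0 (sub_pos.2 hR1)]
  refine ⟨i, (1 + τ * (R - 1))⁻¹, ⟨by positivity, inv_lt_one_of_one_lt₀ hk⟩, t, ht, ?_⟩
  rw [← hit, heq, add_sub_cancel_left, smul_smul, inv_mul_cancel₀ (by linarith), one_smul]
  abel

/-- In polar coordinates the fan misses at most the segments from `c` to the vertices, which are
null. -/
lemma carrier_ae_eq (h : E.StarBall c r) :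
    E.carrier =ᵐ[volume] (⋃ i, E.fanTri c i : Set Plane) := by
  refine (ae_le_set.2 ?_).antisymm (LE.le.eventuallyLE (iUnion_subset h.fanTri_subset))
  have hsub : E.carrier \ ⋃ i, E.fanTri c i ⊆ ⋃ i, segment ℝ c (E.vertex i) := by
    rintro x ⟨hx, hxn⟩
    rw [mem_iUnion]
    by_cases hxc : x = c
    · exact ⟨0, hxc ▸ left_mem_segment _ _ _⟩
    obtain ⟨i, s, hs, t, ht, rfl⟩ := h.exists_polar hx hxc
    have hseg : ∀ z : Plane, c + s • (z - c) ∈ segment ℝ c z := fun z => by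
      rw [segment_eq_image_lineMap]
      exact ⟨s, ⟨hs.1.le, hs.2.le⟩, by rw [AffineMap.lineMap_apply]; simp [add_comm]⟩
    rcases ht.1.eq_or_lt with h0 | h0
    · exact ⟨i, by rw [← h0, edgePoint_zero]; exact hseg _⟩
    rcases ht.2.eq_or_lt with h1 | h1
    · exact ⟨i + 1, by rw [h1, edgePoint_one]; exact hseg _⟩
    exact absurd (mem_iUnion_of_mem i (⟨(s, t), ⟨hs, h0, h1⟩, duffy_fan _ _ _ _⟩ : _ ∈ E.fanTri c i)) hxn
  exact measure_mono_null hsub (measure_iUnion_null fun i => volume_segment _ _)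

lemma integral_eq_sum (h : E.StarBall c r) {F : Type*} [NormedAddCommGroup F] [NormedSpace ℝ F]
    {f : Plane → F} (hf : ∀ i, IntegrableOn f (E.fanTri c i)) :
    ∫ x in E.carrier, f x = ∑ i, ∫ x in E.fanTri c i, f x := by
  rw [setIntegral_congr_set h.carrier_ae_eq]
  exact integral_iUnion_fintype h.measurableSet_fanTri h.fanTri_disjoint hf

/-- With opposite signs, both neighbours of the common vertex would lie on the same side of the ray
through it, and the two fan triangles would overlap near the midpoint of that ray's segment. -/
lemma fanDet_mul_pos (h : E.StarBall c r) (i : E.Idx) : 0 < E.fanDet c i * E.fanDet c (i + 1) := by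
  by_contra! hle
  have h1 := h.fanDet_ne_zero i
  have h2 := h.fanDet_ne_zero (i + 1)
  have hneg : E.fanDet c i * E.fanDet c (i + 1) < 0 := lt_of_le_of_ne hle (mul_ne_zero h1 h2)
  set a := E.vertex i - c with ha
  set b := E.vertex (i + 1) - c with hb
  set d := E.vertex (i + 1 + 1) - c with hd
  have hab : E.fanDet c i = cr a b := rfl
  have hbd : E.fanDet c (i + 1) = cr b d := rfl
  set D := cr a b with hD
  -- `d = α b + β a` with `β > 0`
  have hdecomp : d = (cr a d / D) • b + (-cr b d / D) • a := by
    have := cr_smul_eq a b d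
    rw [← hD] at this
    have h3 := congrArg (fun z => D⁻¹ • z) this
    simp only [smul_smul, smul_add, inv_mul_cancel₀ (hab ▸ h1), one_smul] at h3
    refine h3.trans ?_
    rw [cr_swap b d]; module
  set α := cr a d / D
  set β := -cr b d / D with hβ
  have hβpos : 0 < β := by
    rw [hβ, ← hbd, ← hab]
    rcases lt_or_gt_of_ne h1 with h1' | h1'
    · exact div_pos_of_neg_of_neg (by nlinarith) h1'
    · exact div_pos (by nlinarith) h1'
  have hdis := h.fanTri_disjoint (i := i) (j := i + 1) (by simp)
  rw [Function.onFun, Set.disjoint_left] at hdis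
  have hmem : ∀ (p u v : Plane) (x y : ℝ), 0 < x → 0 < y → x + y < 1 → p + (x • u + y • v) ∈ tri p u v := by
    intro p u v x y hx hy hxy
    refine ⟨(x + y, y / (x + y)), ⟨⟨by positivity, hxy⟩, by positivity, by
      rw [div_lt_one (by positivity)]; linarith⟩, ?_⟩
    have hne : x + y ≠ 0 := by positivity
    simp only [duffy, smul_add, smul_smul, mul_div_cancel₀ _ hne]
    module
  -- Small enough that `(1 / 2) b + ε d` has positive coordinates with sum below `1` in both bases
  -- `(a, b)` and `(b, d)`.
  set ε := min (1 / (4 * (|α| + 1))) (min (1 / (8 * (β + 1))) (1 / 4)) with hε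
  have hεpos : 0 < ε := by positivity
  have hε1 : ε * |α| ≤ 1 / 4 := by
    have : ε ≤ 1 / (4 * (|α| + 1)) := min_le_left _ _
    rw [le_div_iff₀ (by positivity)] at this
    nlinarith [abs_nonneg α]
  have hε2 : ε * β ≤ 1 / 8 := by
    have : ε ≤ 1 / (8 * (β + 1)) := (min_le_right _ _).trans (min_le_left _ _)
    rw [le_div_iff₀ (by positivity)] at this
    nlinarith
  have hε3 : ε ≤ 1 / 4 := (min_le_right _ _).trans (min_le_right _ _)
  have hα1 : ε * α ≤ 1 / 4 := (mul_le_mul_of_nonneg_left (le_abs_self α) hεpos.le).trans hε1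
  have hα2 : -(1 / 4) ≤ ε * α := by
    have := mul_le_mul_of_nonneg_left (neg_abs_le α) hεpos.le
    linarith
  have hβε : 0 < ε * β := by positivity
  have e1 : c + ((1 / 2 : ℝ) • b + ε • d) ∈ E.fanTri c (i + 1) :=
    hmem c b d (1 / 2) ε (by norm_num) hεpos (by linarith)
  refine hdis ?_ e1
  have : (1 / 2 : ℝ) • b + ε • d = (ε * β) • a + (1 / 2 + ε * α) • b := by
    rw [hdecomp]; module
  rw [this]
  exact hmem c a b _ _ hβε (by linarith) (by linarith)

/-- The sign of the orientation of the polygon, seen from an edge. -/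
def _root_.VEM.Polygon.fanSign (E : Polygon) (c : Plane) (i : E.Idx) : ℝ := SignType.sign (E.fanDet c i)

lemma abs_fanDet (c : Plane) (i : E.Idx) : |E.fanDet c i| = E.fanSign c i * E.fanDet c i :=
  (sign_mul_self (E.fanDet c i)).symm

lemma fanSign_succ (h : E.StarBall c r) (i : E.Idx) : E.fanSign c (i + 1) = E.fanSign c i := by
  have := h.fanDet_mul_pos i
  unfold fanSign
  rcases pos_and_pos_or_neg_and_neg_of_mul_pos this with ⟨h1, h2⟩ | ⟨h1, h2⟩
  · rw [sign_pos h1, sign_pos h2]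
  · rw [sign_neg h1, sign_neg h2]

/-- Green's formula for functions that are piecewise smooth on the fan of triangles. -/
lemma green_fan (h : E.StarBall c r) (ξ : Plane) {f : E.Idx → Plane → ℝ}
    (hf : ∀ i, ContDiff ℝ 1 (f i))
    (hmatch : ∀ i, ∀ s : ℝ, f i (c + s • (E.vertex (i + 1) - c)) =
      f (i + 1) (c + s • (E.vertex (i + 1) - c))) :
    ∑ i, ∫ x in E.fanTri c i, fderiv ℝ (f i) x ξ =
      ∑ i, E.fanSign c i * cr ξ (E.vertex (i + 1) - E.vertex i) *
        ∫ t in (0 : ℝ)..1, f i (E.edgePoint i t) := by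
  -- The contribution of the radial side through vertex `i`. The two triangles sharing the side
  -- contribute with opposite signs, because the orientation is constant around the polygon and the
  -- two functions agree there; the cyclic sum cancels.
  set A : E.Idx → ℝ := fun i => E.fanSign c i *
    (cr ξ (E.vertex i - c) * ∫ s in (0 : ℝ)..1, f i (c + s • (E.vertex i - c))) with hA
  have key : ∀ i, ∫ x in E.fanTri c i, fderiv ℝ (f i) x ξ =
      E.fanSign c i * cr ξ (E.vertex (i + 1) - E.vertex i) *
        (∫ t in (0 : ℝ)..1, f i (E.edgePoint i t)) - A (i + 1) + A i := by
    intro i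
    rw [fanTri, integral_tri (h.fanDet_ne_zero i)]
    change |E.fanDet c i| • _ = _
    rw [abs_fanDet, smul_eq_mul, mul_assoc]
    simp only [smul_eq_mul]
    rw [show E.fanDet c i = cr (E.vertex i - c) (E.vertex (i + 1) - c) from rfl,
      green_duffy c _ _ ξ (hf i)]
    simp only [hA, h.fanSign_succ, ← hmatch]
    have e : ∀ t : ℝ, c + (E.vertex i - c + t • (E.vertex (i + 1) - c - (E.vertex i - c))) =
        E.edgePoint i t := fun t => by rw [edgePoint_eq, sub_sub_sub_cancel_right]; abel
    simp only [e]
    rw [sub_sub_sub_cancel_right]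
    ring
  simp_rw [key, Finset.sum_add_distrib, Finset.sum_sub_distrib]
  have : ∑ i, A (i + 1) = ∑ i, A i := Equiv.sum_comp (Equiv.addRight (1 : E.Idx)) A
  rw [this]; ring

lemma edgeLength_mul_inner_edgeNormal (ξ : Plane) (i : E.Idx) :
    E.edgeLength i * inner ℝ ξ (E.edgeNormal i) = cr ξ (E.vertex (i + 1) - E.vertex i) := by
  rw [edgeNormal, inner_smul_right, mul_inv_cancel_left₀ (edgeLength_pos i).ne', inner_eq, cr]
  simp; ring

/-- Seen from `c`, moving the midpoint by `-t n` multiplies the radial coordinate by `1 - t L / D`,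
where `L` is the edge length and `D` the fan determinant. For `D > 0` the point enters the polygon.
For `D < 0` it goes past the edge, and were it inside, star-shapedness would put an edge point
inside. -/
lemma outwardNormal_eq (h : E.StarBall c r) (i : E.Idx) :
    E.outwardNormal i = E.fanSign c i • E.edgeNormal i := by
  set n := E.edgeNormal i with hn
  set e := E.vertex (i + 1) - E.vertex i with he
  have hL := edgeLength_pos i
  have hL2 : E.edgeLength i ^ 2 = e 0 ^ 2 + e 1 ^ 2 := by rw [edgeLength_eq, norm_sq_eq]
  set D := E.fanDet c i with hD
  have hD0 := h.fanDet_ne_zero i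
  set m := E.edgePoint i (1 / 2) with hm
  have hcrn : cr n e = E.edgeLength i := by
    rw [hn, edgeNormal, cr_smul_left, inv_mul_eq_iff_eq_mul₀ hL.ne', ← pow_two, hL2]
    simp [cr, he]; ring
  have hcrm : cr (m - c) e = D := by
    have : m - c = (E.vertex i - c) + (1 / 2 : ℝ) • e := by rw [hm, edgePoint_eq]; abel
    rw [this, cr_add_left, cr_smul_left, cr_self, mul_zero, add_zero, hD, fanDet_eq]
  set k := cr (m - c) n with hk
  -- Polar coordinates of the displaced midpoint: `s` is the radial coordinate and `τ` the parameter
  -- on the edge. They tend to `1` and `1 / 2` as `t` tends to zero.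
  set s : ℝ → ℝ := fun t => 1 - t * E.edgeLength i / D with hs
  set τ : ℝ → ℝ := fun t => 1 / 2 - (t * k / D) / s t with hτ
  have hsc : Tendsto s (𝓝[>] 0) (𝓝 1) := by
    have : Continuous s := by fun_prop
    simpa [hs] using (this.tendsto 0).mono_left nhdsWithin_le_nhds
  have hτc : Tendsto τ (𝓝[>] 0) (𝓝 (1 / 2)) := by
    have h1 : Continuous fun t : ℝ => t * k / D := by fun_prop
    have h2 : Tendsto (fun t : ℝ => t * k / D) (𝓝[>] 0) (𝓝 0) := by
      simpa using (h1.tendsto 0).mono_left nhdsWithin_le_nhds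
    have h3 := (h2.div hsc one_ne_zero).const_sub (1 / 2)
    rwa [zero_div, sub_zero] at h3
  have hev : ∀ᶠ t in 𝓝[>] (0 : ℝ), 0 < t ∧ 0 < s t ∧ τ t ∈ Icc (0 : ℝ) 1 :=
    (eventually_mem_nhdsWithin).and ((hsc.eventually (lt_mem_nhds one_pos)).and
      (hτc.eventually (Icc_mem_nhds (by norm_num) (by norm_num))))
  have hdec : ∀ t : ℝ, s t ≠ 0 → m - t • n = c + s t • (E.edgePoint i (τ t) - c) := by
    intro t h0
    have h1 : D • n = E.edgeLength i • (m - c) + k • e := by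
      have := cr_smul_eq (m - c) e n
      rwa [hcrm, hcrn] at this
    have h2 : n = (E.edgeLength i / D) • (m - c) + (k / D) • e := by
      rw [div_eq_inv_mul, div_eq_inv_mul, mul_smul, mul_smul, ← smul_add, ← h1, smul_smul,
        inv_mul_cancel₀ hD0, one_smul]
    have h3 : E.edgePoint i (τ t) - c = (m - c) - ((t * k / D) / s t) • e := by
      rw [hm, edgePoint_eq, edgePoint_eq, hτ]; module
    rw [h3, smul_sub, smul_smul, mul_div_cancel₀ _ h0]
    calc m - t • n = m - t • ((E.edgeLength i / D) • (m - c) + (k / D) • e) := by rw [← h2]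
      _ = _ := by simp only [hs]; module
  unfold outwardNormal fanSign
  rcases lt_or_gt_of_ne hD0 with hneg | hpos
  · rw [if_neg, sign_neg hneg]
    · simp [hn]
    intro hcon
    obtain ⟨t, hmem, ht, hst, hτt⟩ := (hcon.and hev).exists
    rw [← hm, ← hn, hdec t hst.ne'] at hmem
    have hs1 : 1 < s t := by
      have : t * E.edgeLength i / D < 0 := div_neg_of_pos_of_neg (by positivity) hneg
      simp only [hs]; linarith
    have := h.add_smul_mem (Metric.mem_ball_self h.pos) (subset_closure hmem) (s := (s t)⁻¹)
      (by positivity) (inv_lt_one_of_one_lt₀ hs1)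
    rw [add_sub_cancel_left, smul_smul, inv_mul_cancel₀ hst.ne', one_smul, add_sub_cancel] at this
    exact edgePoint_notMem i hτt this
  · rw [if_pos, sign_pos hpos]
    · simp [hn]
    filter_upwards [hev] with t ⟨ht, hst, hτt⟩
    rw [← hm, ← hn, hdec t hst.ne']
    refine h.center_add_mem i hst.le ?_ hτt
    have : 0 < t * E.edgeLength i / D := by positivity
    simp only [hs]; linarith

lemma edgeLength_mul_inner_outwardNormal (h : E.StarBall c r) (ξ : Plane) (i : E.Idx) :
    E.edgeLength i * inner ℝ ξ (E.outwardNormal i) =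
      E.fanSign c i * cr ξ (E.vertex (i + 1) - E.vertex i) := by
  rw [h.outwardNormal_eq, inner_smul_right, ← edgeLength_mul_inner_edgeNormal]; ring

lemma norm_sub_le (h : E.StarBall c r) {x : Plane} (hx : x ∈ closure E.carrier) :
    ‖x - c‖ ≤ E.diam := by
  rw [← dist_eq_norm]; exact dist_le_diam hx (subset_closure h.center_mem)

lemma carrier_subset_closedBall (h : E.StarBall c r) :
    E.carrier ⊆ Metric.closedBall c E.diam := fun x hx => by
  rw [Metric.mem_closedBall, dist_eq_norm]; exact h.norm_sub_le (subset_closure hx)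

end StarBall

end Polygon
end VEM

end

noncomputable section

namespace VEM

/-! ### The `L²` seminorm -/

section L2

variable {α : Type*} [MeasurableSpace α] {ν : Measure α}
variable {H : Type*} [NormedAddCommGroup H]

/-- The `L²` seminorm. -/
def l2 (ν : Measure α) (f : α → H) : ℝ := Real.sqrt (∫ x, ‖f x‖ ^ 2 ∂ν)

lemma l2_nonneg (f : α → H) : 0 ≤ l2 ν f := Real.sqrt_nonneg _

lemma l2_sq (f : α → H) : l2 ν f ^ 2 = ∫ x, ‖f x‖ ^ 2 ∂ν :=
  Real.sq_sqrt (integral_nonneg fun _ => by positivity)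

lemma l2_sq_real (f : α → ℝ) : l2 ν f ^ 2 = ∫ x, f x ^ 2 ∂ν := by
  simp only [l2_sq, Real.norm_eq_abs, sq_abs]

lemma l2_congr {f g : α → H} (h : f =ᵐ[ν] g) : l2 ν f = l2 ν g := by
  unfold l2; congr 1; exact integral_congr_ae (h.mono fun x hx => by simp [hx])

lemma l2_eq_norm {f : α → H} (hf : MemLp f 2 ν) : l2 ν f = ‖hf.toLp f‖ := by
  rw [Lp.norm_toLp, hf.eLpNorm_eq_integral_rpow_norm (by norm_num) (by norm_num), ENNReal.toReal_ofReal
    (by positivity), l2, Real.sqrt_eq_rpow]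
  norm_num

lemma l2_add_le {f g : α → H} (hf : MemLp f 2 ν) (hg : MemLp g 2 ν) :
    l2 ν (fun x => f x + g x) ≤ l2 ν f + l2 ν g := by
  rw [l2_eq_norm hf, l2_eq_norm hg, show (fun x => f x + g x) = f + g from rfl,
    l2_eq_norm (hf.add hg), MemLp.toLp_add]
  exact norm_add_le _ _

lemma l2_sub_le {f g : α → H} (hf : MemLp f 2 ν) (hg : MemLp g 2 ν) :
    l2 ν (fun x => f x - g x) ≤ l2 ν f + l2 ν g := by
  rw [l2_eq_norm hf, l2_eq_norm hg, show (fun x => f x - g x) = f - g from rfl,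
    l2_eq_norm (hf.sub hg), MemLp.toLp_sub]
  exact norm_sub_le _ _

lemma l2_sub_comm (f g : α → H) : l2 ν (fun x => f x - g x) = l2 ν (fun x => g x - f x) := by
  unfold l2; simp_rw [norm_sub_rev]

lemma l2_le_add_sub {f g : α → H} (hf : MemLp f 2 ν) (hg : MemLp g 2 ν) :
    l2 ν f ≤ l2 ν g + l2 ν (fun x => f x - g x) := by
  have := l2_add_le hg (hf.sub hg)
  simp only [Pi.sub_apply, add_sub_cancel] at this
  exact this

lemma abs_integral_inner_le [InnerProductSpace ℝ H] {f g : α → H} (hf : MemLp f 2 ν)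
    (hg : MemLp g 2 ν) : |∫ x, inner ℝ (f x) (g x) ∂ν| ≤ l2 ν f * l2 ν g := by
  have h : ∫ x, inner ℝ (f x) (g x) ∂ν = inner ℝ (hf.toLp f) (hg.toLp g) := by
    rw [L2.inner_def]
    refine integral_congr_ae ?_
    filter_upwards [hf.coeFn_toLp, hg.coeFn_toLp] with x h1 h2
    rw [h1, h2]
  rw [h, l2_eq_norm hf, l2_eq_norm hg]
  exact abs_real_inner_le_norm _ _

lemma abs_integral_mul_le {f g : α → ℝ} (hf : MemLp f 2 ν) (hg : MemLp g 2 ν) :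
    |∫ x, f x * g x ∂ν| ≤ l2 ν f * l2 ν g := by
  have := abs_integral_inner_le hf hg
  simpa [mul_comm] using this

lemma integrable_inner [InnerProductSpace ℝ H] {f g : α → H} (hf : MemLp f 2 ν) (hg : MemLp g 2 ν) :
    Integrable (fun x => inner ℝ (f x) (g x)) ν := by
  refine (integrable_congr ?_).1 (L2.integrable_inner (𝕜 := ℝ) (hf.toLp f) (hg.toLp g))
  filter_upwards [hf.coeFn_toLp, hg.coeFn_toLp] with x h1 h2
  rw [h1, h2]

lemma integrable_mul {f g : α → ℝ} (hf : MemLp f 2 ν) (hg : MemLp g 2 ν) :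
    Integrable (fun x => f x * g x) ν := hf.integrable_mul hg

lemma integrable_norm_sq {f : α → H} (hf : MemLp f 2 ν) : Integrable (fun x => ‖f x‖ ^ 2) ν :=
  hf.integrable_norm_pow (by norm_num)

lemma l2_mono {H' : Type*} [NormedAddCommGroup H'] {f : α → H} {g : α → H'} (hg : MemLp g 2 ν)
    (h : ∀ᵐ x ∂ν, ‖f x‖ ≤ ‖g x‖) : l2 ν f ≤ l2 ν g := by
  refine Real.sqrt_le_sqrt (integral_mono_of_nonneg (ae_of_all _ fun _ => by positivity)
    (integrable_norm_sq hg) (h.mono fun x hx => ?_))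
  exact pow_le_pow_left₀ (norm_nonneg _) hx 2

lemma l2_le_of_bound [IsFiniteMeasure ν] {f : α → H} {C V : ℝ} (hC : 0 ≤ C)
    (h : ∀ᵐ x ∂ν, ‖f x‖ ≤ C) (hV : ν.real univ ≤ V ^ 2) (hV0 : 0 ≤ V) : l2 ν f ≤ C * V := by
  refine Real.sqrt_le_iff.2 ⟨by positivity, ?_⟩
  calc ∫ x, ‖f x‖ ^ 2 ∂ν ≤ ∫ _, C ^ 2 ∂ν :=
        integral_mono_of_nonneg (ae_of_all _ fun _ => by positivity) (integrable_const _)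
          (h.mono fun x hx => pow_le_pow_left₀ (norm_nonneg _) hx 2)
    _ = ν.real univ * C ^ 2 := by rw [integral_const, smul_eq_mul]
    _ ≤ (C * V) ^ 2 := by rw [mul_pow, mul_comm]; gcongr

lemma l2_smul {c : ℝ} [NormedSpace ℝ H] (f : α → H) : l2 ν (fun x => c • f x) = |c| * l2 ν f := by
  unfold l2
  simp_rw [norm_smul, mul_pow, integral_const_mul]
  rw [Real.sqrt_mul (by positivity), Real.sqrt_sq (norm_nonneg _), Real.norm_eq_abs]

lemma tendsto_l2_iff {f : ℕ → α → H} :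
    Tendsto (fun n => l2 ν (f n)) atTop (𝓝 0) ↔
      Tendsto (fun n => ∫ x, ‖f n x‖ ^ 2 ∂ν) atTop (𝓝 0) := by
  constructor
  · intro h
    have := h.pow 2
    simpa only [l2_sq, zero_pow two_ne_zero] using this
  · intro h
    have := (Real.continuous_sqrt.tendsto 0).comp h
    simpa [Function.comp_def, l2] using this

/-- Convergence of pairings under `L²` convergence. -/
lemma tendsto_integral_inner [InnerProductSpace ℝ H] {f : ℕ → α → H} {f₀ g : α → H}
    (hf : ∀ n, MemLp (f n) 2 ν) (hf₀ : MemLp f₀ 2 ν) (hg : MemLp g 2 ν)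
    (h : Tendsto (fun n => l2 ν (fun x => f n x - f₀ x)) atTop (𝓝 0)) :
    Tendsto (fun n => ∫ x, inner ℝ (f n x) (g x) ∂ν) atTop (𝓝 (∫ x, inner ℝ (f₀ x) (g x) ∂ν)) := by
  rw [tendsto_iff_dist_tendsto_zero]
  refine squeeze_zero (fun _ => dist_nonneg) (fun n => ?_) (by simpa using h.mul_const (l2 ν g))
  rw [Real.dist_eq, ← integral_sub (integrable_inner (hf n) hg) (integrable_inner hf₀ hg)]
  simp_rw [← inner_sub_left]
  exact abs_integral_inner_le ((hf n).sub hf₀) hg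

lemma tendsto_integral_mul {f : ℕ → α → ℝ} {f₀ g : α → ℝ}
    (hf : ∀ n, MemLp (f n) 2 ν) (hf₀ : MemLp f₀ 2 ν) (hg : MemLp g 2 ν)
    (h : Tendsto (fun n => l2 ν (fun x => f n x - f₀ x)) atTop (𝓝 0)) :
    Tendsto (fun n => ∫ x, f n x * g x ∂ν) atTop (𝓝 (∫ x, f₀ x * g x ∂ν)) := by
  have := tendsto_integral_inner hf hf₀ hg h
  simpa [mul_comm] using this

lemma tendsto_l2 {f : ℕ → α → H} {f₀ : α → H} (hf : ∀ n, MemLp (f n) 2 ν) (hf₀ : MemLp f₀ 2 ν)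
    (h : Tendsto (fun n => l2 ν (fun x => f n x - f₀ x)) atTop (𝓝 0)) :
    Tendsto (fun n => l2 ν (f n)) atTop (𝓝 (l2 ν f₀)) := by
  rw [tendsto_iff_dist_tendsto_zero]
  refine squeeze_zero (fun _ => dist_nonneg) (fun n => ?_) h
  rw [Real.dist_eq, abs_sub_le_iff]
  have h1 := l2_le_add_sub (hf n) hf₀
  have h2 := l2_le_add_sub hf₀ (hf n)
  rw [l2_sub_comm] at h2
  constructor <;> linarith

end L2

lemma memLp_of_continuous {F : Type*} [NormedAddCommGroup F] {U : Set Plane}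
    (hU : Bornology.IsBounded U) {f : Plane → F} (hf : Continuous f) :
    MemLp f 2 (volume.restrict U) := by
  have hK := hU.isCompact_closure
  obtain ⟨C, hC⟩ := hK.exists_bound_of_continuousOn hf.continuousOn
  have : IsFiniteMeasure (volume.restrict (closure U)) :=
    ⟨by rw [Measure.restrict_apply_univ]; exact hK.measure_lt_top⟩
  refine MemLp.mono_measure (Measure.restrict_mono_set _ subset_closure) ?_
  exact MemLp.of_bound hf.aestronglyMeasurable C
    ((ae_restrict_iff' isClosed_closure.measurableSet).2 (ae_of_all _ hC))

/-! ### Gradients -/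

lemma inner_gradient (f : Plane → ℝ) (x ξ : Plane) : inner ℝ (gradient f x) ξ = fderiv ℝ f x ξ :=
  inner_gradient_left

/-- The coordinate vectors. -/
def bv (j : Fin 2) : Plane := EuclideanSpace.single j 1

@[simp] lemma inner_bv (x : Plane) (j : Fin 2) : inner ℝ x (bv j) = x j := by
  simp [bv, EuclideanSpace.inner_single_right]

lemma gradient_apply (f : Plane → ℝ) (x : Plane) (j : Fin 2) : gradient f x j = fderiv ℝ f x (bv j) := by
  rw [← inner_gradient, inner_bv]

lemma norm_gradient (f : Plane → ℝ) (x : Plane) : ‖gradient f x‖ = ‖fderiv ℝ f x‖ := by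
  simp [gradient]

lemma continuous_gradient {f : Plane → ℝ} (hf : ContDiff ℝ 1 f) : Continuous (gradient f) :=
  (InnerProductSpace.toDual ℝ Plane).symm.continuous.comp (hf.continuous_fderiv (by norm_num))

lemma gradient_sub {f g : Plane → ℝ} {x : Plane} (hf : DifferentiableAt ℝ f x)
    (hg : DifferentiableAt ℝ g x) :
    gradient (fun y => f y - g y) x = gradient f x - gradient g x := by
  simp [gradient, fderiv_fun_sub hf hg]

lemma gradient_mul {f g : Plane → ℝ} {x : Plane} (hf : DifferentiableAt ℝ f x)
    (hg : DifferentiableAt ℝ g x) :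
    gradient (fun y => f y * g y) x = f x • gradient g x + g x • gradient f x := by
  simp [gradient, fderiv_fun_mul hf hg]

/-! ### Weak gradients -/

section WeakGradient

variable {U : Set Plane} {v w : Plane → ℝ} {φ : Plane → ℝ}

lemma IsTestFunction.memLp (h : IsTestFunction U φ) (ν : Measure Plane) [IsFiniteMeasureOnCompacts ν] :
    MemLp φ 2 ν := h.1.continuous.memLp_of_hasCompactSupport h.2.1

lemma IsTestFunction.continuous_gradient (h : IsTestFunction U φ) : Continuous (gradient φ) :=
  VEM.continuous_gradient (h.1.of_le (by exact_mod_cast le_top))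

lemma tsupport_gradient_subset (φ : Plane → ℝ) :
    tsupport (gradient φ) ⊆ tsupport φ := by
  refine (closure_mono fun x hx => ?_).trans (tsupport_fderiv_subset ℝ (f := φ))
  simpa [gradient] using hx

lemma IsTestFunction.hasCompactSupport_gradient (h : IsTestFunction U φ) :
    HasCompactSupport (gradient φ) := h.2.1.mono' (subset_closure.trans (tsupport_gradient_subset φ))

lemma IsTestFunction.memLp_gradient (h : IsTestFunction U φ) (ν : Measure Plane)
    [IsFiniteMeasureOnCompacts ν] : MemLp (gradient φ) 2 ν :=
  h.continuous_gradient.memLp_of_hasCompactSupport h.hasCompactSupport_gradient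

lemma IsTestFunction.mono {V : Set Plane} (h : IsTestFunction V φ) (hVU : V ⊆ U) :
    IsTestFunction U φ := ⟨h.1, h.2.1, h.2.2.trans hVU⟩

lemma integrable_smul {α : Type*} [MeasurableSpace α] {ν : Measure α} {H : Type*}
    [NormedAddCommGroup H] [NormedSpace ℝ H] {f : α → ℝ} {g : α → H} (hf : MemLp f 2 ν)
    (hg : MemLp g 2 ν) : Integrable (fun x => f x • g x) ν := by
  have := MemLp.smul (p := 2) (q := 2) (r := 1) hg hf
  exact memLp_one_iff_integrable.1 this

lemma IsTestFunction.setIntegral_eq {F : Type*} [NormedAddCommGroup F] [NormedSpace ℝ F]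
    (h : IsTestFunction U φ) {f : Plane → F} (hf : ∀ x, φ x = 0 → gradient φ x = 0 → f x = 0) :
    ∫ x in U, f x = ∫ x, f x := by
  refine setIntegral_eq_integral_of_forall_compl_eq_zero fun x hx => hf x ?_ ?_
  · exact image_eq_zero_of_notMem_tsupport fun hn => hx (h.2.2 hn)
  · exact image_eq_zero_of_notMem_tsupport fun hn => hx (h.2.2 (tsupport_gradient_subset φ hn))

/-- The fundamental lemma of the calculus of variations. It makes the choice in `weakGrad` harmless,
up to null sets. -/
lemma IsWeakGradient.ae_eq (hU : IsOpen U) {g g' : Plane → Plane} (h : IsWeakGradient U v g)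
    (h' : IsWeakGradient U v g') : g =ᵐ[volume.restrict U] g' := by
  have hm : MemLp (g - g') 2 (volume.restrict U) := h.1.sub h'.1
  have key := hU.ae_eq_zero_of_integral_contDiff_smul_eq_zero (f := g - g') (μ := volume)
    (by
      have : LocallyIntegrable (g - g') (volume.restrict U) := hm.locallyIntegrable (by norm_num)
      exact locallyIntegrableOn_of_locallyIntegrable_restrict this)
    (fun φ h1 h2 h3 => by
      have ht : IsTestFunction U φ := ⟨h1, h2, h3⟩
      rw [← ht.setIntegral_eq (fun x hx _ => by simp [hx])]
      simp only [Pi.sub_apply, smul_sub]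
      rw [integral_sub (integrable_smul (ht.memLp _) h.1) (integrable_smul (ht.memLp _) h'.1)]
      have e1 := h.2 φ ht
      have e2 := h'.2 φ ht
      rw [e1] at e2
      rw [neg_inj.1 e2, sub_self])
  rw [EventuallyEq, ae_restrict_iff' hU.measurableSet]
  filter_upwards [key] with x hx hxU
  exact sub_eq_zero.1 (hx hxU)

lemma IsWeakGradient.sub (hv : MemLp v 2 (volume.restrict U)) (hw : MemLp w 2 (volume.restrict U))
    {g g' : Plane → Plane} (h : IsWeakGradient U v g) (h' : IsWeakGradient U w g') :
    IsWeakGradient U (fun x => v x - w x) (fun x => g x - g' x) := by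
  refine ⟨h.1.sub h'.1, fun φ ht => ?_⟩
  simp only [sub_smul, smul_sub]
  rw [integral_sub (integrable_smul hv (ht.memLp_gradient _)) (integrable_smul hw (ht.memLp_gradient _)),
    integral_sub (integrable_smul (ht.memLp _) h.1) (integrable_smul (ht.memLp _) h'.1),
    h.2 φ ht, h'.2 φ ht]
  abel

lemma IsWeakGradient.mono {V : Set Plane} {g : Plane → Plane} (h : IsWeakGradient U v g)
    (hVU : V ⊆ U) : IsWeakGradient V v g := by
  refine ⟨h.1.mono_measure (Measure.restrict_mono_set _ hVU), fun φ ht => ?_⟩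
  have := h.2 φ (ht.mono hVU)
  rw [(ht.mono hVU).setIntegral_eq (fun x _ hx => by simp [hx]),
    (ht.mono hVU).setIntegral_eq (fun x hx _ => by simp [hx])] at this
  rwa [ht.setIntegral_eq (fun x _ hx => by simp [hx]), ht.setIntegral_eq (fun x hx _ => by simp [hx])]

lemma MemH1.isWeakGradient (h : MemH1 U v) : IsWeakGradient U v (weakGrad U v) := by
  rw [weakGrad, dif_pos h.2]; exact h.2.choose_spec

lemma MemH1.memLp_weakGrad (h : MemH1 U v) : MemLp (weakGrad U v) 2 (volume.restrict U) :=
  h.isWeakGradient.1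

lemma IsWeakGradient.weakGrad_ae_eq (hU : IsOpen U) {g : Plane → Plane} (h : IsWeakGradient U v g) :
    weakGrad U v =ᵐ[volume.restrict U] g := by
  have hex : ∃ g, IsWeakGradient U v g := ⟨g, h⟩
  rw [weakGrad, dif_pos hex]
  exact hex.choose_spec.ae_eq hU h

lemma MemH1.sub (h : MemH1 U v) (h' : MemH1 U w) : MemH1 U (fun x => v x - w x) :=
  ⟨h.1.sub h'.1, _, IsWeakGradient.sub h.1 h'.1 h.isWeakGradient h'.isWeakGradient⟩

lemma weakGrad_sub (hU : IsOpen U) (h : MemH1 U v) (h' : MemH1 U w) :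
    weakGrad U (fun x => v x - w x) =ᵐ[volume.restrict U] fun x => weakGrad U v x - weakGrad U w x :=
  (IsWeakGradient.sub h.1 h'.1 h.isWeakGradient h'.isWeakGradient).weakGrad_ae_eq hU

lemma weakGrad_mono {V : Set Plane} (hV : IsOpen V) (h : MemH1 U v) (hVU : V ⊆ U) :
    weakGrad V v =ᵐ[volume.restrict V] weakGrad U v :=
  (h.isWeakGradient.mono hVU).weakGrad_ae_eq hV

lemma integral_mul_fderiv_test {f : Plane → ℝ} (hf : ContDiff ℝ 1 f) (ht : IsTestFunction U φ) (ξ : Plane) :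
    ∫ x in U, f x * fderiv ℝ φ x ξ = -∫ x in U, φ x * fderiv ℝ f x ξ := by
  have hφ1 : ContDiff ℝ 1 φ := ht.1.of_le (by exact_mod_cast le_top)
  have hc := hf.continuous
  have hc' := hf.continuous_fderiv (by norm_num)
  have hd := hφ1.continuous
  have hd' := hφ1.continuous_fderiv (by norm_num)
  have hs := ht.2.1
  have hs' : HasCompactSupport (fun x => fderiv ℝ φ x ξ) :=
    (hs.fderiv (𝕜 := ℝ)).comp_left (g := fun L : Plane →L[ℝ] ℝ => L ξ) (by simp)
  rw [ht.setIntegral_eq (fun x _ hx => by simp [← inner_gradient, hx]),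
    ht.setIntegral_eq (fun x hx _ => by simp [hx])]
  rw [integral_mul_fderiv_eq_neg_fderiv_mul_of_integrable]
  · simp_rw [mul_comm]
  · exact Continuous.integrable_of_hasCompactSupport (by fun_prop) hs.mul_left
  · exact Continuous.integrable_of_hasCompactSupport (by fun_prop) hs'.mul_left
  · exact Continuous.integrable_of_hasCompactSupport (by fun_prop) hs.mul_left
  · exact fun x _ => (hf.differentiable (by norm_num)).differentiableAt
  · exact fun x _ => (hφ1.differentiable (by norm_num)).differentiableAt

lemma plane_ext_inner {x y : Plane} (h : ∀ ξ : Plane, inner ℝ x ξ = inner ℝ y ξ) : x = y :=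
  ext_inner_right ℝ h

lemma isWeakGradient_of_contDiff (hU : Bornology.IsBounded U) {f : Plane → ℝ} (hf : ContDiff ℝ 1 f) :
    IsWeakGradient U f (gradient f) := by
  have hm := memLp_of_continuous hU hf.continuous
  have hm' := memLp_of_continuous hU (continuous_gradient hf)
  refine ⟨hm', fun φ ht => plane_ext_inner fun ξ => ?_⟩
  rw [inner_neg_left, real_inner_comm, ← integral_inner (integrable_smul hm (ht.memLp_gradient _)),
    real_inner_comm, ← integral_inner (integrable_smul (ht.memLp _) hm')]
  simp_rw [inner_smul_right, real_inner_comm _ ξ, inner_gradient]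
  exact integral_mul_fderiv_test hf ht ξ

lemma memH1_of_contDiff (hU : Bornology.IsBounded U) {f : Plane → ℝ} (hf : ContDiff ℝ 1 f) : MemH1 U f :=
  ⟨memLp_of_continuous hU hf.continuous, _, isWeakGradient_of_contDiff hU hf⟩

lemma h1Seminorm_eq (U : Set Plane) (v : Plane → ℝ) :
    h1Seminorm U v = l2 (volume.restrict U) (weakGrad U v) := rfl

lemma tendstoH1_iff {φ : ℕ → Plane → ℝ} : TendstoH1 U φ v ↔
    Tendsto (fun n => l2 (volume.restrict U) (fun x => φ n x - v x)) atTop (𝓝 0) ∧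
    Tendsto (fun n => l2 (volume.restrict U) (fun x => gradient (φ n) x - weakGrad U v x)) atTop (𝓝 0) := by
  rw [TendstoH1, tendsto_l2_iff, tendsto_l2_iff]
  simp only [Real.norm_eq_abs, sq_abs]

end WeakGradient

end VEM

end

noncomputable section

namespace VEM

/-! ### Trace and Poincaré inequalities for smooth functions -/

lemma integral_square_eq' {F : Type*} [NormedAddCommGroup F] [NormedSpace ℝ F] (f : ℝ × ℝ → F)
    (hf : Continuous f) :
    ∫ q in square, f q = ∫ t in (0 : ℝ)..1, ∫ r in (0 : ℝ)..1, f (r, t) := by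
  have : ∫ q in square, f q = ∫ q in square, f q.swap := by
    rw [square, Measure.volume_eq_prod]
    exact (setIntegral_prod_swap _ _ f).symm
  rw [this, integral_square_eq (fun q => f q.swap) (hf.comp continuous_swap)]
  rfl

/-- The variance of `g` on the unit interval is nonnegative. -/
lemma sq_integral_le {g : ℝ → ℝ} (hg : Continuous g) :
    (∫ s in (0 : ℝ)..1, g s) ^ 2 ≤ ∫ s in (0 : ℝ)..1, g s ^ 2 := by
  set m := ∫ s in (0 : ℝ)..1, g s with hm
  have h0 : 0 ≤ ∫ s in (0 : ℝ)..1, (g s - m) ^ 2 :=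
    intervalIntegral.integral_nonneg zero_le_one fun s _ => sq_nonneg _
  have h1 : ∫ s in (0 : ℝ)..1, (g s - m) ^ 2 =
      (∫ s in (0 : ℝ)..1, g s ^ 2) - 2 * m * (∫ s in (0 : ℝ)..1, g s) + m ^ 2 := by
    have e : ∀ s, (g s - m) ^ 2 = (g s ^ 2 - 2 * m * g s) + m ^ 2 := fun s => by ring
    simp_rw [e]
    rw [intervalIntegral.integral_add, intervalIntegral.integral_sub,
      intervalIntegral.integral_const_mul, intervalIntegral.integral_const]
    · simp
    all_goals exact Continuous.intervalIntegrable (by fun_prop) _ _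
  rw [h1, ← hm] at h0
  linarith

lemma hasDerivAt_comp_line {φ : Plane → ℝ} (hφ : ContDiff ℝ 1 φ) (c m : Plane) (s : ℝ) :
    HasDerivAt (fun s : ℝ => φ (c + s • m)) (inner ℝ (gradient φ (c + s • m)) m) s := by
  rw [inner_gradient]
  have h1 : HasDerivAt (fun s : ℝ => c + s • m) m s := by
    simpa using ((hasDerivAt_id s).smul_const m).const_add c
  exact ((hφ.differentiable (by norm_num)).differentiableAt.hasFDerivAt).comp_hasDerivAt s h1

/-- Integrate the derivative of `s² φ(c + s m)²`. The weight removes the value at `c` and leaves a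
factor `s`, which is the Jacobian of the collapsed coordinates. The constant `3` is `2` from
differentiating `s²` plus `1` from `2 a b ≤ a² + b²`. -/
lemma sq_endpoint_le {φ : Plane → ℝ} (hφ : ContDiff ℝ 1 φ) (c m : Plane) {h : ℝ} (hm : ‖m‖ ≤ h) :
    φ (c + m) ^ 2 ≤ ∫ s in (0 : ℝ)..1, s * (3 * φ (c + s • m) ^ 2 +
      h ^ 2 * ‖gradient φ (c + s • m)‖ ^ 2) := by
  have hc := hφ.continuous
  have hc' := continuous_gradient hφ
  have hd : ∀ s : ℝ, HasDerivAt (fun s : ℝ => s ^ 2 * φ (c + s • m) ^ 2)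
      (2 * s * φ (c + s • m) ^ 2 + s ^ 2 * (2 * φ (c + s • m) *
        inner ℝ (gradient φ (c + s • m)) m)) s := by
    intro s
    have := ((hasDerivAt_id s).pow 2).mul ((hasDerivAt_comp_line hφ c m s).pow 2)
    convert! this using 1
    simp
  have hcont : Continuous fun s : ℝ => 2 * s * φ (c + s • m) ^ 2 + s ^ 2 * (2 * φ (c + s • m) *
        inner ℝ (gradient φ (c + s • m)) m) := by fun_prop
  have hint := intervalIntegral.integral_eq_sub_of_hasDerivAt (a := 0) (b := 1) (fun s _ => hd s)
    (hcont.intervalIntegrable _ _)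
  have h1 : φ (c + m) ^ 2 = ∫ s in (0 : ℝ)..1, (2 * s * φ (c + s • m) ^ 2 + s ^ 2 *
      (2 * φ (c + s • m) * inner ℝ (gradient φ (c + s • m)) m)) := by rw [hint]; simp
  rw [h1]
  refine intervalIntegral.integral_mono_on zero_le_one (hcont.intervalIntegrable _ _)
    (Continuous.intervalIntegrable (by fun_prop) _ _) fun s hs => ?_
  set a := φ (c + s • m)
  set b := inner ℝ (gradient φ (c + s • m)) m with hb
  set g := ‖gradient φ (c + s • m)‖
  have hbg : b ^ 2 ≤ h ^ 2 * g ^ 2 := by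
    have : |b| ≤ g * ‖m‖ := abs_real_inner_le_norm _ _
    calc b ^ 2 = |b| ^ 2 := (sq_abs b).symm
      _ ≤ (g * ‖m‖) ^ 2 := by gcongr
      _ ≤ (g * h) ^ 2 := by gcongr
      _ = _ := by ring
  have hs2 : s ^ 2 ≤ s := by nlinarith [hs.1, hs.2]
  have h2 : s ^ 2 * (2 * a * b) ≤ s * (a ^ 2 + b ^ 2) := by
    calc s ^ 2 * (2 * a * b) ≤ s ^ 2 * (a ^ 2 + b ^ 2) := by
          gcongr; nlinarith [sq_nonneg (a - b)]
      _ ≤ _ := by gcongr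
  nlinarith [mul_le_mul_of_nonneg_left hbg hs.1]

namespace Polygon

variable {E : Polygon} {c : Plane} {r : ℝ}

lemma continuous_edgePoint (i : E.Idx) : Continuous (E.edgePoint i) := by
  simp_rw [funext (edgePoint_eq i)]; fun_prop

namespace StarBall

/-- The estimate along one ray, integrated over the edge parameter. -/
lemma trace_le (h : E.StarBall c r) (i : E.Idx) {φ : Plane → ℝ} (hφ : ContDiff ℝ 1 φ) :
    |E.fanDet c i| * ∫ t in (0 : ℝ)..1, φ (E.edgePoint i t) ^ 2 ≤
      ∫ x in E.fanTri c i, (3 * φ x ^ 2 + E.diam ^ 2 * ‖gradient φ x‖ ^ 2) := by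
  have hc := hφ.continuous
  have hc' := continuous_gradient hφ
  rw [fanTri, integral_tri (h.fanDet_ne_zero i)]
  change _ ≤ |E.fanDet c i| • _
  rw [smul_eq_mul]
  refine mul_le_mul_of_nonneg_left ?_ (abs_nonneg _)
  have hcd := continuous_duffy c (E.vertex i - c) (E.vertex (i + 1) - c)
  rw [integral_square_eq' _ (by fun_prop)]
  have hce := continuous_edgePoint i
  have hcc : Continuous fun t : ℝ => ∫ s in (0 : ℝ)..1, s • (3 * φ (duffy c (E.vertex i - c) (E.vertex (i + 1) - c) (s, t)) ^ 2 +
      E.diam ^ 2 * ‖gradient φ (duffy c (E.vertex i - c) (E.vertex (i + 1) - c) (s, t))‖ ^ 2) :=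
    intervalIntegral.continuous_parametric_intervalIntegral_of_continuous' (by fun_prop) _ _
  refine intervalIntegral.integral_mono_on zero_le_one
    (Continuous.intervalIntegrable (by fun_prop) _ _) (hcc.intervalIntegrable _ _) fun t ht => ?_
  have := sq_endpoint_le hφ c (E.edgePoint i t - c) (h.norm_sub_le (edgePoint_mem_closure i ht))
  simp only [duffy_fan, smul_eq_mul]
  rwa [add_sub_cancel] at this

/-- The fan triangles are disjoint, so adding up the edges costs no factor depending on their
number. -/
lemma sum_trace_le (h : E.StarBall c r) {φ : Plane → ℝ} (hφ : ContDiff ℝ 1 φ) :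
    ∑ i, |E.fanDet c i| * ∫ t in (0 : ℝ)..1, φ (E.edgePoint i t) ^ 2 ≤
      3 * l2 (volume.restrict E.carrier) φ ^ 2 +
        E.diam ^ 2 * l2 (volume.restrict E.carrier) (gradient φ) ^ 2 := by
  have hc := hφ.continuous
  have hc' := continuous_gradient hφ
  refine (Finset.sum_le_sum fun i _ => h.trace_le i hφ).trans ?_
  rw [← h.integral_eq_sum fun i => integrableOn_tri_of_continuous (h.fanDet_ne_zero i) (by fun_prop),
    l2_sq_real, l2_sq, ← integral_const_mul, ← integral_const_mul, ← integral_add]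
  · exact (memLp_of_continuous E.isBounded_carrier hc).integrable_sq.const_mul _
  · exact (integrable_norm_sq (memLp_of_continuous E.isBounded_carrier hc')).const_mul _

end StarBall

end Polygon

/-! ### The Poincaré inequality, by integration over segments with one end in the ball -/

open scoped ENNReal

/-- The Jacobian of the inverse homothety in the plane is `σ⁻²`, which is at most `4`. -/
lemma lintegral_comp_affine_le {k : Plane → ℝ≥0∞} (hk : Measurable k) {S E : Set Plane}
    (hE : MeasurableSet E) (hS : MeasurableSet S) {w : Plane} {σ : ℝ} (hσ : 1 / 2 ≤ σ)
    (hmaps : ∀ y ∈ S, w + σ • y ∈ E) :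
    ∫⁻ y in S, k (w + σ • y) ≤ 4 * ∫⁻ y in E, k y := by
  have hσ0 : 0 < σ := by linarith
  have hk' : Measurable (E.indicator k) := hk.indicator hE
  have h1 : ∫⁻ y in S, k (w + σ • y) ≤ ∫⁻ y, E.indicator k (w + σ • y) := by
    calc ∫⁻ y in S, k (w + σ • y) = ∫⁻ y in S, E.indicator k (w + σ • y) :=
          setLIntegral_congr_fun hS fun y hy => by rw [indicator_of_mem (hmaps y hy)]
      _ ≤ _ := setLIntegral_le_lintegral _ _
  refine h1.trans ?_
  have h2 : ∫⁻ y, E.indicator k (w + σ • y) = ∫⁻ z, E.indicator k (w + z) ∂(Measure.map (σ • ·) volume) := by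
    rw [lintegral_map (by fun_prop) (by fun_prop)]
  rw [h2, Measure.map_addHaar_smul volume hσ0.ne', lintegral_smul_measure,
    lintegral_add_left_eq_self (E.indicator k) w, lintegral_indicator hE, smul_eq_mul]
  gcongr
  rw [finrank_euclideanSpace_fin, abs_of_nonneg (by positivity)]
  rw [show (4 : ℝ≥0∞) = ENNReal.ofReal 4 by norm_num]
  refine ENNReal.ofReal_le_ofReal ?_
  rw [inv_le_comm₀ (by positivity) (by norm_num)]
  nlinarith

lemma ofReal_sq_sub_le {φ : Plane → ℝ} (hφ : ContDiff ℝ 1 φ) {x y : Plane} {h : ℝ}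
    (hxy : ‖x - y‖ ≤ h) :
    ENNReal.ofReal ((φ x - φ y) ^ 2) ≤ ENNReal.ofReal (h ^ 2) *
      ∫⁻ s in Ioc (0 : ℝ) 1, ENNReal.ofReal (‖gradient φ (y + s • (x - y))‖ ^ 2) := by
  have hc' := continuous_gradient hφ
  have hcont : Continuous fun s : ℝ => inner ℝ (gradient φ (y + s • (x - y))) (x - y) := by fun_prop
  have h1 := intervalIntegral.integral_eq_sub_of_hasDerivAt (a := 0) (b := 1)
    (fun s _ => hasDerivAt_comp_line hφ y (x - y) s) (hcont.intervalIntegrable _ _)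
  simp only [one_smul, add_sub_cancel, zero_smul, add_zero] at h1
  have h2 : (φ x - φ y) ^ 2 ≤ h ^ 2 * ∫ s in (0 : ℝ)..1, ‖gradient φ (y + s • (x - y))‖ ^ 2 := by
    rw [← h1]
    refine (sq_integral_le hcont).trans ?_
    rw [← intervalIntegral.integral_const_mul]
    refine intervalIntegral.integral_mono_on zero_le_one
      (Continuous.intervalIntegrable (by fun_prop) _ _)
      (Continuous.intervalIntegrable (by fun_prop) _ _) fun s _ => ?_
    have := abs_real_inner_le_norm (gradient φ (y + s • (x - y))) (x - y)
    calc _ = |inner ℝ (gradient φ (y + s • (x - y))) (x - y)| ^ 2 := (sq_abs _).symm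
      _ ≤ (‖gradient φ (y + s • (x - y))‖ * ‖x - y‖) ^ 2 := by gcongr
      _ ≤ (‖gradient φ (y + s • (x - y))‖ * h) ^ 2 := by gcongr
      _ = _ := by ring
  refine (ENNReal.ofReal_le_ofReal h2).trans ?_
  rw [ENNReal.ofReal_mul (sq_nonneg _), intervalIntegral.integral_of_le zero_le_one,
    ofReal_integral_eq_lintegral_ofReal]
  · exact (Continuous.intervalIntegrable (by fun_prop) 0 1).1
  · exact ae_of_all _ fun _ => by positivity

/-- On the half `s ≤ 1 / 2` substitute in `y`, where the homothety has ratio `1 - s`; on the other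
half substitute in `x`, with ratio `s`. Both ratios are at least `1 / 2`, so no singular kernel
appears, and each half contributes `4 · (1 / 2) = 2` times the integral of `k`, times the area of
the set of the other variable. -/
lemma lintegral_segments_le {k : Plane → ℝ≥0∞} (hk : Measurable k) {E B : Set Plane}
    (hE : MeasurableSet E) (hB : MeasurableSet B) (hstar : ∀ y ∈ B, StarConvex ℝ y E) :
    ∫⁻ x in E, ∫⁻ y in B, ∫⁻ s in Ioc (0 : ℝ) 1, k (y + s • (x - y)) ≤
      ENNReal.ofReal 2 * (volume E + volume B) * ∫⁻ z in E, k z := by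
  set K := ∫⁻ z in E, k z with hK
  have hsplit : ∀ x y : Plane, ∫⁻ s in Ioc (0 : ℝ) 1, k (y + s • (x - y)) =
      (∫⁻ s in Ioc (0 : ℝ) (1 / 2), k (y + s • (x - y))) +
        ∫⁻ s in Ioc (1 / 2 : ℝ) 1, k (y + s • (x - y)) := by
    intro x y
    rw [← lintegral_union measurableSet_Ioc (Ioc_disjoint_Ioc_of_le le_rfl),
      Ioc_union_Ioc_eq_Ioc (by norm_num) (by norm_num)]
  have hmem : ∀ x ∈ E, ∀ y ∈ B, ∀ s : ℝ, 0 ≤ s → s ≤ 1 → y + s • (x - y) ∈ E := by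
    intro x hx y hy s hs hs1
    have := hstar y hy hx (a := 1 - s) (b := s) (by linarith) hs (by ring)
    convert this using 1; module
  have h1 : ∀ x ∈ E, ∫⁻ y in B, ∫⁻ s in Ioc (0 : ℝ) (1 / 2), k (y + s • (x - y)) ≤ 2 * K := by
    intro x hx
    rw [lintegral_lintegral_swap (Measurable.aemeasurable (by
      have : Measurable fun z : Plane × ℝ => z.1 + z.2 • (x - z.1) := by fun_prop
      exact hk.comp this))]
    calc ∫⁻ s in Ioc (0 : ℝ) (1 / 2), ∫⁻ y in B, k (y + s • (x - y))
        ≤ ∫⁻ s in Ioc (0 : ℝ) (1 / 2), 4 * K := by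
          refine setLIntegral_mono' measurableSet_Ioc fun s hs => ?_
          have e : ∀ y, y + s • (x - y) = s • x + (1 - s) • y := fun y => by module
          simp_rw [e]
          refine lintegral_comp_affine_le hk hE hB (by linarith [hs.2]) fun y hy => ?_
          rw [← e]; exact hmem x hx y hy s hs.1.le (by linarith [hs.2])
      _ = 2 * K := by
          rw [setLIntegral_const, Real.volume_Ioc, sub_zero, mul_right_comm,
            show (4 : ℝ≥0∞) = ENNReal.ofReal 4 by norm_num, ← ENNReal.ofReal_mul (by norm_num)]
          norm_num
  have h2 : ∀ y ∈ B, ∫⁻ x in E, ∫⁻ s in Ioc (1 / 2 : ℝ) 1, k (y + s • (x - y)) ≤ 2 * K := by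
    intro y hy
    rw [lintegral_lintegral_swap (Measurable.aemeasurable (by
      have : Measurable fun z : Plane × ℝ => y + z.2 • (z.1 - y) := by fun_prop
      exact hk.comp this))]
    calc ∫⁻ s in Ioc (1 / 2 : ℝ) 1, ∫⁻ x in E, k (y + s • (x - y))
        ≤ ∫⁻ s in Ioc (1 / 2 : ℝ) 1, 4 * K := by
          refine setLIntegral_mono' measurableSet_Ioc fun s hs => ?_
          have e : ∀ x, y + s • (x - y) = (1 - s) • y + s • x := fun x => by module
          simp_rw [e]
          refine lintegral_comp_affine_le hk hE hE (by linarith [hs.1]) fun x hx => ?_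
          rw [← e]; exact hmem x hx y hy s (by linarith [hs.1]) hs.2
      _ = 2 * K := by
          rw [setLIntegral_const, Real.volume_Ioc, mul_right_comm,
            show (4 : ℝ≥0∞) = ENNReal.ofReal 4 by norm_num, ← ENNReal.ofReal_mul (by norm_num)]
          norm_num
  have hm : ∀ S : Set ℝ, Measurable fun p : Plane × Plane => ∫⁻ s in S, k (p.2 + s • (p.1 - p.2)) := by
    intro S
    refine Measurable.lintegral_prod_right' (f := fun q : (Plane × Plane) × ℝ => k (q.1.2 + q.2 • (q.1.1 - q.1.2))) ?_
    have : Measurable fun q : (Plane × Plane) × ℝ => q.1.2 + q.2 • (q.1.1 - q.1.2) := by fun_prop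
    exact hk.comp this
  simp_rw [hsplit]
  calc ∫⁻ x in E, ∫⁻ y in B, ((∫⁻ s in Ioc (0 : ℝ) (1 / 2), k (y + s • (x - y))) +
        ∫⁻ s in Ioc (1 / 2 : ℝ) 1, k (y + s • (x - y)))
      = (∫⁻ x in E, ∫⁻ y in B, ∫⁻ s in Ioc (0 : ℝ) (1 / 2), k (y + s • (x - y))) +
        ∫⁻ x in E, ∫⁻ y in B, ∫⁻ s in Ioc (1 / 2 : ℝ) 1, k (y + s • (x - y)) := by
        rw [← lintegral_add_left ((hm _).lintegral_prod_right')]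
        refine lintegral_congr fun x => ?_
        exact (lintegral_add_left (f := fun y => ∫⁻ s in Ioc (0 : ℝ) (1 / 2), k (y + s • (x - y)))
          ((hm (Ioc (0 : ℝ) (1 / 2))).comp measurable_prodMk_left) _)
    _ ≤ (∫⁻ _ in E, 2 * K) + ∫⁻ _ in B, 2 * K := by
        refine add_le_add (setLIntegral_mono' hE h1) ?_
        rw [lintegral_lintegral_swap (hm _).aemeasurable]
        exact setLIntegral_mono' hB h2
    _ = _ := by rw [setLIntegral_const, setLIntegral_const, ENNReal.ofReal_ofNat]; ring

namespace Polygon.StarBall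

variable {E : Polygon} {c : Plane} {r : ℝ}

lemma volume_ball_eq (c : Plane) {s : ℝ} (hs : 0 ≤ s) :
    volume.real (Metric.ball c s) = Real.pi * s ^ 2 := by
  rw [Measure.real, EuclideanSpace.volume_ball_fin_two]
  simp [ENNReal.toReal_ofReal hs, ENNReal.toReal_ofReal Real.pi_pos.le]
  ring

lemma volume_carrier_le (h : E.StarBall c r) : volume.real E.carrier ≤ Real.pi * E.diam ^ 2 := by
  have : volume.real (Metric.closedBall c E.diam) = volume.real (Metric.ball c E.diam) := by
    rw [Measure.real, Measure.real, Measure.addHaar_closedBall_eq_addHaar_ball]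
  rw [← volume_ball_eq c E.diam_pos.le, ← this]
  exact measureReal_mono h.carrier_subset_closedBall Metric.isBounded_closedBall.measure_lt_top.ne

/-- The Poincaré inequality on a star-shaped polygon. -/
lemma poincare (h : E.StarBall c r) {φ : Plane → ℝ} (hφ : ContDiff ℝ 1 φ) :
    ∃ a : ℝ, l2 (volume.restrict E.carrier) (fun x => φ x - a) ≤
      2 * E.diam ^ 2 / r * l2 (volume.restrict E.carrier) (gradient φ) := by
  have hc := hφ.continuous
  have hc' := continuous_gradient hφ
  have hEm := E.measurableSet_carrier
  have hBm : MeasurableSet (Metric.ball c r) := measurableSet_ball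
  set B := Metric.ball c r with hB
  have hB0 : volume B ≠ 0 := (Metric.measure_ball_pos volume c h.pos).ne'
  have hBt : volume B ≠ ⊤ := measure_ball_lt_top.ne
  set K := ∫⁻ z in E.carrier, ENNReal.ofReal (‖gradient φ z‖ ^ 2) with hK
  have hKm : Measurable fun z => ENNReal.ofReal (‖gradient φ z‖ ^ 2) := by fun_prop
  have hGm : Measurable fun p : Plane × Plane => ENNReal.ofReal ((φ p.1 - φ p.2) ^ 2) := by fun_prop
  have h1 : ∫⁻ y in B, ∫⁻ x in E.carrier, ENNReal.ofReal ((φ x - φ y) ^ 2) ≤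
      ENNReal.ofReal (E.diam ^ 2) * (ENNReal.ofReal 2 * (volume E.carrier + volume B) * K) := by
    rw [← lintegral_lintegral_swap hGm.aemeasurable]
    refine le_trans ?_ (mul_le_mul_right (lintegral_segments_le hKm hEm hBm h.star) _)
    rw [← lintegral_const_mul' _ _ ENNReal.ofReal_ne_top]
    refine setLIntegral_mono' hEm fun x hx => ?_
    rw [← lintegral_const_mul' _ _ ENNReal.ofReal_ne_top]
    refine setLIntegral_mono' hBm fun y hy => ?_
    refine ofReal_sq_sub_le hφ ?_
    rw [← dist_eq_norm]
    exact dist_le_diam (subset_closure hx) (subset_closure (h.ball_subset hy))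
  -- The constant is the value of `φ` at a point of the ball where the inner integral does not
  -- exceed its average over the ball.
  obtain ⟨y, hyB, hy⟩ := exists_le_setLAverage (μ := volume) hB0 hBt
    (f := fun y => ∫⁻ x in E.carrier, ENNReal.ofReal ((φ x - φ y) ^ 2))
    (Measurable.lintegral_prod_left' hGm).aemeasurable
  rw [setLAverage_eq] at hy
  refine ⟨φ y, ?_⟩
  have hKreal : K = ENNReal.ofReal (l2 (volume.restrict E.carrier) (gradient φ) ^ 2) := by
    rw [l2_sq, ofReal_integral_eq_lintegral_ofReal
      (integrable_norm_sq (memLp_of_continuous E.isBounded_carrier hc'))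
      (ae_of_all _ fun _ => by positivity)]
  have hLreal : ∫⁻ x in E.carrier, ENNReal.ofReal ((φ x - φ y) ^ 2) =
      ENNReal.ofReal (l2 (volume.restrict E.carrier) (fun x => φ x - φ y) ^ 2) := by
    rw [l2_sq_real, ofReal_integral_eq_lintegral_ofReal
      (memLp_of_continuous E.isBounded_carrier (by fun_prop : Continuous fun x => φ x - φ y)).integrable_sq
      (ae_of_all _ fun _ => by positivity)]
  have hEr : volume E.carrier = ENNReal.ofReal (volume.real E.carrier) :=
    (ENNReal.ofReal_toReal E.volume_lt_top.ne).symm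
  have hBr : volume B = ENNReal.ofReal (volume.real B) := (ENNReal.ofReal_toReal hBt).symm
  have hBpos : 0 < volume.real B := ENNReal.toReal_pos hB0 hBt
  set G := l2 (volume.restrict E.carrier) (gradient φ)
  have h2 := hy.trans (ENNReal.div_le_div_right h1 _)
  rw [hLreal, hKreal, hEr, hBr, ← ENNReal.ofReal_add measureReal_nonneg measureReal_nonneg,
    ← ENNReal.ofReal_mul (by norm_num),
    ← ENNReal.ofReal_mul (by positivity), ← ENNReal.ofReal_mul (by positivity),
    ← ENNReal.ofReal_div_of_pos hBpos, ENNReal.ofReal_le_ofReal_iff (by positivity)] at h2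
  refine abs_le_of_sq_le_sq' ?_ (by have := h.pos; have := l2_nonneg (ν := volume.restrict E.carrier) (gradient φ); positivity) |>.2
  refine h2.trans ?_
  rw [div_le_iff₀ hBpos]
  have hvE := h.volume_carrier_le
  have hvB : volume.real B = Real.pi * r ^ 2 := volume_ball_eq c h.pos.le
  have hBE : volume.real B ≤ volume.real E.carrier := measureReal_mono h.ball_subset E.volume_lt_top.ne
  have hr := h.pos
  -- With both areas at most `π h²` and the ball of area `π r²`, the quotient is `4 h⁴ / r² = (2 h²
  -- / r)²`.
  calc E.diam ^ 2 * (2 * (volume.real E.carrier + volume.real B) * G ^ 2)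
      ≤ E.diam ^ 2 * (2 * (Real.pi * E.diam ^ 2 + Real.pi * E.diam ^ 2) * G ^ 2) := by
        gcongr; exact hBE.trans hvE
    _ = _ := by rw [hvB]; field_simp; ring

end Polygon.StarBall

end VEM

end

noncomputable section

namespace VEM

/-! ### Linear functionals on finite-dimensional spaces with an inner product -/

/-- Equivalence of norms in finite dimension. In coordinates the pointwise bounded family is bounded
by a multiple of the norm, and the positive definite form is bounded below by its minimum on the
unit sphere. All polynomial constants of the proof have this origin. -/
lemma exists_functional_bound {V : Type*} [AddCommGroup V] [Module ℝ V] [FiniteDimensional ℝ V]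
    (A : V →ₗ[ℝ] V →ₗ[ℝ] ℝ) (hA : ∀ v, v ≠ 0 → 0 < A v v) {Y : Type*} (Λ : Y → V →ₗ[ℝ] ℝ)
    (hΛ : ∀ v, ∃ B, ∀ y, |Λ y v| ≤ B) : ∃ C : ℝ, 0 < C ∧ ∀ y v, Λ y v ^ 2 ≤ C * A v v := by
  classical
  obtain ⟨n, ⟨b⟩⟩ : ∃ n, Nonempty (Module.Basis (Fin n) ℝ V) := ⟨_, ⟨Module.finBasis ℝ V⟩⟩
  set e : (Fin n → ℝ) →ₗ[ℝ] V := b.equivFun.symm.toLinearMap with he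
  have hquad : Continuous fun x : Fin n → ℝ => A (e x) (e x) := by
    have : ∀ x : Fin n → ℝ, A (e x) (e x) = ∑ i, ∑ j, x i * (x j * A (b i) (b j)) := by
      intro x
      simp only [he, LinearEquiv.coe_coe, Module.Basis.equivFun_symm_apply, map_sum, map_smul,
        LinearMap.sum_apply, LinearMap.smul_apply, smul_eq_mul, Finset.mul_sum]
      rw [Finset.sum_comm]
      simp only [mul_left_comm]
    simp_rw [this]
    fun_prop
  choose B hB using hΛ
  set D := ∑ i, |B (b i)| with hD
  have hΛle : ∀ y x, |Λ y (e x)| ≤ D * ‖x‖ := by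
    intro y x
    have : Λ y (e x) = ∑ i, x i * Λ y (b i) := by
      simp [he, Module.Basis.equivFun_symm_apply]
    rw [this, hD, Finset.sum_mul]
    refine (Finset.abs_sum_le_sum_abs _ _).trans (Finset.sum_le_sum fun i _ => ?_)
    rw [abs_mul, mul_comm]
    exact mul_le_mul ((hB (b i) y).trans (le_abs_self _)) (norm_le_pi_norm x i) (abs_nonneg _) (abs_nonneg _)
  -- The sphere is empty when `V` is zero, which needs a separate case.
  obtain ⟨a, ha, hale⟩ : ∃ a : ℝ, 0 < a ∧ ∀ x : Fin n → ℝ, a * ‖x‖ ^ 2 ≤ A (e x) (e x) := by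
    by_cases hne : (Metric.sphere (0 : Fin n → ℝ) 1).Nonempty
    · obtain ⟨x₀, hx₀, hmin⟩ := (isCompact_sphere (0 : Fin n → ℝ) 1).exists_isMinOn hne hquad.continuousOn
      refine ⟨A (e x₀) (e x₀), hA _ fun h0 => ?_, fun x => ?_⟩
      · have : x₀ = 0 := by
          have h1 : b.equivFun.symm x₀ = 0 := h0
          exact (LinearEquiv.map_eq_zero_iff _).1 h1
        simp [this] at hx₀
      · by_cases hx : x = 0
        · simp [hx]
        have hxn : 0 < ‖x‖ := norm_pos_iff.2 hx
        have h1 : ‖x‖⁻¹ • x ∈ Metric.sphere (0 : Fin n → ℝ) 1 := by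
          simp [norm_smul, inv_mul_cancel₀ hxn.ne']
        have h2 := isMinOn_iff.1 hmin _ h1
        simp only [map_smul, LinearMap.smul_apply, smul_eq_mul] at h2
        calc _ ≤ ‖x‖⁻¹ * (‖x‖⁻¹ * A (e x) (e x)) * ‖x‖ ^ 2 := by gcongr
          _ = _ := by field_simp
    · refine ⟨1, one_pos, fun x => ?_⟩
      have hx : x = 0 := by
        by_contra hx
        have hxn : 0 < ‖x‖ := norm_pos_iff.2 hx
        exact hne ⟨‖x‖⁻¹ • x, by simp [norm_smul, inv_mul_cancel₀ hxn.ne']⟩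
      simp [hx]
  refine ⟨D ^ 2 / a + 1, by positivity, fun y v => ?_⟩
  obtain ⟨x, rfl⟩ : ∃ x, e x = v := b.equivFun.symm.surjective v
  have h1 : Λ y (e x) ^ 2 ≤ D ^ 2 * ‖x‖ ^ 2 := by
    rw [← sq_abs, ← mul_pow]
    exact pow_le_pow_left₀ (abs_nonneg _) (hΛle y x) 2
  have h2 := hale x
  have h3 : 0 ≤ A (e x) (e x) := le_trans (by positivity) h2
  calc Λ y (e x) ^ 2 ≤ D ^ 2 * ‖x‖ ^ 2 := h1
    _ = D ^ 2 / a * (a * ‖x‖ ^ 2) := by field_simp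
    _ ≤ D ^ 2 / a * A (e x) (e x) := by gcongr
    _ ≤ _ := by linarith

/-! ### Polynomial functions on the plane -/

@[simp] lemma polyFun_zero (x : Plane) : polyFun 0 x = 0 := by simp [polyFun]
@[simp] lemma polyFun_add (p q : Poly) (x : Plane) : polyFun (p + q) x = polyFun p x + polyFun q x := by
  simp [polyFun]
@[simp] lemma polyFun_sub (p q : Poly) (x : Plane) : polyFun (p - q) x = polyFun p x - polyFun q x := by
  simp [polyFun]
@[simp] lemma polyFun_mul (p q : Poly) (x : Plane) : polyFun (p * q) x = polyFun p x * polyFun q x := by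
  simp [polyFun]
@[simp] lemma polyFun_smul (a : ℝ) (q : Poly) (x : Plane) : polyFun (a • q) x = a * polyFun q x := by
  simp [polyFun, MvPolynomial.smul_eval]
@[simp] lemma polyFun_C (a : ℝ) (x : Plane) : polyFun (MvPolynomial.C a) x = a := by simp [polyFun]
@[simp] lemma polyFun_X (j : Fin 2) (x : Plane) : polyFun (MvPolynomial.X j) x = x j := by simp [polyFun]
lemma polyFun_sum {ι : Type*} (s : Finset ι) (p : ι → Poly) (x : Plane) :
    polyFun (∑ i ∈ s, p i) x = ∑ i ∈ s, polyFun (p i) x := by simp [polyFun]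

lemma contDiff_polyFun (p : Poly) {n : WithTop ℕ∞} : ContDiff ℝ n (polyFun p) := by
  induction p using MvPolynomial.induction_on with
  | C a => simp only [funext (polyFun_C a)]; exact contDiff_const
  | add p q hp hq => simp only [funext (polyFun_add p q)]; exact hp.add hq
  | mul_X p j hp =>
    simp only [funext (polyFun_mul p _), polyFun_X]
    exact hp.mul (by fun_prop)

lemma continuous_polyFun (p : Poly) : Continuous (polyFun p) := (contDiff_polyFun p (n := 0)).continuous

lemma gradient_polyFun (p : Poly) (x : Plane) (j : Fin 2) :
    gradient (polyFun p) x j = polyFun (MvPolynomial.pderiv j p) x := by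
  have hd : ∀ q : Poly, DifferentiableAt ℝ (polyFun q) x := fun q =>
    ((contDiff_polyFun q (n := 1)).differentiable (by norm_num)).differentiableAt
  rw [gradient_apply]
  induction p using MvPolynomial.induction_on with
  | C a => simp [funext (polyFun_C a)]
  | add p q hp hq =>
    simp only [funext (polyFun_add p q), map_add, polyFun_add, ← hp, ← hq]
    rw [fderiv_fun_add (hd p) (hd q)]; rfl
  | mul_X p k hp =>
    have hX : HasFDerivAt (fun y : Plane => y k) (EuclideanSpace.proj k : Plane →L[ℝ] ℝ) x :=
      (EuclideanSpace.proj k : Plane →L[ℝ] ℝ).hasFDerivAt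
    simp only [funext (polyFun_mul p _), polyFun_X, MvPolynomial.pderiv_mul, polyFun_add, polyFun_mul,
      ← hp]
    rw [fderiv_fun_mul (hd p) hX.differentiableAt, hX.fderiv]
    rw [MvPolynomial.pderiv_X]
    have : (bv j) k = polyFun ((Pi.single j 1 : Fin 2 → Poly) k) x := by
      by_cases hjk : k = j
      · subst hjk; simp [bv, polyFun]
      · simp [bv, hjk, polyFun]
    simp [this]
    ring

lemma totalDegree_pderiv_le (j : Fin 2) (p : Poly) :
    (MvPolynomial.pderiv j p).totalDegree ≤ p.totalDegree - 1 := by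
  rw [MvPolynomial.totalDegree, Finset.sup_le_iff]
  intro m hm
  rw [MvPolynomial.mem_support_iff, MvPolynomial.coeff_pderiv] at hm
  have h1 : m + Finsupp.single j 1 ∈ p.support := by
    rw [MvPolynomial.mem_support_iff]; exact left_ne_zero_of_mul hm
  have h2 := MvPolynomial.le_totalDegree h1
  rw [Finsupp.sum_add_index' (fun _ => rfl) (fun _ _ _ => rfl), Finsupp.sum_single_index rfl] at h2
  omega

/-- The identity theorem for analytic functions; then a polynomial over an infinite field is
determined by its values. -/
lemma eq_zero_of_polyFun_eq_zero {p : Poly} {x₀ : Plane} {s : ℝ} (hs : 0 < s)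
    (h : ∀ x ∈ Metric.ball x₀ s, polyFun p x = 0) : p = 0 := by
  have ha : AnalyticOnNhd ℝ (polyFun p) univ :=
    AnalyticOnNhd.eval_continuousLinearMap' (fun j => (EuclideanSpace.proj j : Plane →L[ℝ] ℝ)) p
  have h0 : AnalyticOnNhd ℝ (fun _ : Plane => (0 : ℝ)) univ := analyticOnNhd_const
  have heq : polyFun p = fun _ => 0 := ha.eq_of_eventuallyEq h0 (z₀ := x₀)
    (by filter_upwards [Metric.ball_mem_nhds x₀ hs] with x hx using h x hx)
  refine MvPolynomial.funext fun y => ?_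
  have := congrFun heq (WithLp.toLp 2 y)
  simpa [polyFun] using this

/-- Substitution of `c + h y` for the variables. -/
def rescale (c : Plane) (h : ℝ) (p : Poly) : Poly :=
  MvPolynomial.aeval (fun j => MvPolynomial.C (c j) + MvPolynomial.C h * MvPolynomial.X j) p

lemma polyFun_rescale (c : Plane) (h : ℝ) (p : Poly) (y : Plane) :
    polyFun (rescale c h p) y = polyFun p (c + h • y) := by
  induction p using MvPolynomial.induction_on with
  | C a => simp [rescale]
  | add p q hp hq => rw [polyFun_add, ← hp, ← hq, ← polyFun_add]; simp only [rescale, map_add]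
  | mul_X p j hp =>
    rw [polyFun_mul, ← hp, polyFun_X]
    simp [rescale]

lemma totalDegree_rescale_le (c : Plane) (h : ℝ) (p : Poly) :
    (rescale c h p).totalDegree ≤ p.totalDegree := by
  rw [rescale, MvPolynomial.aeval_def, MvPolynomial.eval₂]
  refine MvPolynomial.totalDegree_finsetSum_le fun d hd => ?_
  refine (MvPolynomial.totalDegree_mul _ _).trans ?_
  rw [MvPolynomial.algebraMap_eq, MvPolynomial.totalDegree_C, zero_add]
  refine (MvPolynomial.totalDegree_finsetProd _ _).trans (le_trans ?_ (MvPolynomial.le_totalDegree hd))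
  refine Finset.sum_le_sum fun j _ => (MvPolynomial.totalDegree_pow _ _).trans ?_
  refine (Nat.mul_le_mul_left _ (?_ : _ ≤ 1)).trans (by rw [mul_one])
  refine (MvPolynomial.totalDegree_add _ _).trans (max_le ?_ ?_)
  · simp
  · refine (MvPolynomial.totalDegree_mul _ _).trans ?_
    simp

/-! ### Polynomials on the unit interval -/

section Interval

open Polynomial

lemma integrable_poly (f : ℝ → ℝ) (hf : Continuous f) : IntervalIntegrable f volume 0 1 :=
  hf.intervalIntegrable _ _

/-- A nonzero polynomial has finitely many roots, so it is nonzero somewhere in the interval. -/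
lemma sq_integral_pos {p : ℝ[X]} (hp : p ≠ 0) {f : ℝ → ℝ} (hf : Continuous f)
    (hf0 : ∀ t ∈ Ioo (0 : ℝ) 1, 0 < f t) : 0 < ∫ t in (0 : ℝ)..1, f t * p.eval t ^ 2 := by
  have hc : Continuous fun t => f t * p.eval t ^ 2 := by fun_prop
  obtain ⟨t, ht, hpt⟩ : ∃ t ∈ Ioo (0 : ℝ) 1, p.eval t ≠ 0 := by
    by_contra! hcon
    exact hp (Polynomial.eq_zero_of_infinite_isRoot p ((Ioo_infinite one_pos).mono hcon))
  have hnn : ∀ t ∈ Icc (0 : ℝ) 1, 0 ≤ f t := by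
    rw [← closure_Ioo (zero_ne_one' ℝ)]
    exact fun t ht => closure_minimal (fun s hs => (hf0 s hs).le) (isClosed_le continuous_const hf) ht
  refine intervalIntegral.integral_pos one_pos hc.continuousOn
    (fun s hs => mul_nonneg (hnn s (Ioc_subset_Icc_self hs)) (sq_nonneg _)) ⟨t, Ioo_subset_Icc_self ht, ?_⟩
  have := hf0 t ht
  positivity

instance (n : ℕ) : FiniteDimensional ℝ (degreeLT ℝ n) :=
  Module.Finite.equiv (degreeLTEquiv ℝ n).symm

lemma mem_degreeLT_iff {ℓ : ℕ} {p : ℝ[X]} : p ∈ degreeLT ℝ (ℓ + 1) ↔ p.natDegree ≤ ℓ := by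
  rw [mem_degreeLT, natDegree_le_iff_degree_le, Nat.cast_add, Nat.cast_one, ← Nat.cast_succ,
    degree_lt_iff_coeff_zero, degree_le_iff_coeff_zero]
  simp only [Nat.succ_le_iff, Nat.cast_lt]

/-- The moments of order `k` with respect to the midpoint of `[0, 1]`. -/
def moment (k : ℕ) (p : ℝ[X]) : ℝ := ∫ t in (0 : ℝ)..1, p.eval t * (t - 1 / 2) ^ k

lemma moment_add (k : ℕ) (p q : ℝ[X]) : moment k (p + q) = moment k p + moment k q := by
  simp only [moment, eval_add, add_mul]
  exact intervalIntegral.integral_add (integrable_poly _ (by fun_prop)) (integrable_poly _ (by fun_prop))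

lemma moment_smul (k : ℕ) (a : ℝ) (p : ℝ[X]) : moment k (a • p) = a * moment k p := by
  simp only [moment, eval_smul, smul_eq_mul, mul_assoc]
  exact intervalIntegral.integral_const_mul _ _

/-- Vertex values and moments determine a polynomial. -/
lemma eq_zero_of_moments {ℓ : ℕ} {p : ℝ[X]} (hp : p.natDegree ≤ ℓ) (h0 : p.eval 0 = 0)
    (h1 : p.eval 1 = 0) (hm : ∀ q : ℝ[X], q.natDegree + 2 ≤ ℓ →
      ∫ t in (0 : ℝ)..1, p.eval t * q.eval t = 0) : p = 0 := by
  by_contra hp0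
  -- The quotient `q` has degree at most `ℓ - 2` and is itself admissible in the moment condition;
  -- this yields `∫ t (1 - t) q² = 0`.
  obtain ⟨q, rfl⟩ : X * (X - C 1) ∣ p := by
    refine IsCoprime.mul_dvd ?_ ?_ ?_
    · exact ⟨1, -1, by simp⟩
    · rwa [X_dvd_iff, coeff_zero_eq_eval_zero]
    · rwa [dvd_iff_isRoot]
  have hq : q ≠ 0 := right_ne_zero_of_mul hp0
  have hdeg : (X * (X - C 1) * q : ℝ[X]).natDegree = q.natDegree + 2 := by
    rw [natDegree_mul (mul_ne_zero X_ne_zero (X_sub_C_ne_zero 1)) hq, natDegree_mul X_ne_zero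
      (X_sub_C_ne_zero 1), natDegree_X, natDegree_X_sub_C]; ring
  have := hm q (hdeg ▸ hp)
  have hpos := sq_integral_pos hq (f := fun t => t * (1 - t)) (by fun_prop)
    (fun t ht => mul_pos ht.1 (by linarith [ht.2]))
  have e : ∫ t in (0 : ℝ)..1, (X * (X - C 1) * q : ℝ[X]).eval t * q.eval t =
      -∫ t in (0 : ℝ)..1, t * (1 - t) * q.eval t ^ 2 := by
    rw [← intervalIntegral.integral_neg]
    refine intervalIntegral.integral_congr fun t _ => ?_
    simp; ring
  rw [e] at this
  linarith

lemma integral_mul_eq_zero_of_moments {n : ℕ} {p : ℝ[X]} (hm : ∀ k < n, moment k p = 0) {q : ℝ[X]}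
    (hq : q.natDegree < n) : ∫ t in (0 : ℝ)..1, p.eval t * q.eval t = 0 := by
  -- expand `q` in powers of `t - 1/2`
  have e : ∀ t, q.eval t = ∑ k ∈ Finset.range n, (taylor (1 / 2) q).coeff k * (t - 1 / 2) ^ k := by
    intro t
    rw [← eval_eq_sum_range' (by rwa [natDegree_taylor]), taylor_eval]
    congr 1; ring
  simp_rw [e, Finset.mul_sum]
  rw [intervalIntegral.integral_finsetSum fun k _ => integrable_poly _ (by fun_prop)]
  refine Finset.sum_eq_zero fun k hk => ?_
  have := hm k (Finset.mem_range.1 hk)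
  rw [moment] at this
  simp_rw [mul_left_comm (eval _ p), intervalIntegral.integral_const_mul, this, mul_zero]

/-- `exists_functional_bound` for the `L²` product and the point evaluations. It bounds vertex
values by edge norms. -/
lemma exists_sup_bound (ℓ : ℕ) : ∃ C : ℝ, 0 < C ∧ ∀ p : ℝ[X], p.natDegree ≤ ℓ → ∀ t ∈ Icc (0 : ℝ) 1,
    p.eval t ^ 2 ≤ C * ∫ t in (0 : ℝ)..1, p.eval t ^ 2 := by
  let A : degreeLT ℝ (ℓ + 1) →ₗ[ℝ] degreeLT ℝ (ℓ + 1) →ₗ[ℝ] ℝ := LinearMap.mk₂ ℝ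
    (fun p q => ∫ t in (0 : ℝ)..1, p.1.eval t * q.1.eval t)
    (fun p p' q => by
      simp only [Submodule.coe_add, eval_add, add_mul]
      exact intervalIntegral.integral_add (integrable_poly _ (by fun_prop)) (integrable_poly _ (by fun_prop)))
    (fun a p q => by
      simp only [Submodule.coe_smul, eval_smul, smul_eq_mul, mul_assoc]
      exact intervalIntegral.integral_const_mul _ _)
    (fun p q q' => by
      simp only [Submodule.coe_add, eval_add, mul_add]
      exact intervalIntegral.integral_add (integrable_poly _ (by fun_prop)) (integrable_poly _ (by fun_prop)))
    (fun a p q => by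
      simp only [Submodule.coe_smul, eval_smul, smul_eq_mul, mul_left_comm _ a]
      exact intervalIntegral.integral_const_mul _ _)
  have hAA : ∀ v : degreeLT ℝ (ℓ + 1), A v v = ∫ t in (0 : ℝ)..1, v.1.eval t ^ 2 := fun v => by
    simp only [A, LinearMap.mk₂_apply, pow_two]
  obtain ⟨C, hC, h⟩ := exists_functional_bound A (fun v hv => by
      rw [hAA]
      simpa using sq_integral_pos (fun h0 => hv (Subtype.ext h0)) (f := fun _ => 1) continuous_const
        (fun _ _ => one_pos))
    (fun t : Icc (0 : ℝ) 1 => (leval t.1).comp (degreeLT ℝ (ℓ + 1)).subtype)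
    (fun v => by
      obtain ⟨B, hB⟩ := isCompact_Icc.exists_bound_of_continuousOn (s := Icc (0 : ℝ) 1)
        (f := fun t => v.1.eval t) (by fun_prop)
      exact ⟨B, fun t => by simpa [leval] using hB t.1 t.2⟩)
  refine ⟨C, hC, fun p hp t ht => ?_⟩
  have := h ⟨t, ht⟩ ⟨p, mem_degreeLT_iff.2 hp⟩
  rw [hAA] at this
  simpa [leval] using this

/-- `exists_functional_bound` for the form given by end values and moments, which is positive
definite by unisolvence. It bounds the trace coefficients by the degrees of freedom. -/
lemma exists_coeff_bound (ℓ : ℕ) : ∃ C : ℝ, 0 < C ∧ ∀ p : ℝ[X], p.natDegree ≤ ℓ → ∀ k,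
    p.coeff k ^ 2 ≤ C * (p.eval 0 ^ 2 + p.eval 1 ^ 2 + ∑ k : Fin (ℓ - 1), moment k p ^ 2) := by
  let A : degreeLT ℝ (ℓ + 1) →ₗ[ℝ] degreeLT ℝ (ℓ + 1) →ₗ[ℝ] ℝ := LinearMap.mk₂ ℝ
    (fun p q => p.1.eval 0 * q.1.eval 0 + p.1.eval 1 * q.1.eval 1 +
      ∑ k : Fin (ℓ - 1), moment k p.1 * moment k q.1)
    (fun p p' q => by
      simp only [Submodule.coe_add, eval_add, moment_add, add_mul, Finset.sum_add_distrib]; ring)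
    (fun a p q => by
      simp only [Submodule.coe_smul, eval_smul, moment_smul, smul_eq_mul, mul_assoc, ← Finset.mul_sum]; ring)
    (fun p q q' => by
      simp only [Submodule.coe_add, eval_add, moment_add, mul_add, Finset.sum_add_distrib]; ring)
    (fun a p q => by
      simp only [Submodule.coe_smul, eval_smul, moment_smul, smul_eq_mul, mul_left_comm _ a,
        ← Finset.mul_sum]; ring)
  have hAA : ∀ v : degreeLT ℝ (ℓ + 1), A v v = v.1.eval 0 ^ 2 + v.1.eval 1 ^ 2 +
      ∑ k : Fin (ℓ - 1), moment k v.1 ^ 2 := fun v => by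
    simp only [A, LinearMap.mk₂_apply, pow_two]
  obtain ⟨C, hC, h⟩ := exists_functional_bound A (fun v hv => by
      rw [hAA]
      have hnn : 0 ≤ ∑ k : Fin (ℓ - 1), moment k v.1 ^ 2 := Finset.sum_nonneg fun _ _ => sq_nonneg _
      by_contra! hle
      have h0 : v.1.eval 0 = 0 := by nlinarith [sq_nonneg (v.1.eval 0), sq_nonneg (v.1.eval 1)]
      have h1 : v.1.eval 1 = 0 := by nlinarith [sq_nonneg (v.1.eval 0), sq_nonneg (v.1.eval 1)]
      have h2 : ∑ k : Fin (ℓ - 1), moment k v.1 ^ 2 = 0 := by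
        nlinarith [sq_nonneg (v.1.eval 0), sq_nonneg (v.1.eval 1)]
      rw [Finset.sum_eq_zero_iff_of_nonneg fun _ _ => sq_nonneg _] at h2
      refine hv (Subtype.ext (eq_zero_of_moments (mem_degreeLT_iff.1 v.2) h0 h1 fun q hq => ?_))
      exact integral_mul_eq_zero_of_moments (n := ℓ - 1)
        (fun k hk => pow_eq_zero_iff two_ne_zero |>.1 (h2 ⟨k, hk⟩ (Finset.mem_univ _))) (by omega))
    (fun k : ℕ => (lcoeff ℝ k).comp (degreeLT ℝ (ℓ + 1)).subtype)
    (fun v => ⟨∑ k ∈ v.1.support, |v.1.coeff k|, fun k => by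
      by_cases hk : k ∈ v.1.support
      · exact Finset.single_le_sum (f := fun k => |v.1.coeff k|) (fun _ _ => abs_nonneg _) hk
      · have : v.1.coeff k = 0 := by simpa using hk
        simp only [LinearMap.comp_apply, Submodule.subtype_apply, lcoeff_apply, this, abs_zero]
        positivity⟩)
  refine ⟨C, hC, fun p hp k => ?_⟩
  have := h k ⟨p, mem_degreeLT_iff.2 hp⟩
  rw [hAA] at this
  simpa using this

end Interval

end VEM

end

noncomputable section

namespace VEM

/-! ### Weighted polynomial estimates -/

/-- A bump function supported in the ball of radius `ρ / 2`. -/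
def refBump (ρ : ℝ) (hρ : 0 < ρ) : ContDiffBump (0 : Plane) where
  rIn := ρ / 4
  rOut := ρ / 2
  rIn_pos := by positivity
  rIn_lt_rOut := by linarith

instance (ℓ : ℕ) : FiniteDimensional ℝ (MvPolynomial.restrictTotalDegree (Fin 2) ℝ ℓ) := inferInstance

/-- The weighted product is definite because the bump is positive on a ball, where a nonzero
polynomial cannot vanish identically. The evaluations and partial derivatives over the unit ball are
pointwise bounded by compactness. The constant depends on `ℓ` and `ρ` only. -/
lemma exists_bump_bound (ℓ : ℕ) {ρ : ℝ} (hρ : 0 < ρ) : ∃ C : ℝ, 0 < C ∧ ∀ q : Poly, q.totalDegree ≤ ℓ →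
    ∀ y ∈ Metric.closedBall (0 : Plane) 1,
      polyFun q y ^ 2 ≤ C * ∫ x, refBump ρ hρ x * polyFun q x ^ 2 ∧
      ∀ j, polyFun (MvPolynomial.pderiv j q) y ^ 2 ≤ C * ∫ x, refBump ρ hρ x * polyFun q x ^ 2 := by
  set β := refBump ρ hρ with hβ
  have hβc : Continuous β := β.continuous
  let V := MvPolynomial.restrictTotalDegree (Fin 2) ℝ ℓ
  have hint : ∀ p q : Poly, Integrable fun x => β x * (polyFun p x * polyFun q x) := fun p q => by
    have h1 := continuous_polyFun p
    have h2 := continuous_polyFun q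
    exact Continuous.integrable_of_hasCompactSupport (by fun_prop) β.hasCompactSupport.mul_right
  let A : V →ₗ[ℝ] V →ₗ[ℝ] ℝ := LinearMap.mk₂ ℝ
    (fun p q => ∫ x, β x * (polyFun p.1 x * polyFun q.1 x))
    (fun p p' q => by
      simp only [Submodule.coe_add, polyFun_add, add_mul, mul_add]
      exact integral_add (hint _ _) (hint _ _))
    (fun a p q => by
      simp only [Submodule.coe_smul, polyFun_smul, smul_eq_mul, mul_assoc, mul_left_comm _ a]
      exact integral_const_mul _ _)
    (fun p q q' => by
      simp only [Submodule.coe_add, polyFun_add, mul_add]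
      exact integral_add (hint _ _) (hint _ _))
    (fun a p q => by
      simp only [Submodule.coe_smul, polyFun_smul, smul_eq_mul, mul_left_comm _ a]
      exact integral_const_mul _ _)
  have hAA : ∀ v : V, A v v = ∫ x, β x * polyFun v.1 x ^ 2 := fun v => by
    simp only [A, LinearMap.mk₂_apply, pow_two]
  have hApos : ∀ v : V, v ≠ 0 → 0 < A v v := by
    intro v hv
    rw [hAA]
    obtain ⟨x, hx, hvx⟩ : ∃ x ∈ Metric.ball (0 : Plane) (ρ / 2), polyFun v.1 x ≠ 0 := by
      by_contra! hcon
      exact hv (Subtype.ext (eq_zero_of_polyFun_eq_zero (by positivity) hcon))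
    have hc := continuous_polyFun v.1
    refine Continuous.integral_pos_of_hasCompactSupport_nonneg_nonzero (x := x) (by fun_prop)
      β.hasCompactSupport.mul_right (fun y => mul_nonneg β.nonneg (sq_nonneg _)) ?_
    have : 0 < β x := β.pos_of_mem_ball hx
    positivity
  let ev (y : Plane) : Poly →ₗ[ℝ] ℝ := (MvPolynomial.aeval fun j => y j).toLinearMap
  have hev : ∀ y p, ev y p = polyFun p y := fun y p => by simp [ev, polyFun, MvPolynomial.aeval_eq_eval]
  have hbdd : ∀ p : Poly, ∃ B, ∀ y ∈ Metric.closedBall (0 : Plane) 1, |polyFun p y| ≤ B := fun p =>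
    (isCompact_closedBall (0 : Plane) 1).exists_bound_of_continuousOn (continuous_polyFun p).continuousOn
  obtain ⟨C₁, hC₁, h₁⟩ := exists_functional_bound A hApos
    (fun y : Metric.closedBall (0 : Plane) 1 => (ev y).comp V.subtype)
    (fun v => by
      obtain ⟨B, hB⟩ := hbdd v.1
      exact ⟨B, fun y => by simpa [hev] using hB y.1 y.2⟩)
  obtain ⟨C₂, hC₂, h₂⟩ := exists_functional_bound A hApos
    (fun y : Fin 2 × Metric.closedBall (0 : Plane) 1 =>
      (ev y.2).comp ((MvPolynomial.pderiv y.1).toLinearMap.comp V.subtype))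
    (fun v => by
      choose B hB using fun j => hbdd (MvPolynomial.pderiv j v.1)
      exact ⟨max (B 0) (B 1), fun ⟨j, y⟩ => by
        have := hB j y.1 y.2
        simp only [LinearMap.comp_apply, hev]
        refine this.trans ?_
        fin_cases j <;> simp⟩)
  refine ⟨max C₁ C₂, by positivity, fun q hq y hy => ?_⟩
  have hqV : q ∈ V := (MvPolynomial.mem_restrictTotalDegree _ _ _).2 hq
  have hnn : 0 ≤ ∫ x, β x * polyFun q x ^ 2 :=
    integral_nonneg fun x => mul_nonneg β.nonneg (sq_nonneg _)
  constructor
  · have := h₁ ⟨y, hy⟩ ⟨q, hqV⟩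
    rw [hAA] at this
    simp only [LinearMap.comp_apply, hev] at this
    exact this.trans (mul_le_mul_of_nonneg_right (le_max_left _ _) hnn)
  · intro j
    have := h₂ ⟨j, y, hy⟩ ⟨q, hqV⟩
    rw [hAA] at this
    simp only [LinearMap.comp_apply, hev] at this
    exact this.trans (mul_le_mul_of_nonneg_right (le_max_right _ _) hnn)

/-- The bump function scaled by `h` and centred at `c`. -/
def scaledBump (ρ : ℝ) (hρ : 0 < ρ) (c : Plane) (h : ℝ) (x : Plane) : ℝ :=
  refBump ρ hρ (h⁻¹ • (x - c))

section ScaledBump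

variable {ρ : ℝ} (hρ : 0 < ρ) (c : Plane) {h : ℝ}

lemma contDiff_scaledBump {n : ℕ∞} : ContDiff ℝ n (scaledBump ρ hρ c h) :=
  (refBump ρ hρ).contDiff.comp (by fun_prop)

lemma scaledBump_nonneg (x : Plane) : 0 ≤ scaledBump ρ hρ c h x := (refBump ρ hρ).nonneg

lemma scaledBump_le_one (x : Plane) : scaledBump ρ hρ c h x ≤ 1 := (refBump ρ hρ).le_one

lemma tsupport_scaledBump (hh : 0 < h) :
    tsupport (scaledBump ρ hρ c h) ⊆ Metric.closedBall c (ρ / 2 * h) := by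
  refine closure_minimal (fun x hx => ?_) Metric.isClosed_closedBall
  have h1 : h⁻¹ • (x - c) ∈ Function.support (refBump ρ hρ) := hx
  rw [(refBump ρ hρ).support_eq, Metric.mem_ball, dist_zero_right, norm_smul, norm_inv,
    Real.norm_of_nonneg hh.le, inv_mul_lt_iff₀ hh] at h1
  rw [Metric.mem_closedBall, dist_eq_norm]
  have : (refBump ρ hρ).rOut = ρ / 2 := rfl
  rw [this] at h1
  linarith

lemma exists_gradient_scaledBump_le : ∃ C : ℝ, 0 < C ∧ ∀ (c : Plane) (h : ℝ), 0 < h → ∀ x,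
    ‖gradient (scaledBump ρ hρ c h) x‖ ≤ C / h := by
  set β := refBump ρ hρ
  have hβ : ContDiff ℝ 1 β := β.contDiff
  have hcs : HasCompactSupport (fderiv ℝ β) := β.hasCompactSupport.fderiv (𝕜 := ℝ)
  obtain ⟨C, hC⟩ := hcs.exists_bound_of_continuous (hβ.continuous_fderiv (by norm_num))
  refine ⟨|C| + 1, by positivity, fun c h hh x => ?_⟩
  have hd : HasFDerivAt (scaledBump ρ hρ c h)
      ((fderiv ℝ β (h⁻¹ • (x - c))).comp (h⁻¹ • ContinuousLinearMap.id ℝ Plane)) x := by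
    have h1 : HasFDerivAt (fun x : Plane => h⁻¹ • (x - c)) (h⁻¹ • ContinuousLinearMap.id ℝ Plane) x :=
      ((hasFDerivAt_id (𝕜 := ℝ) x).sub_const c).const_smul h⁻¹
    exact ((hβ.differentiable (by norm_num)).differentiableAt.hasFDerivAt).comp x h1
  rw [norm_gradient, hd.fderiv]
  refine (ContinuousLinearMap.opNorm_comp_le _ _).trans ?_
  have h2 : ‖h⁻¹ • ContinuousLinearMap.id ℝ Plane‖ ≤ h⁻¹ := by
    rw [norm_smul, norm_inv, Real.norm_of_nonneg hh.le]
    exact mul_le_of_le_one_right (by positivity) ContinuousLinearMap.norm_id_le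
  calc _ ≤ (|C| + 1) * h⁻¹ := by
        gcongr
        exact (hC _).trans ((le_abs_self C).trans (by linarith))
    _ = _ := by rw [div_eq_mul_inv]

/-- Scaling by `x = c + h y`: the area gives `h²`, and the squared gradient another `h²`. The factor
`2` collects the two partial derivatives. With `h` the diameter and `c` the centre, the closed ball
contains the whole element. -/
lemma exists_scaledBump_bound (ℓ : ℕ) : ∃ C : ℝ, 0 < C ∧ ∀ (c : Plane) (h : ℝ), 0 < h →
    ∀ q : Poly, q.totalDegree ≤ ℓ → ∀ x ∈ Metric.closedBall c h,
      polyFun q x ^ 2 ≤ C / h ^ 2 * ∫ x, scaledBump ρ hρ c h x * polyFun q x ^ 2 ∧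
      ‖gradient (polyFun q) x‖ ^ 2 ≤ C / h ^ 4 * ∫ x, scaledBump ρ hρ c h x * polyFun q x ^ 2 := by
  obtain ⟨C, hC, hb⟩ := exists_bump_bound ℓ hρ
  refine ⟨2 * C, by positivity, fun c h hh q hq x hx => ?_⟩
  have hI : ∫ x, scaledBump ρ hρ c h x * polyFun q x ^ 2 =
      h ^ 2 * ∫ y, refBump ρ hρ y * polyFun (rescale c h q) y ^ 2 := by
    have h1 := Measure.integral_comp_smul (volume : Measure Plane)
      (fun z => scaledBump ρ hρ c h (c + z) * polyFun q (c + z) ^ 2) h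
    rw [integral_add_left_eq_self (fun z => scaledBump ρ hρ c h z * polyFun q z ^ 2) c] at h1
    simp only [finrank_euclideanSpace_fin, smul_eq_mul] at h1
    simp_rw [polyFun_rescale]
    rw [abs_of_nonneg (by positivity), eq_inv_mul_iff_mul_eq₀ (by positivity)] at h1
    rw [← h1]
    congr 1
    refine integral_congr_ae (ae_of_all _ fun y => ?_)
    simp only [scaledBump, add_sub_cancel_left, smul_smul, inv_mul_cancel₀ hh.ne', one_smul]
  set I := ∫ y, refBump ρ hρ y * polyFun (rescale c h q) y ^ 2 with hIdef
  have hInn : 0 ≤ I := integral_nonneg fun y => mul_nonneg (refBump ρ hρ).nonneg (sq_nonneg _)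
  set y := h⁻¹ • (x - c) with hy
  have hxy : c + h • y = x := by rw [hy, smul_smul, mul_inv_cancel₀ hh.ne', one_smul]; abel
  have hyb : y ∈ Metric.closedBall (0 : Plane) 1 := by
    rw [Metric.mem_closedBall, dist_eq_norm] at hx
    rw [mem_closedBall_zero_iff, hy, norm_smul, norm_inv, Real.norm_of_nonneg hh.le,
      inv_mul_le_iff₀ hh, mul_one]
    exact hx
  obtain ⟨h1, h2⟩ := hb (rescale c h q) ((totalDegree_rescale_le c h q).trans hq) y hyb
  rw [hI]
  constructor
  · rw [polyFun_rescale, hxy] at h1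
    calc _ ≤ C * I := h1
      _ ≤ 2 * C * I := by nlinarith
      _ = _ := by field_simp
  · have h3 : ∀ j, polyFun (MvPolynomial.pderiv j (rescale c h q)) y = h * polyFun (MvPolynomial.pderiv j q) x := by
      intro j
      have hd : HasFDerivAt (fun y : Plane => c + h • y) (h • ContinuousLinearMap.id ℝ Plane) y :=
        ((hasFDerivAt_id y).const_smul h).const_add c
      have hq1 : DifferentiableAt ℝ (polyFun q) (c + h • y) :=
        ((contDiff_polyFun q (n := 1)).differentiable (by norm_num)).differentiableAt
      have hcomp := hq1.hasFDerivAt.comp y hd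
      rw [show polyFun q ∘ (fun y => c + h • y) = polyFun (rescale c h q) from
        funext fun z => (polyFun_rescale c h q z).symm] at hcomp
      rw [← gradient_polyFun, ← gradient_polyFun, gradient_apply, gradient_apply, hcomp.fderiv, hxy]
      simp
    have h4 := h2 0
    have h5 := h2 1
    rw [h3, mul_pow] at h4 h5
    rw [norm_sq_eq, gradient_polyFun, gradient_polyFun]
    have h6 : h ^ 2 * (polyFun (MvPolynomial.pderiv 0 q) x ^ 2 + polyFun (MvPolynomial.pderiv 1 q) x ^ 2) ≤
        2 * C * I := by linarith
    calc _ = h ^ 2 * (polyFun (MvPolynomial.pderiv 0 q) x ^ 2 + polyFun (MvPolynomial.pderiv 1 q) x ^ 2) / h ^ 2 := by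
          field_simp
      _ ≤ 2 * C * I / h ^ 2 := by gcongr
      _ = _ := by field_simp

end ScaledBump

namespace Polygon

variable {E : Polygon} {c : Plane}

/-- The restriction of Lebesgue measure to a polygon. -/
abbrev mE (E : Polygon) : Measure Plane := volume.restrict E.carrier

lemma memLp_polyFun (E : Polygon) (q : Poly) : MemLp (polyFun q) 2 E.mE :=
  memLp_of_continuous E.isBounded_carrier (continuous_polyFun q)

lemma memLp_gradient_polyFun (E : Polygon) (q : Poly) : MemLp (gradient (polyFun q)) 2 E.mE :=
  memLp_of_continuous E.isBounded_carrier (continuous_gradient (contDiff_polyFun q))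

lemma scaledBump_isTest {ρ : ℝ} (hρ : 0 < ρ) (h : E.StarBall c (ρ * E.diam)) (q : Poly) :
    IsTestFunction E.carrier (fun x => scaledBump ρ hρ c E.diam x * polyFun q x) := by
  have hd := E.diam_pos
  have h1 : tsupport (fun x => scaledBump ρ hρ c E.diam x * polyFun q x) ⊆
      Metric.closedBall c (ρ / 2 * E.diam) :=
    (closure_mono (Function.support_mul_subset_left _ _)).trans (tsupport_scaledBump hρ c hd)
  refine ⟨(contDiff_scaledBump hρ c).mul (contDiff_polyFun q), ?_, h1.trans ?_⟩
  · exact HasCompactSupport.of_support_subset_isCompact (isCompact_closedBall c (ρ / 2 * E.diam))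
      (subset_closure.trans h1)
  · refine (Metric.closedBall_subset_ball ?_).trans h.ball_subset
    nlinarith [mul_pos hρ hd]

lemma integral_scaledBump_eq {ρ : ℝ} (hρ : 0 < ρ) (h : E.StarBall c (ρ * E.diam)) (q : Poly) :
    ∫ x, scaledBump ρ hρ c E.diam x * polyFun q x ^ 2 =
      ∫ x in E.carrier, polyFun q x * (scaledBump ρ hρ c E.diam x * polyFun q x) := by
  rw [(scaledBump_isTest hρ h q).setIntegral_eq (fun x hx _ => by rw [hx, mul_zero])]
  exact integral_congr_ae (ae_of_all _ fun x => by ring)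

lemma mE_real_univ_le {r : ℝ} (h : E.StarBall c r) : E.mE.real univ ≤ (2 * E.diam) ^ 2 := by
  rw [measureReal_restrict_apply_univ, mul_pow]
  refine h.volume_carrier_le.trans ?_
  have := Real.pi_le_four
  gcongr
  linarith

/-- The inverse inequality for polynomials. -/
lemma exists_inverse_bound (ℓ : ℕ) {ρ : ℝ} (hρ : 0 < ρ) : ∃ C : ℝ, 0 < C ∧
    ∀ (E : Polygon) (c : Plane), E.StarBall c (ρ * E.diam) → ∀ q : Poly, q.totalDegree ≤ ℓ →
      l2 E.mE (gradient (polyFun q)) ≤ C / E.diam * l2 E.mE (polyFun q) := by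
  obtain ⟨C, hC, hb⟩ := exists_scaledBump_bound hρ ℓ
  refine ⟨2 * Real.sqrt C, by positivity, fun E c h q hq => ?_⟩
  have hd := E.diam_pos
  set N := l2 E.mE (polyFun q) with hN
  have hN0 : 0 ≤ N := l2_nonneg _
  have hB : ∫ x, scaledBump ρ hρ c E.diam x * polyFun q x ^ 2 ≤ N ^ 2 := by
    rw [integral_scaledBump_eq hρ h, hN, l2_sq_real]
    refine integral_mono (integrable_mul (memLp_polyFun E q) ((scaledBump_isTest hρ h q).memLp _))
      (memLp_polyFun E q).integrable_sq fun x => ?_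
    have := scaledBump_le_one hρ c (h := E.diam) x
    nlinarith [sq_nonneg (polyFun q x)]
  have hpt : ∀ᵐ x ∂E.mE, ‖gradient (polyFun q) x‖ ≤ Real.sqrt C / E.diam ^ 2 * N := by
    refine (ae_restrict_iff' E.measurableSet_carrier).2 (ae_of_all _ fun x hx => ?_)
    refine abs_le_of_sq_le_sq' ?_ (by positivity) |>.2
    refine (hb c E.diam hd q hq x (h.carrier_subset_closedBall hx)).2.trans ?_
    rw [mul_pow, div_pow, Real.sq_sqrt hC.le, ← pow_mul]
    gcongr
  refine (l2_le_of_bound (by positivity) hpt (mE_real_univ_le h) (by positivity)).trans (le_of_eq ?_)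
  field_simp

/-- A polynomial is controlled by a function of which it is the weak divergence. -/
lemma exists_divergence_bound (ℓ : ℕ) {ρ : ℝ} (hρ : 0 < ρ) : ∃ C : ℝ, 0 < C ∧
    ∀ (E : Polygon) (c : Plane), E.StarBall c (ρ * E.diam) → ∀ q : Poly, q.totalDegree ≤ ℓ →
    ∀ g : Plane → Plane, MemLp g 2 E.mE →
      (∀ φ, IsTestFunction E.carrier φ →
        ∫ x in E.carrier, inner ℝ (g x) (gradient φ x) = -∫ x in E.carrier, polyFun q x * φ x) →
      l2 E.mE (polyFun q) ≤ C / E.diam * l2 E.mE g := by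
  obtain ⟨C, hC, hb⟩ := exists_scaledBump_bound hρ ℓ
  obtain ⟨D, hD, hgb⟩ := exists_gradient_scaledBump_le hρ
  refine ⟨2 * Real.sqrt C * ((Real.sqrt C * (1 + D)) * 2), by positivity, fun E c h q hq g hg hdiv => ?_⟩
  have hd := E.diam_pos
  set b := scaledBump ρ hρ c E.diam with hbdef
  set I := ∫ x, b x * polyFun q x ^ 2 with hI
  have hInn : 0 ≤ I := integral_nonneg fun x => mul_nonneg (scaledBump_nonneg hρ c x) (sq_nonneg _)
  have ht := scaledBump_isTest hρ h q
  have hq1 : ∀ x ∈ E.carrier, |polyFun q x| ≤ Real.sqrt C / E.diam * Real.sqrt I := fun x hx => by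
    refine abs_le_of_sq_le_sq ?_ (by positivity)
    refine (hb c E.diam hd q hq x (h.carrier_subset_closedBall hx)).1.trans (le_of_eq ?_)
    rw [mul_pow, div_pow, Real.sq_sqrt hC.le, Real.sq_sqrt hInn]
  have hq2 : ∀ x ∈ E.carrier, ‖gradient (polyFun q) x‖ ≤ Real.sqrt C / E.diam ^ 2 * Real.sqrt I := fun x hx => by
    refine abs_le_of_sq_le_sq' ?_ (by positivity) |>.2
    refine (hb c E.diam hd q hq x (h.carrier_subset_closedBall hx)).2.trans (le_of_eq ?_)
    rw [mul_pow, div_pow, Real.sq_sqrt hC.le, Real.sq_sqrt hInn, ← pow_mul]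
  have hpt : ∀ᵐ x ∂E.mE, ‖gradient (fun x => b x * polyFun q x) x‖ ≤
      Real.sqrt C * (1 + D) / E.diam ^ 2 * Real.sqrt I := by
    refine (ae_restrict_iff' E.measurableSet_carrier).2 (ae_of_all _ fun x hx => ?_)
    rw [gradient_mul
      ((contDiff_scaledBump hρ c (n := 1)).differentiable (by norm_num)).differentiableAt
      ((contDiff_polyFun q (n := 1)).differentiable (by norm_num)).differentiableAt]
    refine (norm_add_le _ _).trans ?_
    rw [norm_smul, norm_smul, Real.norm_of_nonneg (scaledBump_nonneg hρ c x), Real.norm_eq_abs]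
    calc _ ≤ 1 * (Real.sqrt C / E.diam ^ 2 * Real.sqrt I) +
          (Real.sqrt C / E.diam * Real.sqrt I) * (D / E.diam) := by
          gcongr
          · exact scaledBump_le_one hρ c x
          · exact hq2 x hx
          · exact hq1 x hx
          · exact hgb c E.diam hd x
      _ = _ := by field_simp
  have hl2 := l2_le_of_bound (by positivity) hpt (mE_real_univ_le h) (by positivity)
  -- The equation tested with `b q`, where `b` is the bump: the right side becomes the weighted norm
  -- `I`, and no boundary values of `g` enter. As `I` occurs on the right under a square root, it
  -- can be divided out.
  have hIle : I ≤ l2 E.mE g * (Real.sqrt C * (1 + D) / E.diam ^ 2 * Real.sqrt I * (2 * E.diam)) := by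
    have h1 := hdiv _ ht
    have h2 := abs_integral_inner_le hg (ht.memLp_gradient E.mE)
    have h3 : I = -∫ x in E.carrier, inner ℝ (g x) (gradient (fun x => b x * polyFun q x) x) := by
      rw [h1, neg_neg]
      exact integral_scaledBump_eq hρ h q
    refine h3.le.trans ((neg_le_abs _).trans (h2.trans ?_))
    exact mul_le_mul_of_nonneg_left hl2 (l2_nonneg _)
  have hsq : Real.sqrt I ≤ Real.sqrt C * (1 + D) * 2 / E.diam * l2 E.mE g := by
    rcases eq_or_lt_of_le hInn with h0 | h0
    · rw [← h0, Real.sqrt_zero]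
      have := l2_nonneg (ν := E.mE) g
      positivity
    have hs : 0 < Real.sqrt I := Real.sqrt_pos.2 h0
    refine le_of_mul_le_mul_right ?_ hs
    rw [Real.mul_self_sqrt hInn]
    refine hIle.trans (le_of_eq ?_)
    field_simp
  have hpt1 : ∀ᵐ x ∂E.mE, ‖polyFun q x‖ ≤ Real.sqrt C / E.diam * Real.sqrt I :=
    (ae_restrict_iff' E.measurableSet_carrier).2 (ae_of_all _ hq1)
  refine (l2_le_of_bound (by positivity) hpt1 (mE_real_univ_le h) (by positivity)).trans ?_
  calc Real.sqrt C / E.diam * Real.sqrt I * (2 * E.diam) = 2 * Real.sqrt C * Real.sqrt I := by field_simp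
    _ ≤ 2 * Real.sqrt C * (Real.sqrt C * (1 + D) * 2 / E.diam * l2 E.mE g) := by gcongr
    _ = _ := by ring

/-- The `L²` projection onto polynomials of bounded degree exists. -/
lemma exists_projection (E : Polygon) (ℓ : ℕ) {f : Plane → ℝ} (hf : MemLp f 2 E.mE) :
    ∃ q : Poly, q.totalDegree ≤ ℓ ∧ ∀ p : Poly, p.totalDegree ≤ ℓ →
      ∫ x in E.carrier, polyFun q x * polyFun p x = ∫ x in E.carrier, f x * polyFun p x := by
  let V := MvPolynomial.restrictTotalDegree (Fin 2) ℝ ℓ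
  have hint : ∀ p q : Poly, Integrable (fun x => polyFun p x * polyFun q x) E.mE := fun p q =>
    integrable_mul (memLp_polyFun E p) (memLp_polyFun E q)
  let A : V →ₗ[ℝ] V →ₗ[ℝ] ℝ := LinearMap.mk₂ ℝ
    (fun p q => ∫ x in E.carrier, polyFun p.1 x * polyFun q.1 x)
    (fun p p' q => by
      simp only [Submodule.coe_add, polyFun_add, add_mul]
      exact integral_add (hint _ _) (hint _ _))
    (fun a p q => by
      simp only [Submodule.coe_smul, polyFun_smul, smul_eq_mul, mul_assoc]
      exact integral_const_mul _ _)
    (fun p q q' => by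
      simp only [Submodule.coe_add, polyFun_add, mul_add]
      exact integral_add (hint _ _) (hint _ _))
    (fun a p q => by
      simp only [Submodule.coe_smul, polyFun_smul, smul_eq_mul, mul_left_comm _ a]
      exact integral_const_mul _ _)
  -- The Gram map is injective because a polynomial with zero `L²` norm vanishes on a ball in the
  -- element. It is then surjective by dimension, and its preimage of the functional given by `f` is
  -- the projection.
  have hinj : Function.Injective A := by
    rw [← LinearMap.ker_eq_bot, LinearMap.ker_eq_bot']
    intro v hv
    have h0 : ∫ x in E.carrier, polyFun v.1 x * polyFun v.1 x = 0 := by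
      have := LinearMap.congr_fun hv v
      simpa [A] using this
    rw [integral_eq_zero_iff_of_nonneg (fun x => mul_self_nonneg _) (hint _ _)] at h0
    obtain ⟨x₀, hx₀⟩ := E.isConnected_carrier.nonempty
    obtain ⟨s, hs, hball⟩ := Metric.isOpen_iff.1 E.isOpen_carrier x₀ hx₀
    refine Subtype.ext (eq_zero_of_polyFun_eq_zero (x₀ := x₀) hs fun x hx => ?_)
    have h1 : EqOn (fun x => polyFun v.1 x * polyFun v.1 x) 0 E.carrier := by
      refine Measure.eqOn_open_of_ae_eq h0 E.isOpen_carrier ?_ continuousOn_const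
      have := continuous_polyFun v.1
      exact (by fun_prop : Continuous fun x => polyFun v.1 x * polyFun v.1 x).continuousOn
    have := h1 (hball hx)
    simpa using this
  have hsurj : Function.Surjective A :=
    (LinearMap.injective_iff_surjective_of_finrank_eq_finrank
      (Subspace.dual_finrank_eq (K := ℝ) (V := V)).symm).1 hinj
  let L : V →ₗ[ℝ] ℝ :=
    { toFun := fun p => ∫ x in E.carrier, f x * polyFun p.1 x
      map_add' := fun p q => by
        simp only [Submodule.coe_add, polyFun_add, mul_add]
        exact integral_add (integrable_mul hf (memLp_polyFun E _)) (integrable_mul hf (memLp_polyFun E _))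
      map_smul' := fun a p => by
        simp only [Submodule.coe_smul, polyFun_smul, mul_left_comm _ a, RingHom.id_apply, smul_eq_mul]
        exact integral_const_mul _ _ }
  obtain ⟨q, hq⟩ := hsurj L
  refine ⟨q.1, (MvPolynomial.mem_restrictTotalDegree _ _ _).1 q.2, fun p hp => ?_⟩
  exact LinearMap.congr_fun hq ⟨p, (MvPolynomial.mem_restrictTotalDegree _ _ _).2 hp⟩

end Polygon

end VEM

end

noncomputable section

namespace VEM

/-! ### Traces -/

/-- Lebesgue measure on the unit interval. -/
abbrev mI : Measure ℝ := volume.restrict (Ioc 0 1)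

lemma integral_mI {F : Type*} [NormedAddCommGroup F] [NormedSpace ℝ F] (f : ℝ → F) :
    ∫ t in (0 : ℝ)..1, f t = ∫ t, f t ∂mI := intervalIntegral.integral_of_le zero_le_one

lemma memLp_mI {f : ℝ → ℝ} (hf : Continuous f) : MemLp f 2 mI := by
  obtain ⟨C, hC⟩ := (isCompact_Icc (a := (0 : ℝ)) (b := 1)).exists_bound_of_continuousOn hf.continuousOn
  exact MemLp.of_bound hf.aestronglyMeasurable C
    ((ae_restrict_iff' measurableSet_Ioc).2 (ae_of_all _ fun t ht => hC t (Ioc_subset_Icc_self ht)))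

lemma l2_mI_sq (f : ℝ → ℝ) : l2 mI f ^ 2 = ∫ t in (0 : ℝ)..1, f t ^ 2 := by
  rw [l2_sq_real, integral_mI]

lemma tendsto_l2_mI_iff {f : ℕ → ℝ → ℝ} : Tendsto (fun n => l2 mI (f n)) atTop (𝓝 0) ↔
    Tendsto (fun n => ∫ t in (0 : ℝ)..1, f n t ^ 2) atTop (𝓝 0) := by
  rw [tendsto_l2_iff]
  simp only [integral_mI, Real.norm_eq_abs, sq_abs]

lemma contDiff_one {f : Plane → ℝ} (hf : ContDiff ℝ ∞ f) : ContDiff ℝ 1 f :=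
  hf.of_le (by exact_mod_cast le_top)

lemma l2_le_of_eq_sub {α F : Type*} [MeasurableSpace α] {ν : Measure α} [NormedAddCommGroup F]
    {f g k : α → F} (hf : MemLp f 2 ν) (hg : MemLp g 2 ν) (e : ∀ x, k x = f x - g x) :
    l2 ν k ≤ l2 ν f + l2 ν g := by
  rw [show k = f - g from funext e]
  exact l2_sub_le hf hg

namespace Polygon

variable {E : Polygon} {c : Plane} {r : ℝ} {v w : Plane → ℝ} {i : E.Idx} {ℓ : ℕ}

lemma hasEdgeTrace_iff {g : ℝ → ℝ} : E.HasEdgeTrace v i g ↔ ∃ φ : ℕ → Plane → ℝ,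
    (∀ k, ContDiff ℝ ∞ (φ k)) ∧ TendstoH1 E.carrier φ v ∧
      Tendsto (fun k => l2 mI (fun t => φ k (E.edgePoint i t) - g t)) atTop (𝓝 0) := by
  simp only [HasEdgeTrace, tendsto_l2_mI_iff]

namespace StarBall

lemma l2_edge_le (h : E.StarBall c r) (i : E.Idx) {φ : Plane → ℝ} (hφ : ContDiff ℝ 1 φ) :
    |E.fanDet c i| * l2 mI (fun t => φ (E.edgePoint i t)) ^ 2 ≤
      3 * l2 E.mE φ ^ 2 + E.diam ^ 2 * l2 E.mE (gradient φ) ^ 2 := by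
  rw [l2_mI_sq]
  refine le_trans ?_ (h.sum_trace_le hφ)
  exact Finset.single_le_sum (f := fun i => |E.fanDet c i| * ∫ t in (0 : ℝ)..1, φ (E.edgePoint i t) ^ 2)
    (fun i _ => mul_nonneg (abs_nonneg _) (intervalIntegral.integral_nonneg zero_le_one
      fun _ _ => sq_nonneg _)) (Finset.mem_univ i)

/-- The trace inequality, applied to the difference with the sequence that defines the trace, shows
that every smooth `H¹` approximation of `v` also converges to the trace on the edge. -/
lemma tendsto_edge (h : E.StarBall c r) (hv : MemH1 E.carrier v) {φ : ℕ → Plane → ℝ}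
    (hφ : ∀ n, ContDiff ℝ ∞ (φ n)) (hφv : TendstoH1 E.carrier φ v) {g : ℝ → ℝ} (hg : Continuous g)
    (ht : E.HasEdgeTrace v i g) :
    Tendsto (fun n => l2 mI (fun t => φ n (E.edgePoint i t) - g t)) atTop (𝓝 0) := by
  obtain ⟨ψ, hψ, hψv, hψg⟩ := hasEdgeTrace_iff.1 ht
  rw [tendstoH1_iff] at hφv hψv
  have hce := continuous_edgePoint i
  have hφc := fun n => (hφ n).continuous
  have hψc := fun n => (hψ n).continuous
  have hD := abs_pos.2 (h.fanDet_ne_zero i)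
  have hm : ∀ {f : Plane → ℝ}, Continuous f → MemLp f 2 E.mE := fun hf =>
    memLp_of_continuous E.isBounded_carrier hf
  have hmg : ∀ {f : Plane → ℝ}, ContDiff ℝ ∞ f → MemLp (gradient f) 2 E.mE := fun hf =>
    memLp_of_continuous E.isBounded_carrier (continuous_gradient (contDiff_one hf))
  have h1 : Tendsto (fun n => l2 E.mE (fun x => φ n x - ψ n x)) atTop (𝓝 0) := by
    refine squeeze_zero (fun _ => l2_nonneg _) (fun n => ?_) (by simpa using hφv.1.add hψv.1)
    exact l2_le_of_eq_sub ((hm (hφc n)).sub hv.1) ((hm (hψc n)).sub hv.1)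
      fun x => (sub_sub_sub_cancel_right _ _ _).symm
  have h2 : Tendsto (fun n => l2 E.mE (gradient (fun x => φ n x - ψ n x))) atTop (𝓝 0) := by
    refine squeeze_zero (fun _ => l2_nonneg _) (fun n => ?_) (by simpa using hφv.2.add hψv.2)
    have e : gradient (fun x => φ n x - ψ n x) = fun x => gradient (φ n) x - gradient (ψ n) x :=
      funext fun x => gradient_sub ((contDiff_one (hφ n)).differentiable (by norm_num)).differentiableAt
        ((contDiff_one (hψ n)).differentiable (by norm_num)).differentiableAt
    rw [e]
    exact l2_le_of_eq_sub ((hmg (hφ n)).sub hv.memLp_weakGrad) ((hmg (hψ n)).sub hv.memLp_weakGrad)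
      fun x => (sub_sub_sub_cancel_right _ _ _).symm
  have h3 : Tendsto (fun n => l2 mI (fun t => φ n (E.edgePoint i t) - ψ n (E.edgePoint i t)) ^ 2)
      atTop (𝓝 0) := by
    have hlim := (((h1.pow 2).const_mul 3).add ((h2.pow 2).const_mul (E.diam ^ 2))).const_mul
      |E.fanDet c i|⁻¹
    refine squeeze_zero (fun _ => by positivity) (fun n => ?_) (by simpa using hlim)
    rw [← div_eq_inv_mul, le_div_iff₀' hD]
    exact h.l2_edge_le i (φ := fun x => φ n x - ψ n x) ((contDiff_one (hφ n)).sub (contDiff_one (hψ n)))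
  have h4 : Tendsto (fun n => l2 mI (fun t => φ n (E.edgePoint i t) - ψ n (E.edgePoint i t)))
      atTop (𝓝 0) := by
    have := (Real.continuous_sqrt.tendsto 0).comp h3
    simpa [Function.comp_def, Real.sqrt_sq (l2_nonneg _)] using this
  refine squeeze_zero (fun _ => l2_nonneg _) (fun n => ?_) (by simpa using hψg.add h4)
  have a1 : MemLp (fun t => φ n (E.edgePoint i t)) 2 mI := memLp_mI (by have := hφc n; fun_prop)
  have a2 : MemLp (fun t => ψ n (E.edgePoint i t)) 2 mI := memLp_mI (by have := hψc n; fun_prop)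
  rw [l2_sub_comm (f := fun t => φ n (E.edgePoint i t))
    (g := fun t => ψ n (E.edgePoint i t))]
  exact l2_le_of_eq_sub (a2.sub (memLp_mI hg)) (a2.sub a1) fun x => by simp

/-- A sequence that realises `p` also converges to `q`, and a polynomial with zero norm on the
interval is zero. This identifies the polynomial chosen in `edgeTrace`. -/
lemma hasEdgeTrace_unique (h : E.StarBall c r) (hv : MemH1 E.carrier v) {p q : Polynomial ℝ}
    (hp : E.HasEdgeTrace v i (fun t => p.eval t)) (hq : E.HasEdgeTrace v i (fun t => q.eval t)) :
    p = q := by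
  obtain ⟨φ, hφ, hφv, hφp⟩ := hasEdgeTrace_iff.1 hp
  have hφq := h.tendsto_edge hv hφ hφv (by fun_prop) hq
  have hce := continuous_edgePoint i
  have hle : ∀ n, l2 mI (fun t => p.eval t - q.eval t) ≤
      l2 mI (fun t => φ n (E.edgePoint i t) - q.eval t) +
      l2 mI (fun t => φ n (E.edgePoint i t) - p.eval t) := fun n => by
    have hφc := (hφ n).continuous
    have := l2_sub_le (memLp_mI (f := fun t => φ n (E.edgePoint i t) - q.eval t) (by fun_prop))
      (memLp_mI (f := fun t => φ n (E.edgePoint i t) - p.eval t) (by fun_prop))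
    simpa using this
  have h0 : l2 mI (fun t => p.eval t - q.eval t) ≤ 0 :=
    ge_of_tendsto' (by simpa using hφq.add hφp) hle
  by_contra hne
  have hpos := sq_integral_pos (sub_ne_zero.2 hne) (f := fun _ => 1) continuous_const fun _ _ => one_pos
  simp only [one_mul, Polynomial.eval_sub] at hpos
  rw [← l2_mI_sq, le_antisymm h0 (l2_nonneg _)] at hpos
  simp at hpos

lemma edgeTrace_eq (h : E.StarBall c r) (hv : MemH1 E.carrier v) {q : Polynomial ℝ}
    (hq : E.HasEdgeTrace v i (fun t => q.eval t)) : E.edgeTrace v i = q := by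
  have hex : ∃ q : Polynomial ℝ, E.HasEdgeTrace v i (fun t => q.eval t) := ⟨q, hq⟩
  rw [edgeTrace, dif_pos hex]
  exact h.hasEdgeTrace_unique hv hex.choose_spec hq

lemma hasEdgeTrace_edgeTrace (h : E.StarBall c r) (hv : E.MemEnlarged ℓ v) (i : E.Idx) :
    E.HasEdgeTrace v i (fun t => (E.edgeTrace v i).eval t) ∧ (E.edgeTrace v i).natDegree ≤ ℓ := by
  obtain ⟨q, hq, hqt⟩ := hv.2.2 i
  rw [h.edgeTrace_eq hv.1 hqt]
  exact ⟨hqt, hq⟩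

/-- Smooth functions that approximate `v` together with its traces. -/
lemma exists_approx (h : E.StarBall c r) (hv : E.MemEnlarged ℓ v) : ∃ φ : ℕ → Plane → ℝ,
    (∀ n, ContDiff ℝ ∞ (φ n)) ∧
    Tendsto (fun n => l2 E.mE (fun x => φ n x - v x)) atTop (𝓝 0) ∧
    Tendsto (fun n => l2 E.mE (fun x => gradient (φ n) x - weakGrad E.carrier v x)) atTop (𝓝 0) ∧
    ∀ i, Tendsto (fun n => l2 mI (fun t => φ n (E.edgePoint i t) - (E.edgeTrace v i).eval t))
      atTop (𝓝 0) := by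
  -- The definition gives a sequence for each edge separately; by `tendsto_edge` the one for edge
  -- `0` serves all edges.
  obtain ⟨φ, hφ, hφv, -⟩ := hasEdgeTrace_iff.1 (h.hasEdgeTrace_edgeTrace hv 0).1
  refine ⟨φ, hφ, (tendstoH1_iff.1 hφv).1, (tendstoH1_iff.1 hφv).2, fun i => ?_⟩
  exact h.tendsto_edge hv.1 hφ hφv (by fun_prop) (h.hasEdgeTrace_edgeTrace hv i).1

lemma _root_.VEM.Polygon.hasEdgeTrace_sub (hv : MemH1 E.carrier v) (hw : MemH1 E.carrier w)
    {p q : Polynomial ℝ} (hp : E.HasEdgeTrace v i (fun t => p.eval t))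
    (hq : E.HasEdgeTrace w i (fun t => q.eval t)) :
    E.HasEdgeTrace (fun x => v x - w x) i (fun t => (p - q).eval t) := by
  obtain ⟨φ, hφ, hφv, hφp⟩ := hasEdgeTrace_iff.1 hp
  obtain ⟨ψ, hψ, hψv, hψp⟩ := hasEdgeTrace_iff.1 hq
  rw [tendstoH1_iff] at hφv hψv
  have hce := continuous_edgePoint i
  have hm : ∀ {f : Plane → ℝ}, Continuous f → MemLp f 2 E.mE := fun hf =>
    memLp_of_continuous E.isBounded_carrier hf
  have hmg : ∀ {f : Plane → ℝ}, ContDiff ℝ ∞ f → MemLp (gradient f) 2 E.mE := fun hf =>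
    memLp_of_continuous E.isBounded_carrier (continuous_gradient (contDiff_one hf))
  refine hasEdgeTrace_iff.2 ⟨fun n x => φ n x - ψ n x, fun n => (hφ n).sub (hψ n), ?_, ?_⟩
  · rw [tendstoH1_iff]
    constructor
    · refine squeeze_zero (fun _ => l2_nonneg _) (fun n => ?_) (by simpa using hφv.1.add hψv.1)
      exact l2_le_of_eq_sub ((hm (hφ n).continuous).sub hv.1) ((hm (hψ n).continuous).sub hw.1)
        fun x => sub_sub_sub_comm _ _ _ _
    · refine squeeze_zero (fun _ => l2_nonneg _) (fun n => ?_) (by simpa using hφv.2.add hψv.2)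
      have := l2_sub_le ((hmg (hφ n)).sub hv.memLp_weakGrad) ((hmg (hψ n)).sub hw.memLp_weakGrad)
      simp only [Pi.sub_apply] at this
      refine le_trans (le_of_eq (l2_congr ?_)) this
      filter_upwards [weakGrad_sub E.isOpen_carrier hv hw] with x hx
      rw [hx, gradient_sub ((contDiff_one (hφ n)).differentiable (by norm_num)).differentiableAt
        ((contDiff_one (hψ n)).differentiable (by norm_num)).differentiableAt]
      abel
  · refine squeeze_zero (fun _ => l2_nonneg _) (fun n => ?_) (by simpa using hφp.add hψp)
    have c1 := (hφ n).continuous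
    have c2 := (hψ n).continuous
    exact l2_le_of_eq_sub (memLp_mI (f := fun t => φ n (E.edgePoint i t) - p.eval t) (by fun_prop))
      (memLp_mI (f := fun t => ψ n (E.edgePoint i t) - q.eval t) (by fun_prop))
      fun x => by simp only [Polynomial.eval_sub]; ring

end StarBall

lemma hasEdgeTrace_of_contDiff {f : Plane → ℝ} (hf : ContDiff ℝ ∞ f) (i : E.Idx) :
    E.HasEdgeTrace f i (fun t => f (E.edgePoint i t)) := by
  refine hasEdgeTrace_iff.2 ⟨fun _ => f, fun _ => hf, ?_, by simp [l2]⟩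
  rw [tendstoH1_iff]
  refine ⟨by simp [l2], ?_⟩
  have h0 : l2 E.mE (fun x => gradient f x - weakGrad E.carrier f x) = 0 := by
    have : (fun x => gradient f x - weakGrad E.carrier f x) =ᵐ[E.mE] fun _ => 0 := by
      filter_upwards [(isWeakGradient_of_contDiff E.isBounded_carrier (contDiff_one hf)).weakGrad_ae_eq
        E.isOpen_carrier] with x hx
      rw [hx, sub_self]
    rw [l2_congr this]; simp [l2]
  simp only [h0, tendsto_const_nhds]

/-! ### Polynomials in the enlarged space, and linearity of traces and degrees of freedom -/

/-- The restriction of a polynomial to an edge. -/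
def edgePoly (i : E.Idx) (p : Poly) : Polynomial ℝ :=
  MvPolynomial.aeval (fun j => Polynomial.C (E.vertex i j) +
    Polynomial.C ((E.vertex (i + 1) - E.vertex i) j) * Polynomial.X) p

lemma edgePoly_eval (i : E.Idx) (p : Poly) (t : ℝ) :
    (E.edgePoly i p).eval t = polyFun p (E.edgePoint i t) := by
  rw [edgePoint_eq]
  induction p using MvPolynomial.induction_on with
  | C a => simp [edgePoly]
  | add p q hp hq => rw [polyFun_add, ← hp, ← hq, ← Polynomial.eval_add]; simp only [edgePoly, map_add]
  | mul_X p j hp =>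
    rw [polyFun_mul, ← hp, polyFun_X]
    simp [edgePoly, mul_comm]

lemma natDegree_edgePoly_le (i : E.Idx) {p : Poly} (hp : p.totalDegree ≤ ℓ) :
    (E.edgePoly i p).natDegree ≤ ℓ := by
  have := MvPolynomial.aeval_natDegree_le p hp (n := 1) (fun j => Polynomial.C (E.vertex i j) +
    Polynomial.C ((E.vertex (i + 1) - E.vertex i) j) * Polynomial.X) (fun j => by
      refine (Polynomial.natDegree_add_le _ _).trans (max_le (by simp) ?_)
      exact (Polynomial.natDegree_C_mul_le _ _).trans Polynomial.natDegree_X_le)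
  rwa [mul_one] at this

lemma memH1_polyFun (E : Polygon) (p : Poly) : MemH1 E.carrier (polyFun p) :=
  memH1_of_contDiff E.isBounded_carrier (contDiff_polyFun p)

lemma weakGrad_polyFun (E : Polygon) (p : Poly) :
    weakGrad E.carrier (polyFun p) =ᵐ[E.mE] gradient (polyFun p) :=
  (isWeakGradient_of_contDiff E.isBounded_carrier (contDiff_polyFun p)).weakGrad_ae_eq E.isOpen_carrier

lemma memEnlarged_polyFun {p : Poly} (hp : p.totalDegree ≤ ℓ) : E.MemEnlarged ℓ (polyFun p) := by
  refine ⟨E.memH1_polyFun p, ⟨∑ j, MvPolynomial.pderiv j (MvPolynomial.pderiv j p), ?_, fun φ ht => ?_⟩,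
    fun i => ⟨E.edgePoly i p, natDegree_edgePoly_le i hp, ?_⟩⟩
  · refine MvPolynomial.totalDegree_finsetSum_le fun j _ => ?_
    have h1 := totalDegree_pderiv_le j p
    have h2 := totalDegree_pderiv_le j (MvPolynomial.pderiv j p)
    omega
  · have e1 : ∫ x in E.carrier, inner ℝ (weakGrad E.carrier (polyFun p) x) (gradient φ x) =
        ∫ x in E.carrier, ∑ j, polyFun (MvPolynomial.pderiv j p) x * fderiv ℝ φ x (bv j) := by
      refine integral_congr_ae ?_
      filter_upwards [E.weakGrad_polyFun p] with x hx
      rw [hx, inner_eq]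
      simp only [gradient_polyFun, gradient_apply φ, Fin.sum_univ_two]
    have hI : ∀ j, Integrable (fun x => polyFun (MvPolynomial.pderiv j p) x * fderiv ℝ φ x (bv j)) E.mE := by
      intro j
      refine integrable_mul (memLp_polyFun E _) ?_
      have hc : Continuous fun x => fderiv ℝ φ x (bv j) := by
        have := (contDiff_one ht.1).continuous_fderiv (by norm_num)
        fun_prop
      exact memLp_of_continuous E.isBounded_carrier hc
    rw [e1, integral_finsetSum _ fun j _ => hI j]
    simp_rw [integral_mul_fderiv_test (contDiff_polyFun _) ht, ← gradient_apply, gradient_polyFun,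
      Finset.sum_neg_distrib]
    rw [← integral_finsetSum]
    · congr 1
      refine integral_congr_ae (ae_of_all _ fun x => ?_)
      simp only [polyFun_sum, mul_comm, Finset.mul_sum]
    · exact fun j _ => integrable_mul (ht.memLp _) (memLp_polyFun E _)
  · simp only [edgePoly_eval]
    exact hasEdgeTrace_of_contDiff (contDiff_polyFun p) i

namespace StarBall

lemma _root_.VEM.Polygon.memEnlarged_sub (hv : E.MemEnlarged ℓ v) (hw : E.MemEnlarged ℓ w) :
    E.MemEnlarged ℓ (fun x => v x - w x) := by
  obtain ⟨hv1, ⟨p, hp, hpd⟩, hvt⟩ := hv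
  obtain ⟨hw1, ⟨q, hq, hqd⟩, hwt⟩ := hw
  refine ⟨hv1.sub hw1, ⟨p - q, (MvPolynomial.totalDegree_sub _ _).trans (max_le hp hq), fun φ ht => ?_⟩,
    fun i => ?_⟩
  · have e1 : ∫ x in E.carrier, inner ℝ (weakGrad E.carrier (fun x => v x - w x) x) (gradient φ x) =
        ∫ x in E.carrier, (inner ℝ (weakGrad E.carrier v x) (gradient φ x) -
          inner ℝ (weakGrad E.carrier w x) (gradient φ x)) := by
      refine integral_congr_ae ?_
      filter_upwards [weakGrad_sub E.isOpen_carrier hv1 hw1] with x hx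
      rw [hx, inner_sub_left]
    rw [e1, integral_sub (integrable_inner hv1.memLp_weakGrad (ht.memLp_gradient _))
      (integrable_inner hw1.memLp_weakGrad (ht.memLp_gradient _)), hpd φ ht, hqd φ ht]
    simp only [polyFun_sub, sub_mul]
    rw [integral_sub (integrable_mul (memLp_polyFun E _) (ht.memLp _))
      (integrable_mul (memLp_polyFun E _) (ht.memLp _))]
    ring
  · obtain ⟨a, ha, hat⟩ := hvt i
    obtain ⟨b, hb, hbt⟩ := hwt i
    exact ⟨a - b, (Polynomial.natDegree_sub_le _ _).trans (max_le ha hb), hasEdgeTrace_sub hv1 hw1 hat hbt⟩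

lemma edgeTrace_sub (h : E.StarBall c r) (hv : E.MemEnlarged ℓ v) (hw : E.MemEnlarged ℓ w) (i : E.Idx) :
    E.edgeTrace (fun x => v x - w x) i = E.edgeTrace v i - E.edgeTrace w i :=
  h.edgeTrace_eq (hv.1.sub hw.1) (hasEdgeTrace_sub hv.1 hw.1 (h.hasEdgeTrace_edgeTrace hv i).1
    (h.hasEdgeTrace_edgeTrace hw i).1)

lemma dof_sub (h : E.StarBall c r) (hv : E.MemEnlarged ℓ v) (hw : E.MemEnlarged ℓ w) (d : E.DofIdx ℓ) :
    E.dof ℓ (fun x => v x - w x) d = E.dof ℓ v d - E.dof ℓ w d := by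
  cases d with
  | vertexValue i => simp [dof, h.edgeTrace_sub hv hw]
  | edgeMoment i k =>
    simp only [dof, h.edgeTrace_sub hv hw, edgeIntegral, Polynomial.eval_sub, sub_mul]
    rw [intervalIntegral.integral_sub (integrable_poly _ (by fun_prop)) (integrable_poly _ (by fun_prop))]
    ring
  | interiorMoment a b =>
    simp only [dof, sub_mul]
    have hm : MemLp (fun x : Plane => ((x 0 - E.centroid 0) / E.diam) ^ (a : ℕ) *
        ((x 1 - E.centroid 1) / E.diam) ^ (b : ℕ)) 2 E.mE :=
      memLp_of_continuous E.isBounded_carrier (by fun_prop)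
    rw [integral_sub (integrable_mul hv.1.1 hm) (integrable_mul hw.1.1 hm)]
    ring

/-- The difference with the trace has degree at most `ℓ`, vanishing end values and vanishing
moments, hence is zero by `eq_zero_of_moments`. -/
lemma edgeProjection_eq (h : E.StarBall c r) {Q : (Plane → ℝ) → Polynomial ℝ}
    (hQ : E.IsEdgeProjection ℓ i Q) (hv : E.MemEnlarged ℓ v) : Q v = E.edgeTrace v i := by
  obtain ⟨-, hdeg, hend, hmom, -⟩ := hQ
  rw [← sub_eq_zero]
  refine eq_zero_of_moments (ℓ := ℓ) ((Polynomial.natDegree_sub_le _ _).trans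
    (max_le (hdeg v hv) (h.hasEdgeTrace_edgeTrace hv i).2)) ?_ ?_ fun q hq => ?_
  · rw [Polynomial.eval_sub, (hend v hv).1, sub_self]
  · rw [Polynomial.eval_sub, (hend v hv).2, sub_self]
  · have := hmom v hv q hq
    rw [edgeIntegral, edgeIntegral] at this
    have := mul_left_cancel₀ (edgeLength_pos i).ne' this
    simp only [Polynomial.eval_sub, sub_mul]
    rw [intervalIntegral.integral_sub (integrable_poly _ (by fun_prop)) (integrable_poly _ (by fun_prop)),
      this, sub_self]

end StarBall

end Polygon

end VEM

end

noncomputable section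

namespace VEM

/-! ### Continuity of traces at the vertices -/

lemma sq_sub_le_integral {φ : Plane → ℝ} (hφ : ContDiff ℝ 1 φ) (x m : Plane) :
    (φ (x + m) - φ x) ^ 2 ≤ ‖m‖ ^ 2 * ∫ s in (0 : ℝ)..1, ‖gradient φ (x + s • m)‖ ^ 2 := by
  have hg := continuous_gradient hφ
  have hc : Continuous fun s : ℝ => inner ℝ (gradient φ (x + s • m)) m := by fun_prop
  have hFTC := intervalIntegral.integral_eq_sub_of_hasDerivAt
    (fun s _ => hasDerivAt_comp_line hφ x m s) (hc.intervalIntegrable 0 1)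
  simp only [one_smul, zero_smul, add_zero] at hFTC
  rw [← hFTC, ← intervalIntegral.integral_const_mul]
  refine (sq_integral_le hc).trans (intervalIntegral.integral_mono_on zero_le_one
    (Continuous.intervalIntegrable (by fun_prop) _ _)
    (Continuous.intervalIntegrable (by fun_prop) _ _) fun s _ => ?_)
  rw [← mul_pow, ← sq_abs]
  exact pow_le_pow_left₀ (abs_nonneg _)
    ((abs_real_inner_le_norm _ _).trans (mul_comm _ _).le) 2

/-- At distance parameter `s` from the apex the two sides are joined by a segment of length `s ‖b -
A‖`, which is a coordinate line of the collapsed coordinates. Its squared length supplies `s² ≤ s`,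
which is absorbed in the Jacobian. -/
lemma corner_le {φ : Plane → ℝ} (hφ : ContDiff ℝ 1 φ) (p : Plane) {A b : Plane} (hD : cr A b ≠ 0) :
    |cr A b| * ∫ s in (0 : ℝ)..1, (φ (p + s • b) - φ (p + s • A)) ^ 2 ≤
      ‖b - A‖ ^ 2 * ∫ x in tri p A b, ‖gradient φ x‖ ^ 2 := by
  have hg := continuous_gradient hφ
  have hφc := hφ.continuous
  have hd := continuous_duffy p A b
  rw [integral_tri hD, smul_eq_mul, mul_left_comm]
  refine mul_le_mul_of_nonneg_left ?_ (abs_nonneg _)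
  simp only [smul_eq_mul]
  rw [integral_square_eq _ (by fun_prop), ← intervalIntegral.integral_const_mul]
  refine intervalIntegral.integral_mono_on zero_le_one (Continuous.intervalIntegrable (by fun_prop) _ _)
    (Continuous.intervalIntegrable ?_ _ _) fun s hs => ?_
  · refine continuous_const.mul
      (intervalIntegral.continuous_parametric_intervalIntegral_of_continuous' (by fun_prop) _ _)
  have h1 := sq_sub_le_integral hφ (p + s • A) (s • (b - A))
  rw [show p + s • A + s • (b - A) = p + s • b by module] at h1
  refine h1.trans ?_
  rw [intervalIntegral.integral_const_mul, norm_smul, mul_pow, Real.norm_eq_abs, sq_abs,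
    mul_comm (s ^ 2), mul_assoc]
  have e : ∀ t : ℝ, p + s • A + t • s • (b - A) = duffy p A b (s, t) := fun t => by
    simp only [duffy]; module
  simp only [e]
  have h0 : 0 ≤ ∫ t in (0 : ℝ)..1, ‖gradient φ (duffy p A b (s, t))‖ ^ 2 :=
    intervalIntegral.integral_nonneg zero_le_one fun _ _ => sq_nonneg _
  gcongr
  nlinarith [hs.1, hs.2]

lemma l2_mI_comp_le {f : ℝ → ℝ} (hf : Continuous f) {ε a : ℝ} (hε : ε ≠ 0) (h0 : a ∈ Icc (0 : ℝ) 1)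
    (h1 : a + ε ∈ Icc (0 : ℝ) 1) :
    l2 mI (fun s => f (a + s * ε)) ^ 2 ≤ |ε|⁻¹ * l2 mI f ^ 2 := by
  rw [l2_mI_sq, l2_mI_sq]
  simp only [mul_comm _ ε]
  rw [intervalIntegral.integral_comp_add_mul (fun s => f s ^ 2) hε, smul_eq_mul, mul_zero, mul_one,
    add_zero]
  have key : ∀ x y : ℝ, 0 ≤ x → x ≤ y → y ≤ 1 → ∫ t in x..y, f t ^ 2 ≤ ∫ t in (0 : ℝ)..1, f t ^ 2 :=
    fun x y hx hxy hy => intervalIntegral.integral_mono_interval hx hxy hy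
      (ae_of_all _ fun _ => sq_nonneg _) (Continuous.intervalIntegrable (by fun_prop) _ _)
  rcases hε.lt_or_gt with hε | hε
  · rw [intervalIntegral.integral_symm, abs_of_neg hε, inv_neg, neg_mul, mul_neg, neg_le_neg_iff]
    exact mul_le_mul_of_nonpos_left (key _ _ h1.1 (by linarith) h0.2) (inv_nonpos.2 hε.le)
  · rw [abs_of_pos hε]
    exact mul_le_mul_of_nonneg_left (key _ _ h0.1 (by linarith) h1.2) (inv_nonneg.2 hε.le)

namespace Polygon

variable {E : Polygon} {c : Plane} {r : ℝ} {v w : Plane → ℝ} {ℓ : ℕ}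

namespace StarBall

/-- A point of the small triangle is a convex combination of `c`, with positive weight, and a point
`p + t b` of the closure. -/
lemma corner_subset (h : E.StarBall c r) {p b : Plane}
    (hb : ∀ t ∈ Icc (0 : ℝ) 1, p + t • b ∈ closure E.carrier) {ε : ℝ} (hε : 0 < ε) (hε1 : ε ≤ 1) :
    tri p (ε • (c - p)) (ε • b) ⊆ E.carrier := by
  rintro _ ⟨⟨s, t⟩, ⟨hs, ht⟩, rfl⟩
  simp only [mem_Ioo] at hs ht
  have hsε : 0 < s * ε := mul_pos hs.1 hε
  have hsε1 : s * ε < 1 := by nlinarith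
  have hw : 0 < s * ε * (1 - t) := mul_pos hsε (by linarith)
  have hw1 : 0 < 1 - s * ε * (1 - t) := by nlinarith
  have := h.add_smul_mem (Metric.mem_ball_self h.pos) (hb (s * ε * t / (1 - s * ε * (1 - t)))
    ⟨by have := ht.1; positivity, by rw [div_le_one hw1]; nlinarith⟩) hw1.le (by linarith)
  convert this using 1
  simp only [duffy]
  have e : (1 - s * ε * (1 - t)) • (s * ε * t / (1 - s * ε * (1 - t))) • b = (s * ε * t) • b := by
    rw [smul_smul, mul_div_cancel₀ _ hw1.ne']
  rw [add_sub_right_comm, smul_add _ (p - c), e]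
  module

/-- The factor `ε²` from the area cancels the one from the squared side length, so the constant is
independent of `ε` while the domain of integration shrinks to `p`. -/
lemma corner_integral_le (h : E.StarBall c r) {φ : Plane → ℝ} (hφ : ContDiff ℝ 1 φ) {p b : Plane}
    (hb : ∀ t ∈ Icc (0 : ℝ) 1, p + t • b ∈ closure E.carrier) (hD : cr (c - p) b ≠ 0)
    {ε : ℝ} (hε : 0 < ε) (hε1 : ε ≤ 1) :
    ∫ s in (0 : ℝ)..1, (φ (p + (s * ε) • b) - φ (p + (s * ε) • (c - p))) ^ 2 ≤
      ‖b - (c - p)‖ ^ 2 / |cr (c - p) b| *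
        ∫ x in E.carrier ∩ Metric.closedBall p (ε * (‖c - p‖ + ‖b‖)), ‖gradient φ x‖ ^ 2 := by
  have hD' : cr (ε • (c - p)) (ε • b) = ε ^ 2 * cr (c - p) b := by
    rw [cr_smul_left, cr_smul_right]; ring
  have h1 := corner_le hφ p (A := ε • (c - p)) (b := ε • b) (by rw [hD']; positivity)
  rw [hD', abs_mul, abs_of_pos (by positivity : 0 < ε ^ 2), ← smul_sub, norm_smul, mul_pow,
    Real.norm_eq_abs, sq_abs, mul_assoc, mul_assoc] at h1
  have h2 := le_of_mul_le_mul_left h1 (by positivity)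
  simp only [smul_smul] at h2
  have h3 : ∫ x in tri p (ε • (c - p)) (ε • b), ‖gradient φ x‖ ^ 2 ≤
      ∫ x in E.carrier ∩ Metric.closedBall p (ε * (‖c - p‖ + ‖b‖)), ‖gradient φ x‖ ^ 2 := by
    refine setIntegral_mono_set ?_ (ae_of_all _ fun _ => sq_nonneg _) (LE.le.eventuallyLE ?_)
    · exact (integrable_norm_sq (memLp_of_continuous E.isBounded_carrier
        (continuous_gradient hφ))).mono_measure (Measure.restrict_mono inter_subset_left le_rfl)
    · refine subset_inter (h.corner_subset hb hε hε1) ?_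
      rintro _ ⟨⟨s, t⟩, ⟨hs, ht⟩, rfl⟩
      simp only [mem_Ioo] at hs ht
      rw [Metric.mem_closedBall, dist_eq_norm]
      have e : duffy p (ε • (c - p)) (ε • b) (s, t) - p =
          (ε * (s * (1 - t))) • (c - p) + (ε * (s * t)) • b := by
        simp only [duffy]; module
      rw [e, mul_add]
      have b1 : s * (1 - t) ≤ 1 := by nlinarith
      have b2 : s * t ≤ 1 := by nlinarith
      have b3 : 0 ≤ s * (1 - t) := mul_nonneg hs.1.le (by linarith)
      have b4 : 0 ≤ s * t := mul_nonneg hs.1.le ht.1.le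
      refine (norm_add_le _ _).trans (add_le_add ?_ ?_) <;>
      · rw [norm_smul, Real.norm_eq_abs, abs_of_nonneg (by positivity)]
        gcongr
        nlinarith
  rw [div_mul_eq_mul_div, le_div_iff₀' (abs_pos.2 hD)]
  exact h2.trans (mul_le_mul_of_nonneg_left h3 (sq_nonneg _))

/-- Point values mean nothing for `H¹` functions in the plane. However, the mean square difference
of the traces over boundary pieces of size `ε` at the vertex is bounded by the energy in a ball of
radius proportional to `ε`. This tends to zero, and for polynomial traces the left side tends to the
squared jump. -/
lemma edgeTrace_vertex (h : E.StarBall c r) (hv : E.MemEnlarged ℓ v) (i : E.Idx) :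
    (E.edgeTrace v i).eval 1 = (E.edgeTrace v (i + 1)).eval 0 := by
  obtain ⟨φ, hφ, -, hφg, hφt⟩ := h.exists_approx hv
  set p := E.vertex (i + 1) with hp
  set b₁ := E.vertex i - p
  set b₂ := E.vertex (i + 1 + 1) - p
  set g₁ := E.edgeTrace v i
  set g₂ := E.edgeTrace v (i + 1)
  have hγ₁ : ∀ s : ℝ, p + s • b₁ = E.edgePoint i (1 - s) := fun s => by
    rw [edgePoint_eq]; simp only [b₁, hp]; module
  have hγ₂ : ∀ s : ℝ, p + s • b₂ = E.edgePoint (i + 1) s := fun s => by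
    rw [edgePoint_eq]
  have hD₁ : cr (c - p) b₁ ≠ 0 := by
    have : cr (c - p) b₁ = E.fanDet c i := by simp only [fanDet, cr, b₁, hp, PiLp.sub_apply]; ring
    rw [this]; exact h.fanDet_ne_zero i
  have hD₂ : cr (c - p) b₂ ≠ 0 := by
    have : cr (c - p) b₂ = -E.fanDet c (i + 1) := by
      simp only [fanDet, cr, b₂, hp, PiLp.sub_apply]; ring
    rw [this]; exact neg_ne_zero.2 (h.fanDet_ne_zero _)
  have hb₁ : ∀ t ∈ Icc (0 : ℝ) 1, p + t • b₁ ∈ closure E.carrier := fun t ht => by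
    rw [hγ₁]; exact edgePoint_mem_closure i ⟨by linarith [ht.2], by linarith [ht.1]⟩
  have hb₂ : ∀ t ∈ Icc (0 : ℝ) 1, p + t • b₂ ∈ closure E.carrier := fun t ht => by
    rw [hγ₂]; exact edgePoint_mem_closure _ ht
  -- The ball of radius `ε R` about the vertex contains both corner triangles. The constant `K` need
  -- not be uniform over polygons, as it multiplies a quantity that tends to zero.
  set R := ‖c - p‖ + ‖b₁‖ + ‖b₂‖
  set K := ‖b₁ - (c - p)‖ ^ 2 / |cr (c - p) b₁| + ‖b₂ - (c - p)‖ ^ 2 / |cr (c - p) b₂|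
  set S : ℝ → Set Plane := fun ε => E.carrier ∩ Metric.closedBall p (ε * R)
  have hce := continuous_edgePoint i
  have hce' := continuous_edgePoint (i + 1)
  have hgm := hv.1.memLp_weakGrad
  have hgφ := fun n => memLp_of_continuous E.isBounded_carrier (continuous_gradient (contDiff_one (hφ n)))
  have hres : ∀ ε, volume.restrict (S ε) ≤ volume.restrict E.carrier := fun ε =>
    Measure.restrict_mono inter_subset_left le_rfl
  -- Both edges are compared with the segment from the vertex to `c`.
  have smooth : ∀ n, ∀ ε, 0 < ε → ε ≤ 1 →
      l2 mI (fun s => φ n (E.edgePoint i (1 - s * ε)) - φ n (E.edgePoint (i + 1) (s * ε))) ^ 2 ≤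
        2 * K * l2 (volume.restrict (S ε)) (gradient (φ n)) ^ 2 := by
    intro n ε hε hε1
    have hc := (hφ n).continuous
    have hmono : ∀ R', R' ≤ R → ∫ x in E.carrier ∩ Metric.closedBall p (ε * R'), ‖gradient (φ n) x‖ ^ 2 ≤
        l2 (volume.restrict (S ε)) (gradient (φ n)) ^ 2 := fun R' hR' => by
      rw [l2_sq]
      refine setIntegral_mono_set ((integrable_norm_sq (hgφ n)).mono_measure (hres ε))
        (ae_of_all _ fun _ => sq_nonneg _) (LE.le.eventuallyLE ?_)
      exact inter_subset_inter_right _ (Metric.closedBall_subset_closedBall (by gcongr))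
    have k1 := (h.corner_integral_le (contDiff_one (hφ n)) hb₁ hD₁ hε hε1).trans
      (mul_le_mul_of_nonneg_left (hmono _ (by simp only [R]; linarith [norm_nonneg b₂])) (by positivity))
    have k2 := (h.corner_integral_le (contDiff_one (hφ n)) hb₂ hD₂ hε hε1).trans
      (mul_le_mul_of_nonneg_left (hmono _ (by simp only [R]; linarith [norm_nonneg b₁])) (by positivity))
    rw [l2_mI_sq]
    have k3 : ∫ s in (0 : ℝ)..1, (φ n (E.edgePoint i (1 - s * ε)) - φ n (E.edgePoint (i + 1) (s * ε))) ^ 2 ≤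
        ∫ s in (0 : ℝ)..1, (2 * (φ n (p + (s * ε) • b₁) - φ n (p + (s * ε) • (c - p))) ^ 2 +
          2 * (φ n (p + (s * ε) • b₂) - φ n (p + (s * ε) • (c - p))) ^ 2) := by
      refine intervalIntegral.integral_mono_on zero_le_one (Continuous.intervalIntegrable (by fun_prop) _ _)
        (Continuous.intervalIntegrable (by fun_prop) _ _) fun s _ => ?_
      rw [hγ₁, hγ₂]
      nlinarith [sq_nonneg (φ n (E.edgePoint i (1 - s * ε)) + φ n (E.edgePoint (i + 1) (s * ε)) -
        2 * φ n (p + (s * ε) • (c - p)))]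
    rw [intervalIntegral.integral_add (Continuous.intervalIntegrable (by fun_prop) _ _)
      (Continuous.intervalIntegrable (by fun_prop) _ _), intervalIntegral.integral_const_mul,
      intervalIntegral.integral_const_mul] at k3
    simp only [K]
    linarith
  have limit : ∀ ε, 0 < ε → ε ≤ 1 →
      ∫ s in (0 : ℝ)..1, (g₁.eval (1 - s * ε) - g₂.eval (s * ε)) ^ 2 ≤
        2 * K * l2 (volume.restrict (S ε)) (weakGrad E.carrier v) ^ 2 := by
    intro ε hε hε1
    rw [← l2_mI_sq]
    have t1 : ∀ (f : ℕ → ℝ → ℝ) (a ε' : ℝ), (∀ n, Continuous (f n)) → ε' ≠ 0 → a ∈ Icc (0 : ℝ) 1 →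
        a + ε' ∈ Icc (0 : ℝ) 1 → Tendsto (fun n => l2 mI (f n)) atTop (𝓝 0) →
        Tendsto (fun n => l2 mI (fun s => f n (a + s * ε'))) atTop (𝓝 0) := by
      intro f a ε' hf hε' ha ha' hlim
      have h2 : Tendsto (fun n => l2 mI (fun s => f n (a + s * ε')) ^ 2) atTop (𝓝 0) :=
        squeeze_zero (fun _ => sq_nonneg _) (fun n => l2_mI_comp_le (hf n) hε' ha ha')
          (by simpa using (hlim.pow 2).const_mul |ε'|⁻¹)
      have := (Real.continuous_sqrt.tendsto 0).comp h2
      simpa [Function.comp_def, Real.sqrt_sq (l2_nonneg _)] using this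
    have u1 := t1 _ 1 (-ε) (fun n => by have := (hφ n).continuous; fun_prop) (by linarith) (by simp)
      ⟨by linarith, by linarith⟩ (hφt i)
    have u2 := t1 _ 0 ε (fun n => by have := (hφ n).continuous; fun_prop) hε.ne' (by simp)
      ⟨by linarith, by linarith⟩ (hφt (i + 1))
    simp only [mul_neg, ← sub_eq_add_neg] at u1
    simp only [zero_add] at u2
    have L1 : Tendsto (fun n => l2 mI (fun s => φ n (E.edgePoint i (1 - s * ε)) -
        φ n (E.edgePoint (i + 1) (s * ε)))) atTop
        (𝓝 (l2 mI fun s => g₁.eval (1 - s * ε) - g₂.eval (s * ε))) := by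
      refine tendsto_l2 (fun n => memLp_mI (by have := (hφ n).continuous; fun_prop))
        (memLp_mI (by fun_prop)) ?_
      refine squeeze_zero (fun _ => l2_nonneg _) (fun n => ?_) (by simpa using u1.add u2)
      have := (hφ n).continuous
      exact l2_le_of_eq_sub (memLp_mI (by fun_prop)) (memLp_mI (by fun_prop))
        fun x => sub_sub_sub_comm _ _ _ _
    have L2 : Tendsto (fun n => l2 (volume.restrict (S ε)) (gradient (φ n))) atTop
        (𝓝 (l2 (volume.restrict (S ε)) (weakGrad E.carrier v))) := by
      refine tendsto_l2 (fun n => (hgφ n).mono_measure (hres ε)) (hgm.mono_measure (hres ε)) ?_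
      refine squeeze_zero (fun _ => l2_nonneg _) (fun n => ?_) hφg
      refine Real.sqrt_le_sqrt (integral_mono_measure (hres ε) (ae_of_all _ fun _ => sq_nonneg _) ?_)
      exact integrable_norm_sq ((hgφ n).sub hgm)
    exact le_of_tendsto_of_tendsto' (L1.pow 2) ((L2.pow 2).const_mul _) fun n => smooth n ε hε hε1
  have hseq : Tendsto (fun k : ℕ => 1 / ((k : ℝ) + 1)) atTop (𝓝 0) := tendsto_one_div_add_atTop_nhds_zero_nat
  have hleft : Tendsto (fun k : ℕ => ∫ s in (0 : ℝ)..1, (g₁.eval (1 - s * (1 / ((k : ℝ) + 1))) -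
      g₂.eval (s * (1 / ((k : ℝ) + 1)))) ^ 2) atTop (𝓝 ((g₁.eval 1 - g₂.eval 0) ^ 2)) := by
    have hc : Continuous fun ε : ℝ => ∫ s in (0 : ℝ)..1, (g₁.eval (1 - s * ε) - g₂.eval (s * ε)) ^ 2 :=
      intervalIntegral.continuous_parametric_intervalIntegral_of_continuous' (by fun_prop) _ _
    have := (hc.tendsto 0).comp hseq
    simpa [Function.comp_def] using this
  -- The sets decrease to a subset of the single point `p`, so the energy on them tends to zero.
  have hright : Tendsto (fun k : ℕ => l2 (volume.restrict (S (1 / ((k : ℝ) + 1)))) (weakGrad E.carrier v) ^ 2)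
      atTop (𝓝 0) := by
    simp only [l2_sq]
    have hanti : Antitone fun k : ℕ => S (1 / ((k : ℝ) + 1)) := fun k l hkl =>
      inter_subset_inter_right _ (Metric.closedBall_subset_closedBall
        (mul_le_mul_of_nonneg_right (one_div_le_one_div_of_le (by positivity) (by gcongr)) (by positivity)))
    have hlim := tendsto_setIntegral_of_antitone (μ := volume) (f := fun x => ‖weakGrad E.carrier v x‖ ^ 2)
      (fun k : ℕ => (E.measurableSet_carrier.inter Metric.isClosed_closedBall.measurableSet :
        MeasurableSet (S (1 / ((k : ℝ) + 1))))) hanti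
      ⟨0, (integrable_norm_sq hgm).mono_measure (hres _)⟩
    have hsub : ⋂ k : ℕ, S (1 / ((k : ℝ) + 1)) ⊆ {p} := by
      intro x hx
      rw [mem_iInter] at hx
      have : dist x p ≤ 0 * R := ge_of_tendsto' (hseq.mul_const R) fun k => (hx k).2
      rw [zero_mul] at this
      exact dist_le_zero.1 this
    rwa [setIntegral_measure_zero _ (measure_mono_null hsub (measure_singleton p))] at hlim
  have := le_of_tendsto_of_tendsto' hleft (hright.const_mul (2 * K)) fun k =>
    limit _ (by positivity) (by rw [div_le_one (by positivity)]; linarith [k.cast_nonneg (α := ℝ)])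
  rw [mul_zero] at this
  exact sub_eq_zero.1 (pow_eq_zero_iff two_ne_zero |>.1 (le_antisymm this (sq_nonneg _)))

end StarBall
end Polygon
end VEM

end

noncomputable section

namespace VEM

/-! ### Green's formula and the gradient projection -/

lemma memLp_apply {α : Type*} [MeasurableSpace α] {ν : Measure α} {f : α → Plane} (hf : MemLp f 2 ν)
    (j : Fin 2) : MemLp (fun x => f x j) 2 ν :=
  (EuclideanSpace.proj j : Plane →L[ℝ] ℝ).comp_memLp' hf

lemma l2_apply_le {α : Type*} [MeasurableSpace α] {ν : Measure α} {f : α → Plane} (hf : MemLp f 2 ν)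
    (j : Fin 2) : l2 ν (fun x => f x j) ≤ l2 ν f :=
  l2_mono hf (ae_of_all _ fun x => PiLp.norm_apply_le (f x) j)

namespace Polygon

variable {E : Polygon} {c : Plane} {r : ℝ} {v w : Plane → ℝ} {ℓ : ℕ}

namespace StarBall

/-- `green_fan` applied to the product `φ p`, the same function on every triangle. -/
lemma green_smooth (h : E.StarBall c r) {φ : Plane → ℝ} (hφ : ContDiff ℝ 1 φ) {p : Plane → ℝ}
    (hp : ContDiff ℝ 1 p) (j : Fin 2) :
    ∫ x in E.carrier, gradient φ x j * p x =
      -(∫ x in E.carrier, φ x * gradient p x j) +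
        ∑ i, E.edgeIntegral i (fun t => φ (E.edgePoint i t) *
          (p (E.edgePoint i t) * E.outwardNormal i j)) := by
  have hf : ContDiff ℝ 1 (fun x => φ x * p x) := hφ.mul hp
  have hI : ∀ {f : Plane → ℝ}, Continuous f → Integrable f E.mE := fun hf =>
    (memLp_of_continuous E.isBounded_carrier hf).integrable (by norm_num)
  have hc := continuous_gradient hφ
  have hcp := continuous_gradient hp
  have h1 := h.green_fan (bv j) (f := fun _ x => φ x * p x) (fun _ => hf) (fun _ _ => rfl)
  have e : ∀ x, fderiv ℝ (fun x => φ x * p x) x (bv j) =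
      gradient φ x j * p x + φ x * gradient p x j := fun x => by
    rw [← gradient_apply, gradient_mul (hφ.differentiable (by norm_num)).differentiableAt
      (hp.differentiable (by norm_num)).differentiableAt]
    simp only [PiLp.add_apply, PiLp.smul_apply, smul_eq_mul]; ring
  simp only [e] at h1
  have i1 := hI (f := fun x => gradient φ x j * p x) (by have := hp.continuous; fun_prop)
  have i2 := hI (f := fun x => φ x * gradient p x j)
    (by have := hφ.continuous; fun_prop)
  have h2 := h.integral_eq_sum (f := fun x => gradient φ x j * p x +
    φ x * gradient p x j) fun i => ((i1.add i2).mono_measure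
    (Measure.restrict_mono (h.fanTri_subset i) le_rfl))
  rw [← h2, integral_add i1 i2] at h1
  rw [← sub_eq_iff_eq_add', sub_neg_eq_add, h1]
  refine Finset.sum_congr rfl fun i _ => ?_
  rw [← h.edgeLength_mul_inner_outwardNormal, real_inner_comm, inner_bv, edgeIntegral, mul_assoc]
  congr 1
  rw [← intervalIntegral.integral_const_mul]
  refine intervalIntegral.integral_congr fun t _ => ?_
  ring

/-- Every term is continuous along a sequence that approximates `v` in `H¹` and its traces on all
edges at once. -/
lemma green_apply (h : E.StarBall c r) (hv : E.MemEnlarged ℓ v) {p : Plane → ℝ}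
    (hp : ContDiff ℝ 1 p) (j : Fin 2) :
    ∫ x in E.carrier, weakGrad E.carrier v x j * p x =
      -(∫ x in E.carrier, v x * gradient p x j) +
        ∑ i, E.edgeIntegral i (fun t => (E.edgeTrace v i).eval t *
          (p (E.edgePoint i t) * E.outwardNormal i j)) := by
  obtain ⟨φ, hφ, hφv, hφg, hφt⟩ := h.exists_approx hv
  have hg := hv.1.memLp_weakGrad
  have hφg' := fun n => memLp_of_continuous E.isBounded_carrier (continuous_gradient (contDiff_one (hφ n)))
  have hpc := hp.continuous
  have hpg := continuous_gradient hp
  have hm : MemLp p 2 E.mE := memLp_of_continuous E.isBounded_carrier hpc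
  have hmg : MemLp (gradient p) 2 E.mE := memLp_of_continuous E.isBounded_carrier hpg
  have L1 : Tendsto (fun n => ∫ x in E.carrier, gradient (φ n) x j * p x) atTop
      (𝓝 (∫ x in E.carrier, weakGrad E.carrier v x j * p x)) :=
    tendsto_integral_mul (fun n => memLp_apply (hφg' n) j) (memLp_apply hg j) hm
      (squeeze_zero (fun _ => l2_nonneg _) (fun n => l2_apply_le ((hφg' n).sub hg) j) hφg)
  have L2 := tendsto_integral_mul (fun n => memLp_of_continuous E.isBounded_carrier (hφ n).continuous)
    hv.1.1 (memLp_apply hmg j) hφv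
  have L3 : ∀ i, Tendsto (fun n => E.edgeIntegral i (fun t => φ n (E.edgePoint i t) *
      (p (E.edgePoint i t) * E.outwardNormal i j))) atTop
      (𝓝 (E.edgeIntegral i (fun t => (E.edgeTrace v i).eval t *
      (p (E.edgePoint i t) * E.outwardNormal i j)))) := fun i => by
    simp only [edgeIntegral, integral_mI]
    have hce := continuous_edgePoint i
    exact (tendsto_integral_mul (fun n => memLp_mI (by have := (hφ n).continuous; fun_prop))
      (memLp_mI (by fun_prop)) (memLp_mI (by fun_prop)) (hφt i)).const_mul _
  refine tendsto_nhds_unique L1 ?_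
  simp only [fun n => h.green_smooth (contDiff_one (hφ n)) hp j]
  exact L2.neg.add (tendsto_finsetSum _ fun i _ => L3 i)

end StarBall

/-- Degrees up to `ℓ - 2` are covered by the projection and degrees `ℓ - 1` and `ℓ` by the local
space, so `P v` is the full `L²` projection. -/
lemma MemLocal.integral_eq_zero {P : (Plane → ℝ) → Poly} (hv : E.MemLocal ℓ P v)
    (hP : E.IsValueProjection ℓ P) {p : Poly} (hp : p.totalDegree ≤ ℓ) :
    ∫ x in E.carrier, (v x - polyFun (P v) x) * polyFun p x = 0 := by
  by_cases hd : p.totalDegree + 2 ≤ ℓ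
  · simp only [sub_mul]
    rw [integral_sub (integrable_mul hv.1.1.1 (memLp_polyFun E p))
      (integrable_mul (memLp_polyFun E _) (memLp_polyFun E p)), hP.2.2.1 v hv.1 p hd, sub_self]
  · exact hv.2 p hp hd

lemma MemLocal.integral_eq {P : (Plane → ℝ) → Poly} (hv : E.MemLocal ℓ P v)
    (hP : E.IsValueProjection ℓ P) {p : Poly} (hp : p.totalDegree ≤ ℓ) :
    ∫ x in E.carrier, polyFun (P v) x * polyFun p x = ∫ x in E.carrier, v x * polyFun p x := by
  have := hv.integral_eq_zero hP hp
  simp only [sub_mul] at this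
  rw [integral_sub (integrable_mul hv.1.1.1 (memLp_polyFun E p))
    (integrable_mul (memLp_polyFun E _) (memLp_polyFun E p))] at this
  linarith

/-- In the defining identity `P v` may be replaced by `v` and the edge projections by the traces; by
Green's formula the right side is then the pairing with the weak gradient. -/
lemma StarBall.isGradProjection_iff (h : E.StarBall c r) {P : (Plane → ℝ) → Poly}
    {Q : E.Idx → (Plane → ℝ) → Polynomial ℝ} (hP : E.IsValueProjection ℓ P)
    (hQ : ∀ i, E.IsEdgeProjection ℓ i (Q i)) (hv : E.MemLocal ℓ P v) (g : Fin 2 → Poly) :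
    E.IsGradProjection ℓ (P v) (fun i => Q i v) g ↔ (∀ j, (g j).totalDegree ≤ ℓ - 1) ∧
      ∀ p : Fin 2 → Poly, (∀ j, (p j).totalDegree ≤ ℓ - 1) →
      ∫ x in E.carrier, ∑ j, polyFun (g j) x * polyFun (p j) x =
        ∫ x in E.carrier, ∑ j, weakGrad E.carrier v x j * polyFun (p j) x := by
  refine and_congr_right fun _ => forall₂_congr fun p hp => ?_
  -- Degree at most `ℓ` is enough here, because `P v` is the projection onto that whole space.
  have hdiv : (∑ j, MvPolynomial.pderiv j (p j)).totalDegree ≤ ℓ :=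
    MvPolynomial.totalDegree_finsetSum_le fun j _ => by
      have h1 := totalDegree_pderiv_le j (p j)
      have h2 := hp j
      omega
  rw [hv.integral_eq hP hdiv]
  simp only [h.edgeProjection_eq (hQ _) hv.1]
  have e : ∫ x in E.carrier, ∑ j, weakGrad E.carrier v x j * polyFun (p j) x =
      -(∫ x in E.carrier, v x * polyFun (∑ j, MvPolynomial.pderiv j (p j)) x) +
        ∑ i, E.edgeIntegral i (fun t => (E.edgeTrace v i).eval t *
          ∑ j, polyFun (p j) (E.edgePoint i t) * E.outwardNormal i j) := by
    rw [integral_finsetSum _ fun j _ => integrable_mul (memLp_apply hv.1.1.memLp_weakGrad j)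
      (memLp_polyFun E (p j))]
    simp only [h.green_apply hv.1 (contDiff_polyFun _), gradient_polyFun, Finset.sum_add_distrib, Finset.sum_neg_distrib, polyFun_sum,
      Finset.mul_sum]
    rw [integral_finsetSum _ fun j _ => integrable_mul hv.1.1.1 (memLp_polyFun E _), Finset.sum_comm]
    congr 1
    refine Finset.sum_congr rfl fun i _ => ?_
    have hce := continuous_edgePoint i
    have hcp := fun j => continuous_polyFun (p j)
    simp only [edgeIntegral]
    rw [intervalIntegral.integral_finsetSum fun j _ => Continuous.intervalIntegrable (by fun_prop) _ _,
      Finset.mul_sum]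
  rw [e]

/-! ### The `L²` projection of vector fields -/

/-- The vector field with polynomial components. -/
def polyField (g : Fin 2 → Poly) (x : Plane) : Plane := !₂[polyFun (g 0) x, polyFun (g 1) x]

lemma polyField_apply (g : Fin 2 → Poly) (x : Plane) (j : Fin 2) :
    polyField g x j = polyFun (g j) x := by
  fin_cases j <;> simp [polyField]

lemma continuous_polyField (g : Fin 2 → Poly) : Continuous (polyField g) := by
  have h0 := continuous_polyFun (g 0)
  have h1 := continuous_polyFun (g 1)
  unfold polyField
  fun_prop

lemma memLp_polyField (E : Polygon) (g : Fin 2 → Poly) : MemLp (polyField g) 2 E.mE :=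
  memLp_of_continuous E.isBounded_carrier (continuous_polyField g)

lemma inner_polyField (x : Plane) (p : Fin 2 → Poly) (y : Plane) :
    inner ℝ x (polyField p y) = ∑ j, x j * polyFun (p j) y := by
  rw [inner_eq, Fin.sum_univ_two, polyField_apply, polyField_apply]

/-- `g` is the `L²` projection of the vector field `f` onto polynomials of degree at most `n`. -/
def IsFieldProjection (E : Polygon) (n : ℕ) (f : Plane → Plane) (g : Fin 2 → Poly) : Prop :=
  (∀ j, (g j).totalDegree ≤ n) ∧ ∀ p : Fin 2 → Poly, (∀ j, (p j).totalDegree ≤ n) →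
    ∫ x in E.carrier, inner ℝ (polyField g x) (polyField p x) =
      ∫ x in E.carrier, inner ℝ (f x) (polyField p x)

/-- The componentwise projections of the weak gradient witness existence, so the value of `gradProj`
is never its default, and the chosen field has the projection property. -/
lemma StarBall.exists_gradProj_eq (h : E.StarBall c r) {P : (Plane → ℝ) → Poly}
    {Q : E.Idx → (Plane → ℝ) → Polynomial ℝ} (hP : E.IsValueProjection ℓ P)
    (hQ : ∀ i, E.IsEdgeProjection ℓ i (Q i)) (hv : E.MemLocal ℓ P v) :
    ∃ g, E.gradProj ℓ P Q v = polyField g ∧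
      E.IsFieldProjection (ℓ - 1) (weakGrad E.carrier v) g := by
  have hg := hv.1.1.memLp_weakGrad
  have hex : ∃ g, E.IsGradProjection ℓ (P v) (fun i => Q i v) g := by
    choose q hq hqp using fun j => exists_projection E (ℓ - 1) (memLp_apply hg j)
    refine ⟨q, (h.isGradProjection_iff hP hQ hv q).2 ⟨hq, fun p hp => ?_⟩⟩
    rw [integral_finsetSum _ fun j _ => integrable_mul (memLp_polyFun E (q j)) (memLp_polyFun E (p j)),
      integral_finsetSum _ fun j _ => integrable_mul (memLp_apply hg j) (memLp_polyFun E (p j))]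
    exact Finset.sum_congr rfl fun j _ => hqp j (p j) (hp j)
  refine ⟨hex.choose, by rw [gradProj, dif_pos hex]; rfl, ?_⟩
  have := (h.isGradProjection_iff hP hQ hv _).1 hex.choose_spec
  refine ⟨this.1, fun p hp => ?_⟩
  simp only [inner_polyField, polyField_apply]
  exact this.2 p hp

namespace IsFieldProjection

variable {n : ℕ} {f f' : Plane → Plane} {g g' : Fin 2 → Poly}

lemma integral_inner_self (hg : E.IsFieldProjection n f g) :
    l2 E.mE (polyField g) ^ 2 = ∫ x in E.carrier, inner ℝ (f x) (polyField g x) := by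
  rw [l2_sq, ← hg.2 g hg.1]
  simp only [real_inner_self_eq_norm_sq]

lemma l2_le (hf : MemLp f 2 E.mE) (hg : E.IsFieldProjection n f g) :
    l2 E.mE (polyField g) ≤ l2 E.mE f := by
  have h1 := (le_abs_self _).trans (abs_integral_inner_le hf (memLp_polyField E g))
  rw [← hg.integral_inner_self, sq] at h1
  rcases (l2_nonneg (ν := E.mE) (polyField g)).eq_or_lt with h0 | h0
  · rw [← h0]; exact l2_nonneg _
  · exact le_of_mul_le_mul_right h1 h0

lemma sub (hf : MemLp f 2 E.mE) (hf' : MemLp f' 2 E.mE) (hg : E.IsFieldProjection n f g)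
    (hg' : E.IsFieldProjection n f' g') :
    E.IsFieldProjection n (fun x => f x - f' x) (fun j => g j - g' j) := by
  refine ⟨fun j => (MvPolynomial.totalDegree_sub _ _).trans (max_le (hg.1 j) (hg'.1 j)), fun p hp => ?_⟩
  have e : ∀ x, polyField (fun j => g j - g' j) x = polyField g x - polyField g' x := fun x => by
    ext j; simp only [PiLp.sub_apply, polyField_apply, polyFun_sub]
  simp only [e, inner_sub_left]
  rw [integral_sub (integrable_inner (memLp_polyField E g) (memLp_polyField E p))
    (integrable_inner (memLp_polyField E g') (memLp_polyField E p)),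
    integral_sub (integrable_inner hf (memLp_polyField E p))
    (integrable_inner hf' (memLp_polyField E p)), hg.2 p hp, hg'.2 p hp]

/-- Best approximation. -/
lemma l2_sub_le (hf : MemLp f 2 E.mE) (hg : E.IsFieldProjection n f g)
    {p : Fin 2 → Poly} (hp : ∀ j, (p j).totalDegree ≤ n) :
    l2 E.mE f ≤ l2 E.mE (polyField g) + 2 * l2 E.mE (fun x => f x - polyField p x) := by
  -- As `p` is its own projection, `p - g` is the projection of `p - f` and has at most its norm.
  -- The factor `2` comes from passing from `f` to `p` and from `p` to `g`.
  have hpp : E.IsFieldProjection n (polyField p) p := ⟨hp, fun _ _ => rfl⟩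
  have h1 : l2 E.mE _ ≤ l2 E.mE (fun x => polyField p x - f x) :=
    (hpp.sub (memLp_polyField E p) hf hg).l2_le ((memLp_polyField E p).sub hf)
  have h2 := l2_le_add_sub hf (memLp_polyField E p)
  have h3 := l2_le_add_sub (memLp_polyField E p) (memLp_polyField E g)
  have e : (fun x => polyField p x - polyField g x) = polyField (fun j => p j - g j) := by
    funext x; ext j; simp only [PiLp.sub_apply, polyField_apply, polyFun_sub]
  rw [e] at h3
  rw [VEM.l2_sub_comm] at h1
  linarith

end IsFieldProjection

end Polygon
end VEM

end

noncomputable section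

namespace VEM

/-! ### Bounds for the degrees of freedom -/

namespace Polygon

variable {E : Polygon} {c : Plane} {r : ℝ} {v w : Plane → ℝ} {ℓ : ℕ}

lemma sum_dofIdx (E : Polygon) (ℓ : ℕ) (f : E.DofIdx ℓ → ℝ) :
    ∑ d, f d = ∑ i, f (.vertexValue i) + (∑ i, ∑ k, f (.edgeMoment i k) +
      ∑ a, ∑ b, f (.interiorMoment a b)) := by
  rw [← (E.dofEquiv ℓ).sum_comp, Fintype.sum_sum_type, Fintype.sum_sum_type, Fintype.sum_prod_type,
    Fintype.sum_sigma]
  rfl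

lemma dof_edgeMoment (v : Plane → ℝ) (i : E.Idx) (k : Fin (ℓ - 1)) :
    E.dof ℓ v (.edgeMoment i k) = moment k (E.edgeTrace v i) := by
  rw [dof, edgeIntegral, inv_mul_cancel_left₀ (edgeLength_pos i).ne', moment]

/-- The scaled monomial has degree `a + b ≤ ℓ - 2`. -/
lemma dof_interiorMoment_eq_zero
    (hv : ∀ p : Poly, p.totalDegree + 2 ≤ ℓ → ∫ x in E.carrier, v x * polyFun p x = 0)
    (a : Fin (ℓ - 1)) (b : Fin (ℓ - 1 - a)) : E.dof ℓ v (.interiorMoment a b) = 0 := by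
  set X : Fin 2 → Poly := fun j => MvPolynomial.C E.diam⁻¹ * (MvPolynomial.X j - MvPolynomial.C (E.centroid j))
  have hX : ∀ j, (X j).totalDegree ≤ 1 := fun j => by
    refine (MvPolynomial.totalDegree_mul _ _).trans ?_
    rw [MvPolynomial.totalDegree_C, zero_add]
    refine (MvPolynomial.totalDegree_sub _ _).trans (max_le (MvPolynomial.totalDegree_X _).le ?_)
    rw [MvPolynomial.totalDegree_C]; exact zero_le_one
  have hd : (X 0 ^ (a : ℕ) * X 1 ^ (b : ℕ)).totalDegree + 2 ≤ ℓ := by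
    have h1 := MvPolynomial.totalDegree_mul (X 0 ^ (a : ℕ)) (X 1 ^ (b : ℕ))
    have h2 := MvPolynomial.totalDegree_pow (X 0) a
    have h3 := MvPolynomial.totalDegree_pow (X 1) b
    have h4 := Nat.mul_le_mul_left (a : ℕ) (hX 0)
    have h5 := Nat.mul_le_mul_left (b : ℕ) (hX 1)
    have := a.2
    have := b.2
    omega
  have e : ∀ x : Plane, ((x 0 - E.centroid 0) / E.diam) ^ (a : ℕ) *
      ((x 1 - E.centroid 1) / E.diam) ^ (b : ℕ) = polyFun (X 0 ^ (a : ℕ) * X 1 ^ (b : ℕ)) x := fun x => by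
    simp only [polyFun, X, map_mul, map_pow, map_sub, MvPolynomial.eval_C, MvPolynomial.eval_X,
      div_eq_inv_mul]
  simp only [dof, e, hv _ hd, mul_zero]

/-- The interior moments vanish by orthogonality, the vertex values are point evaluations of the
traces, and each of the `ℓ - 1` moments of an edge is at most the norm of the trace, since `|t - 1 /
2| ≤ 1`. -/
lemma exists_dof_bound (ℓ : ℕ) : ∃ C : ℝ, 0 < C ∧ ∀ (E : Polygon) (u : Plane → ℝ),
    (∀ i, (E.edgeTrace u i).natDegree ≤ ℓ) →
    (∀ p : Poly, p.totalDegree + 2 ≤ ℓ → ∫ x in E.carrier, u x * polyFun p x = 0) →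
    ∑ d, E.dof ℓ u d ^ 2 ≤ C * ∑ i, ∫ t in (0 : ℝ)..1, (E.edgeTrace u i).eval t ^ 2 := by
  obtain ⟨C, hC, hb⟩ := exists_sup_bound ℓ
  refine ⟨C + ((ℓ - 1 : ℕ) : ℝ), by positivity, fun E u hdeg hu => ?_⟩
  rw [sum_dofIdx]
  simp only [dof_interiorMoment_eq_zero hu, dof_edgeMoment]
  rw [Finset.sum_eq_zero (s := Finset.univ) (f := fun a : Fin (ℓ - 1) => ∑ b : Fin (ℓ - 1 - a), (0 : ℝ) ^ 2)
    (fun a _ => Finset.sum_eq_zero fun b _ => by norm_num), add_zero, add_mul, Finset.mul_sum, Finset.mul_sum]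
  refine add_le_add (Finset.sum_le_sum fun i _ => hb _ (hdeg i) 0 (by simp)) (Finset.sum_le_sum fun i _ => ?_)
  refine (Finset.sum_le_card_nsmul _ _ (∫ t in (0 : ℝ)..1, (E.edgeTrace u i).eval t ^ 2) fun k _ => ?_).trans
    (by simp)
  refine (sq_integral_le (by fun_prop)).trans (intervalIntegral.integral_mono_on zero_le_one
    (integrable_poly _ (by fun_prop)) (integrable_poly _ (by fun_prop)) fun t ht => ?_)
  rw [mul_pow]
  refine mul_le_of_le_one_right (sq_nonneg _) ?_
  rw [← pow_mul, mul_comm, pow_mul]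
  exact pow_le_one₀ (sq_nonneg _) (by nlinarith [ht.1, ht.2])

lemma memEnlarged_residual {P : (Plane → ℝ) → Poly} (hP : E.IsValueProjection ℓ P)
    (hv : E.MemEnlarged ℓ v) : E.MemEnlarged ℓ (fun x => v x - polyFun (P v) x) :=
  memEnlarged_sub hv (memEnlarged_polyFun (hP.2.1 v hv))

namespace StarBall

lemma sum_trace_le_of_memEnlarged (h : E.StarBall c r) (hv : E.MemEnlarged ℓ v) :
    ∑ i, |E.fanDet c i| * ∫ t in (0 : ℝ)..1, (E.edgeTrace v i).eval t ^ 2 ≤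
      3 * l2 E.mE v ^ 2 + E.diam ^ 2 * l2 E.mE (weakGrad E.carrier v) ^ 2 := by
  obtain ⟨φ, hφ, hφv, hφg, hφt⟩ := h.exists_approx hv
  have hφ' := fun n => memLp_of_continuous E.isBounded_carrier (hφ n).continuous
  have hφ'' := fun n => memLp_of_continuous E.isBounded_carrier (continuous_gradient (contDiff_one (hφ n)))
  have L1 := tendsto_l2 hφ' hv.1.1 hφv
  have L2 := tendsto_l2 hφ'' hv.1.memLp_weakGrad hφg
  have L3 : ∀ i, Tendsto (fun n => l2 mI (fun t => φ n (E.edgePoint i t))) atTop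
      (𝓝 (l2 mI fun t => (E.edgeTrace v i).eval t)) := fun i => by
    have hce := continuous_edgePoint i
    exact tendsto_l2 (fun n => memLp_mI (by have := (hφ n).continuous; fun_prop)) (memLp_mI (by fun_prop))
      (hφt i)
  simp only [← l2_mI_sq]
  refine le_of_tendsto_of_tendsto' (tendsto_finsetSum _ fun i _ => ((L3 i).pow 2).const_mul |E.fanDet c i|)
    (((L1.pow 2).const_mul 3).add ((L2.pow 2).const_mul (E.diam ^ 2))) fun n => ?_
  simp only [l2_mI_sq]
  exact h.sum_trace_le (contDiff_one (hφ n))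

/-- The constant depends on the approximating function; stopping at a late member of the sequence,
at the price of `ε`, avoids a limit of constants. -/
lemma poincare_memEnlarged (h : E.StarBall c r) (hv : E.MemEnlarged ℓ v) {ε : ℝ} (hε : 0 < ε) :
    ∃ a : ℝ, l2 E.mE (fun x => v x - a) ≤
      2 * E.diam ^ 2 / r * l2 E.mE (weakGrad E.carrier v) + ε := by
  obtain ⟨φ, hφ, hφv, hφg, -⟩ := h.exists_approx hv
  have hφ' := fun n => memLp_of_continuous E.isBounded_carrier (hφ n).continuous
  have hφ'' := fun n => memLp_of_continuous E.isBounded_carrier (continuous_gradient (contDiff_one (hφ n)))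
  have L := hφv.add ((tendsto_l2 hφ'' hv.1.memLp_weakGrad hφg).const_mul (2 * E.diam ^ 2 / r))
  rw [zero_add] at L
  obtain ⟨n, hn⟩ := (L.eventually (gt_mem_nhds (lt_add_of_pos_right _ hε))).exists
  obtain ⟨a, ha⟩ := h.poincare (contDiff_one (hφ n))
  refine ⟨a, le_trans ?_ hn.le⟩
  refine le_trans ?_ (add_le_add le_rfl ha)
  rw [add_comm]
  exact l2_le_of_eq_sub (f := fun x => φ n x - a) (g := fun x => φ n x - v x)
    ((hφ' n).sub (memLp_const a)) ((hφ' n).sub hv.1.1) fun x => by ring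

end StarBall

/-- Pythagoras: `v - a` is the sum of `v - P v` and `P v - a`, which are orthogonal because `P v` is
the full projection. -/
lemma l2_sub_const_le {P : (Plane → ℝ) → Poly} (hP : E.IsValueProjection ℓ P) (hv : E.MemLocal ℓ P v)
    (a : ℝ) : l2 E.mE (fun x => v x - polyFun (P v) x) ≤ l2 E.mE (fun x => v x - a) ∧
      l2 E.mE (polyFun (P v - MvPolynomial.C a)) ≤ l2 E.mE (fun x => v x - a) := by
  have hu : MemLp (fun x => v x - polyFun (P v) x) 2 E.mE := hv.1.1.1.sub (memLp_polyFun E _)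
  have hva : MemLp (fun x => v x - a) 2 E.mE := hv.1.1.1.sub (memLp_const a)
  have hq := memLp_polyFun E (P v - MvPolynomial.C a)
  have hdeg : (P v - MvPolynomial.C a).totalDegree ≤ ℓ :=
    (MvPolynomial.totalDegree_sub _ _).trans (max_le (hP.2.1 v hv.1) (by simp))
  have horth := hv.integral_eq_zero hP hdeg
  have key : ∀ f : Plane → ℝ, MemLp f 2 E.mE → l2 E.mE f ^ 2 = ∫ x in E.carrier, f x * (v x - a) →
      l2 E.mE f ≤ l2 E.mE (fun x => v x - a) := fun f hf he => by
    have h1 := (le_abs_self _).trans (abs_integral_mul_le hf hva)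
    rw [← he, sq] at h1
    rcases (l2_nonneg (ν := E.mE) f).eq_or_lt with h0 | h0
    · rw [← h0]; exact l2_nonneg _
    · exact le_of_mul_le_mul_left h1 h0
  have e : ∀ x, polyFun (P v - MvPolynomial.C a) x = polyFun (P v) x - a := fun x => by simp
  constructor
  · refine key _ hu ?_
    rw [l2_sq_real, ← add_zero (∫ x in E.carrier, (v x - polyFun (P v) x) ^ 2), ← horth,
      ← integral_add (by simpa only [sq] using integrable_mul hu hu) (integrable_mul hu hq)]
    exact integral_congr_ae (ae_of_all _ fun x => by simp only [e]; ring)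
  · refine key _ hq ?_
    rw [l2_sq_real, ← add_zero (∫ x in E.carrier, polyFun (P v - MvPolynomial.C a) x ^ 2), ← horth,
      ← integral_add (by simpa only [sq] using integrable_mul hq hq) (integrable_mul hu hq)]
    exact integral_congr_ae (ae_of_all _ fun x => by simp only [e]; ring)

/-- The projection error is at most the distance to constants, which Poincaré bounds. For the
gradient, `P v` and `P v - a` have the same one, and the inverse inequality returns the factor `h`
gained by Poincaré. -/
lemma exists_residual_bound (ℓ : ℕ) {ρ : ℝ} (hρ : 0 < ρ) : ∃ C : ℝ, 0 < C ∧
    ∀ (E : Polygon) (c : Plane), E.StarBall c (ρ * E.diam) →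
    ∀ P, E.IsValueProjection ℓ P → ∀ v, E.MemLocal ℓ P v →
      l2 E.mE (fun x => v x - polyFun (P v) x) ≤ C * E.diam * l2 E.mE (weakGrad E.carrier v) ∧
      l2 E.mE (weakGrad E.carrier (fun x => v x - polyFun (P v) x)) ≤
        C * l2 E.mE (weakGrad E.carrier v) := by
  obtain ⟨C, hC, hinv⟩ := exists_inverse_bound ℓ hρ
  refine ⟨2 / ρ + (1 + C * (2 / ρ)), by positivity, fun E c h P hP v hv => ?_⟩
  have hh := E.diam_pos
  set G := l2 E.mE (weakGrad E.carrier v) with hG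
  have hG0 : 0 ≤ G := l2_nonneg _
  have hK : 2 * E.diam ^ 2 / (ρ * E.diam) = 2 / ρ * E.diam := by field_simp
  have h1 : l2 E.mE (fun x => v x - polyFun (P v) x) ≤ 2 / ρ * E.diam * G := by
    refine le_of_forall_pos_le_add fun ε hε => ?_
    obtain ⟨a, ha⟩ := h.poincare_memEnlarged hv.1 hε
    rw [hK] at ha
    exact (l2_sub_const_le hP hv a).1.trans ha
  have h2 : l2 E.mE (gradient (polyFun (P v))) ≤ C * (2 / ρ) * G := by
    refine le_of_forall_pos_le_add fun ε hε => ?_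
    -- Scaled so that the error equals `ε` after the inverse inequality.
    obtain ⟨a, ha⟩ := h.poincare_memEnlarged hv.1 (ε := ε * E.diam / C) (by positivity)
    rw [hK] at ha
    have hdeg : (P v - MvPolynomial.C a).totalDegree ≤ ℓ :=
      (MvPolynomial.totalDegree_sub _ _).trans (max_le (hP.2.1 v hv.1) (by simp))
    have h3 := (hinv E c h _ hdeg).trans (mul_le_mul_of_nonneg_left
      ((l2_sub_const_le hP hv a).2.trans ha) (by positivity))
    have e : gradient (polyFun (P v - MvPolynomial.C a)) = gradient (polyFun (P v)) := by
      funext x; ext j; simp [gradient_polyFun]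
    rw [e] at h3
    refine h3.trans (le_of_eq ?_)
    rw [hG]
    field_simp
  constructor
  · refine h1.trans ?_
    have : 0 ≤ (1 + C * (2 / ρ)) * E.diam * G := by positivity
    nlinarith
  · have h3 : l2 E.mE (weakGrad E.carrier (fun x => v x - polyFun (P v) x)) ≤
        G + l2 E.mE (gradient (polyFun (P v))) := by
      rw [hG]
      refine le_trans (le_of_eq (l2_congr ?_)) (l2_sub_le hv.1.1.memLp_weakGrad (memLp_gradient_polyFun E (P v)))
      filter_upwards [weakGrad_sub E.isOpen_carrier hv.1.1 (E.memH1_polyFun (P v)),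
        E.weakGrad_polyFun (P v)] with x h1 h2
      rw [h1, h2]
    have : 0 ≤ 2 / ρ * G := by positivity
    nlinarith

/-- The stabilisation is bounded by the energy. -/
theorem exists_stab_le (ℓ : ℕ) {ρ : ℝ} (hρ : 0 < ρ) : ∃ C : ℝ, 0 < C ∧
    ∀ (E : Polygon) (c : Plane), E.StarBall c (ρ * E.diam) → (∀ i, ρ * E.diam ≤ E.edgeLength i) →
    ∀ P, E.IsValueProjection ℓ P → ∀ v, E.MemLocal ℓ P v →
      ∑ d, E.dof ℓ (fun x => v x - polyFun (P v) x) d ^ 2 ≤ C * l2 E.mE (weakGrad E.carrier v) ^ 2 := by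
  obtain ⟨C₁, hC₁, h₁⟩ := exists_dof_bound ℓ
  obtain ⟨C₂, hC₂, h₂⟩ := exists_residual_bound ℓ hρ
  refine ⟨C₁ * (4 * C₂ ^ 2 / ρ ^ 2), by positivity, fun E c h hedge P hP v hv => ?_⟩
  have hh := E.diam_pos
  have hu := memEnlarged_residual hP hv.1
  set u : Plane → ℝ := fun x => v x - polyFun (P v) x
  have k1 := h₁ E u (fun i => (h.hasEdgeTrace_edgeTrace hu i).2)
    fun p hp => hv.integral_eq_zero hP (by omega)
  obtain ⟨k2, k3⟩ := h₂ E c h P hP v hv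
  have k4 := h.sum_trace_le_of_memEnlarged hu
  -- The determinant is at least the ball radius times the edge length, and both are at least `ρ h`.
  have k5 : (ρ * E.diam) ^ 2 * ∑ i, ∫ t in (0 : ℝ)..1, (E.edgeTrace u i).eval t ^ 2 ≤
      ∑ i, |E.fanDet c i| * ∫ t in (0 : ℝ)..1, (E.edgeTrace u i).eval t ^ 2 := by
    rw [Finset.mul_sum]
    refine Finset.sum_le_sum fun i _ => mul_le_mul_of_nonneg_right ?_
      (intervalIntegral.integral_nonneg zero_le_one fun _ _ => sq_nonneg _)
    rw [sq]
    exact (mul_le_mul_of_nonneg_left (hedge i) (by positivity)).trans (h.r_mul_edgeLength_le i)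
  have k6 := pow_le_pow_left₀ (l2_nonneg _) k2 2
  have k7 := mul_le_mul_of_nonneg_left (pow_le_pow_left₀ (l2_nonneg _) k3 2) (sq_nonneg E.diam)
  refine k1.trans ?_
  rw [mul_assoc]
  refine mul_le_mul_of_nonneg_left ?_ hC₁.le
  have k8 : (ρ * E.diam) ^ 2 * ∑ i, ∫ t in (0 : ℝ)..1, (E.edgeTrace u i).eval t ^ 2 ≤
      4 * C₂ ^ 2 * E.diam ^ 2 * l2 E.mE (weakGrad E.carrier v) ^ 2 := by nlinarith
  rw [div_mul_eq_mul_div, le_div_iff₀ (by positivity)]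
  refine le_of_mul_le_mul_left (a := E.diam ^ 2) ?_ (by positivity)
  linarith

end Polygon
end VEM

end

noncomputable section

namespace VEM

/-! ### Approximation of functions with zero trace by test functions -/

/-- Convolution with a normalised bump function. -/
def moll (η : ContDiffBump (0 : Plane)) (g : Plane → ℝ) : Plane → ℝ :=
  convolution (η.normed volume) g (ContinuousLinearMap.lsmul ℝ ℝ) volume

/-- The homothety with center `c` and ratio `σ`. -/
def dil (c : Plane) (σ : ℝ) (x : Plane) : Plane := c + σ • (x - c)

section moll

variable {η : ContDiffBump (0 : Plane)} {g g' : Plane → ℝ} {c : Plane} {σ : ℝ}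

lemma moll_eq (η : ContDiffBump (0 : Plane)) (g : Plane → ℝ) (y : Plane) :
    moll η g y = ∫ t, η.normed volume (y - t) * g t := by
  rw [moll, convolution_eq_swap]; rfl

lemma convolutionExists_moll (hg : LocallyIntegrable g) : ConvolutionExists (η.normed volume) g
    (ContinuousLinearMap.lsmul ℝ ℝ) volume :=
  η.hasCompactSupport_normed.convolutionExists_left _ η.continuous_normed hg

lemma integrable_moll (hg : LocallyIntegrable g) (y : Plane) :
    Integrable (fun t => η.normed volume (y - t) * g t) :=
  (convolutionExists_moll hg y).integrable_swap

lemma moll_sub (hg : LocallyIntegrable g) (hg' : LocallyIntegrable g') (y : Plane) :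
    moll η (fun x => g x - g' x) y = moll η g y - moll η g' y := by
  simp only [moll_eq, mul_sub]
  exact integral_sub (integrable_moll hg y) (integrable_moll hg' y)

lemma contDiff_moll (hg : LocallyIntegrable g) : ContDiff ℝ ∞ (moll η g) :=
  η.hasCompactSupport_normed.contDiff_convolution_left (n := ⊤) _ η.contDiff_normed hg

lemma locallyIntegrable_of_memLp (hg : MemLp g 2 volume) : LocallyIntegrable g :=
  hg.locallyIntegrable (by norm_num)

lemma contDiff_dil (c : Plane) (σ : ℝ) : ContDiff ℝ ∞ (dil c σ) := by unfold dil; fun_prop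

/-- Jensen's inequality for the probability density `η(y - ·)`, by Cauchy–Schwarz for `√η` and `√η
g`. -/
lemma moll_sq_le (hg : MemLp g 2 volume) (y : Plane) : moll η g y ^ 2 ≤ moll η (fun x => g x ^ 2) y := by
  have hη0 : ∀ t, 0 ≤ η.normed volume (y - t) := fun t => η.nonneg_normed _
  have hsqi : LocallyIntegrable fun x => g x ^ 2 := hg.integrable_sq.locallyIntegrable
  have hc : Continuous fun t => η.normed volume (y - t) :=
    η.continuous_normed.comp (continuous_const.sub continuous_id)
  have h1 : Integrable (fun t => η.normed volume (y - t)) :=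
    (η.integrable_normed).comp_sub_left y
  have hA : MemLp (fun t => Real.sqrt (η.normed volume (y - t))) 2 volume := by
    refine (memLp_two_iff_integrable_sq (Real.continuous_sqrt.comp hc).aestronglyMeasurable).2 ?_
    simpa only [Function.comp_def, Real.sq_sqrt (hη0 _)] using h1
  have hB : MemLp (fun t => Real.sqrt (η.normed volume (y - t)) * g t) 2 volume := by
    rw [memLp_two_iff_integrable_sq (by
      exact (Real.continuous_sqrt.comp hc).aestronglyMeasurable.mul hg.aestronglyMeasurable)]
    simpa only [mul_pow, Real.sq_sqrt (hη0 _)] using integrable_moll hsqi y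
  have hCS := abs_integral_mul_le hA hB
  have e : ∀ t, Real.sqrt (η.normed volume (y - t)) * (Real.sqrt (η.normed volume (y - t)) * g t) =
      η.normed volume (y - t) * g t := fun t => by rw [← mul_assoc, Real.mul_self_sqrt (hη0 t)]
  simp only [e] at hCS
  have h2 : l2 volume (fun t => Real.sqrt (η.normed volume (y - t))) = 1 := by
    rw [← Real.sqrt_sq (l2_nonneg _), l2_sq_real]
    simp only [Real.sq_sqrt (hη0 _)]
    rw [integral_sub_left_eq_self (fun t => η.normed volume t), η.integral_normed, Real.sqrt_one]
  rw [h2, one_mul, ← moll_eq] at hCS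
  calc moll η g y ^ 2 = |moll η g y| ^ 2 := (sq_abs _).symm
    _ ≤ l2 volume (fun t => Real.sqrt (η.normed volume (y - t)) * g t) ^ 2 := by gcongr
    _ = _ := by
      rw [l2_sq_real, moll_eq]
      simp only [mul_pow, Real.sq_sqrt (hη0 _)]

lemma integrable_comp_dil (hσ : σ ≠ 0) (hg : Integrable g) : Integrable (fun x => g (dil c σ x)) := by
  have h1 := (hg.comp_add_left c).comp_smul hσ
  exact h1.comp_sub_right c

lemma integral_comp_dil (c : Plane) (σ : ℝ) (g : Plane → ℝ) :
    ∫ x, g (dil c σ x) = (σ ^ 2)⁻¹ * ∫ x, g x := by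
  rw [show (fun x => g (dil c σ x)) = fun x => (fun y => g (c + σ • y)) (x - c) from rfl,
    integral_sub_right_eq_self (fun y => g (c + σ • y)),
    Measure.integral_comp_smul volume (fun y => g (c + y)), integral_add_left_eq_self]
  simp

/-- Mollification contracts `L²`, and the dilation contributes `σ⁻² ≤ 1`. -/
lemma moll_dil_bound (hσ : 1 ≤ σ) (hg : MemLp g 2 volume) :
    MemLp (fun x => moll η g (dil c σ x)) 2 volume ∧
      l2 volume (fun x => moll η g (dil c σ x)) ≤ l2 volume g := by
  have hσ0 : 0 < σ := by linarith
  have hsq : Integrable fun x => g x ^ 2 := hg.integrable_sq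
  have hI : Integrable (moll η fun x => g x ^ 2) :=
    η.integrable_normed.integrable_convolution _ hsq
  have hI' := integrable_comp_dil (c := c) hσ0.ne' hI
  have hc : Continuous fun x => moll η g (dil c σ x) :=
    (contDiff_moll (locallyIntegrable_of_memLp hg)).continuous.comp (contDiff_dil c σ).continuous
  have hle : ∀ x, moll η g (dil c σ x) ^ 2 ≤ moll η (fun x => g x ^ 2) (dil c σ x) := fun x => moll_sq_le hg _
  have hi : Integrable fun x => moll η g (dil c σ x) ^ 2 :=
    hI'.mono' (hc.pow 2).aestronglyMeasurable (ae_of_all _ fun x => by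
      rw [Real.norm_eq_abs, abs_of_nonneg (sq_nonneg _)]; exact hle x)
  refine ⟨(memLp_two_iff_integrable_sq hc.aestronglyMeasurable).2 hi, ?_⟩
  refine abs_le_of_sq_le_sq' ?_ (l2_nonneg _) |>.2
  rw [l2_sq_real, l2_sq_real]
  refine (integral_mono hi hI' hle).trans ?_
  rw [integral_comp_dil]
  have e : ∫ x, moll η (fun x => g x ^ 2) x = ∫ x, g x ^ 2 := by
    rw [moll, integral_convolution _ η.integrable_normed hsq, η.integral_normed]
    simp
  rw [e]
  refine mul_le_of_le_one_left (integral_nonneg fun _ => sq_nonneg _) (inv_le_one_of_one_le₀ ?_)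
  nlinarith

lemma tendsto_moll_dil_of_continuous {U : Set Plane} (hU : Bornology.IsBounded U)
    (hUm : MeasurableSet U)
    {η : ℕ → ContDiffBump (0 : Plane)} (hη : Tendsto (fun n => (η n).rOut) atTop (𝓝 0))
    {σ : ℕ → ℝ} (hσ : Tendsto σ atTop (𝓝 1)) (hg : Continuous g) (hgs : HasCompactSupport g) :
    Tendsto (fun n => l2 (volume.restrict U) (fun x => moll (η n) g (dil c (σ n) x) - g x)) atTop (𝓝 0) := by
  obtain ⟨R, hR⟩ := (Metric.isBounded_iff_subset_closedBall c).1 hU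
  have hfin : IsFiniteMeasure (volume.restrict U) := ⟨by
    rw [Measure.restrict_apply_univ]; exact hU.measure_lt_top⟩
  set V := Real.sqrt ((volume.restrict U).real univ)
  have hV : (volume.restrict U).real univ ≤ V ^ 2 := (Real.sq_sqrt measureReal_nonneg).ge
  have huc := hgs.uniformContinuous_of_continuous hg
  rw [Metric.tendsto_atTop]
  intro ε hε
  obtain ⟨δ, hδ, hδg⟩ := Metric.uniformContinuous_iff.1 huc (ε / (2 * (V + 1)))
    (by have : 0 ≤ V := Real.sqrt_nonneg _; positivity)
  have hlim : Tendsto (fun n => (η n).rOut + |σ n - 1| * |R|) atTop (𝓝 0) := by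
    have := hη.add (((hσ.sub_const 1).abs).mul_const |R|)
    simpa using this
  obtain ⟨N, hN⟩ := eventually_atTop.1 (hlim.eventually (gt_mem_nhds hδ))
  refine ⟨N, fun n hn => ?_⟩
  have hV0 : 0 ≤ V := Real.sqrt_nonneg _
  set κ := ε / (2 * (V + 1)) with hκ
  have hκ0 : 0 ≤ κ := by positivity
  have hn' := hN n hn
  have hb : ∀ x ∈ U, ‖moll (η n) g (dil c (σ n) x) - g x‖ ≤ 2 * κ := by
    intro x hx
    have hxy : dist (dil c (σ n) x) x ≤ |σ n - 1| * |R| := by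
      rw [dist_eq_norm, show dil c (σ n) x - x = (σ n - 1) • (x - c) by simp only [dil]; module,
        norm_smul, Real.norm_eq_abs]
      exact mul_le_mul_of_nonneg_left (((mem_closedBall_iff_norm).1 (hR hx)).trans (le_abs_self R))
        (abs_nonneg _)
    have h1 : dist (moll (η n) g (dil c (σ n) x)) (g (dil c (σ n) x)) ≤ κ :=
      ContDiffBump.dist_normed_convolution_le hg.aestronglyMeasurable fun z hz => (hδg (lt_of_lt_of_le
        (Metric.mem_ball.1 hz) (by
          have : 0 ≤ |σ n - 1| * |R| := by positivity
          linarith))).le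
    have h2 : dist (g (dil c (σ n) x)) (g x) ≤ κ := (hδg (lt_of_le_of_lt hxy (by
      have := (η n).rOut_pos
      linarith))).le
    rw [← dist_eq_norm]
    linarith [dist_triangle (moll (η n) g (dil c (σ n) x)) (g (dil c (σ n) x)) (g x)]
  rw [Real.dist_eq, sub_zero, abs_of_nonneg (l2_nonneg _)]
  refine (l2_le_of_bound (by positivity) (ae_restrict_of_forall_mem hUm hb) hV hV0).trans_lt ?_
  rw [hκ]
  have : 2 * (ε / (2 * (V + 1))) * V = ε * (V / (V + 1)) := by field_simp
  rw [this]
  exact mul_lt_of_lt_one_right hε ((div_lt_one (by positivity)).2 (by linarith))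

/-- For continuous functions of compact support the convergence is uniform on `U`; density and the
contraction property extend it to `L²`. -/
lemma tendsto_moll_dil {U : Set Plane} (hU : Bornology.IsBounded U) (hUm : MeasurableSet U)
    {η : ℕ → ContDiffBump (0 : Plane)} (hη : Tendsto (fun n => (η n).rOut) atTop (𝓝 0))
    {σ : ℕ → ℝ} (hσ1 : ∀ n, 1 ≤ σ n) (hσ : Tendsto σ atTop (𝓝 1)) (hg : MemLp g 2 volume) :
    Tendsto (fun n => l2 (volume.restrict U) (fun x => moll (η n) g (dil c (σ n) x) - g x)) atTop (𝓝 0) := by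
  rw [Metric.tendsto_atTop]
  intro ε hε
  obtain ⟨f, hfs, hfg, hfc, hfm⟩ := MemLp.exists_hasCompactSupport_integral_rpow_sub_le (p := 2) (by norm_num)
    (by simpa using hg) (ε := (ε / 4) ^ 2) (by positivity)
  rw [ENNReal.ofReal_ofNat] at hfm
  simp only [Real.rpow_ofNat] at hfg
  have hfg' : l2 volume (fun x => g x - f x) ≤ ε / 4 := by
    rw [l2]; exact (Real.sqrt_le_left (by positivity)).2 hfg
  obtain ⟨N, hN⟩ := Metric.tendsto_atTop.1 (tendsto_moll_dil_of_continuous (c := c) hU hUm hη hσ hfc hfs) (ε / 2)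
    (by positivity)
  refine ⟨N, fun n hn => ?_⟩
  have hn' := hN n hn
  rw [Real.dist_eq, sub_zero, abs_of_nonneg (l2_nonneg _)] at hn' ⊢
  obtain ⟨m1, b1⟩ := moll_dil_bound (η := η n) (c := c) (hσ1 n) (hg.sub hfm)
  have m2 := (moll_dil_bound (η := η n) (c := c) (hσ1 n) hfm).1
  have hle : volume.restrict U ≤ volume := Measure.restrict_le_self
  have hmono : ∀ {k : Plane → ℝ}, MemLp k 2 volume → l2 (volume.restrict U) k ≤ l2 volume k := fun hk =>
    Real.sqrt_le_sqrt (integral_mono_measure hle (ae_of_all _ fun _ => sq_nonneg _) (integrable_norm_sq hk))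
  have k1 := l2_add_le (ν := volume.restrict U) (m1.mono_measure hle) ((m2.sub hfm).mono_measure hle)
  have k2 := l2_sub_le (((m1.add (m2.sub hfm))).mono_measure hle) ((hg.sub hfm).mono_measure hle)
  have e : ∀ x, moll (η n) g (dil c (σ n) x) - g x =
      moll (η n) (g - f) (dil c (σ n) x) + (moll (η n) f (dil c (σ n) x) - f x) - (g x - f x) := fun x => by
    rw [show g - f = fun x => g x - f x from rfl,
      moll_sub (locallyIntegrable_of_memLp hg) (locallyIntegrable_of_memLp hfm)]
    ring
  simp only [e]
  have k3 := (hmono m1).trans b1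
  have k4 := hmono (hg.sub hfm)
  have k5 : l2 volume (g - f) ≤ ε / 4 := hfg'
  have k6 : l2 (volume.restrict U) (fun x => (moll (η n) (g - f) (dil c (σ n) x) +
      (moll (η n) f (dil c (σ n) x) - f x)) - (g x - f x)) ≤
      l2 (volume.restrict U) (fun x => moll (η n) (g - f) (dil c (σ n) x) +
      (moll (η n) f (dil c (σ n) x) - f x)) + l2 (volume.restrict U) (g - f) := k2
  have k7 : l2 (volume.restrict U) (fun x => moll (η n) (g - f) (dil c (σ n) x) +
      (moll (η n) f (dil c (σ n) x) - f x)) ≤ l2 (volume.restrict U) (fun x => moll (η n) (g - f) (dil c (σ n) x)) +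
      l2 (volume.restrict U) (fun x => moll (η n) f (dil c (σ n) x) - f x) := k1
  linarith

end moll

namespace Polygon

variable {E : Polygon} {c : Plane} {r : ℝ} {ℓ : ℕ}

/-- The pair of a function and its gradient satisfies Green's formula without boundary terms. -/
structure ZeroTrace (E : Polygon) (f : Plane → ℝ) (F : Plane → Plane) : Prop where
  memLp : MemLp f 2 E.mE
  memLp_grad : MemLp F 2 E.mE
  green : ∀ ψ : Plane → ℝ, ContDiff ℝ ∞ ψ → ∀ j,
    ∫ x in E.carrier, f x * gradient ψ x j = -∫ x in E.carrier, ψ x * F x j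

lemma memLp_indicator (E : Polygon) {f : Plane → ℝ} (hf : MemLp f 2 E.mE) :
    MemLp (E.carrier.indicator f) 2 volume := (memLp_indicator_iff_restrict E.measurableSet_carrier).2 hf

lemma moll_indicator (E : Polygon) (η : ContDiffBump (0 : Plane)) (f : Plane → ℝ) (y : Plane) :
    moll η (E.carrier.indicator f) y = ∫ t in E.carrier, η.normed volume (y - t) * f t := by
  rw [moll_eq, ← integral_indicator E.measurableSet_carrier]
  refine integral_congr_ae (ae_of_all _ fun t => ?_)
  by_cases ht : t ∈ E.carrier <;> simp [ht]

/-- The extension by zero has the extended `F` as its weak gradient on the whole plane. The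
derivative falls on the kernel, and Green's formula without boundary terms moves it to `f`. -/
lemma ZeroTrace.gradient_moll {f : Plane → ℝ} {F : Plane → Plane} (hz : E.ZeroTrace f F)
    (η : ContDiffBump (0 : Plane)) (y : Plane) (j : Fin 2) :
    gradient (moll η (E.carrier.indicator f)) y j = moll η (E.carrier.indicator fun x => F x j) y := by
  have hloc := locallyIntegrable_of_memLp (E.memLp_indicator hz.memLp)
  have hη : ContDiff ℝ 1 (η.normed volume) := η.contDiff_normed (n := 1)
  have hd := η.hasCompactSupport_normed.hasFDerivAt_convolution_left (ContinuousLinearMap.lsmul ℝ ℝ)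
    hη hloc y
  have hex := η.hasCompactSupport_normed.fderiv (𝕜 := ℝ) |>.convolutionExists_left
    (ContinuousLinearMap.precompL Plane (ContinuousLinearMap.lsmul ℝ ℝ)) (hη.continuous_fderiv (by norm_num))
    hloc (μ := volume)
  have h1 : gradient (moll η (E.carrier.indicator f)) y j =
      ∫ t, fderiv ℝ (η.normed volume) (y - t) (bv j) * E.carrier.indicator f t := by
    rw [gradient_apply, moll, hd.fderiv, convolution_eq_swap,
      ContinuousLinearMap.integral_apply (hex y).integrable_swap]
    refine integral_congr_ae (ae_of_all _ fun t => ?_)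
    simp [ContinuousLinearMap.precompL_apply]
  have hψ : ContDiff ℝ ∞ fun t => η.normed volume (y - t) :=
    (η.contDiff_normed (n := ⊤)).comp (contDiff_const.sub contDiff_id)
  have h2 := hz.green _ hψ j
  have h3 : ∀ t, gradient (fun t => η.normed volume (y - t)) t j =
      -fderiv ℝ (η.normed volume) (y - t) (bv j) := fun t => by
    have hd' := ((hη.differentiable (by norm_num)) (y - t)).hasFDerivAt.comp t
      ((hasFDerivAt_id t).const_sub y)
    rw [gradient_apply, show fderiv ℝ (fun t => η.normed volume (y - t)) t = _ from hd'.fderiv]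
    simp
  rw [moll_indicator, h1, ← neg_eq_iff_eq_neg.2 h2, ← integral_neg,
    ← integral_indicator E.measurableSet_carrier]
  refine integral_congr_ae (ae_of_all _ fun t => ?_)
  by_cases ht : t ∈ E.carrier
  · simp only [ht, indicator_of_mem, h3]; ring
  · simp [ht]

namespace StarBall

/-- With `N = n + 1` and `y` the dilated point, `x` is the combination of `z` and `c + N (y - z)`
with weights `N / (N + 1)` and `1 / (N + 1)`. The allowed distance `r / (N + 1)` keeps the second
point in the ball. -/
lemma subset_of_dil (h : E.StarBall c r) {n : ℕ} {x z : Plane} (hz : z ∈ closure E.carrier)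
    (hx : dist (dil c (1 + 1 / ((n : ℝ) + 1)) x) z ≤ r / ((n : ℝ) + 2)) : x ∈ E.carrier := by
  set N : ℝ := (n : ℝ) + 1 with hN
  have hN0 : 0 < N := by positivity
  set y := dil c (1 + 1 / N) x with hy
  have e2 : (n : ℝ) + 2 = N + 1 := by rw [hN]; ring
  rw [e2] at hx
  have hmem : c + N • (y - z) ∈ Metric.ball c r := by
    rw [Metric.mem_ball, dist_eq_norm, add_sub_cancel_left, norm_smul, Real.norm_eq_abs, abs_of_pos hN0,
      ← dist_eq_norm]
    refine (mul_le_mul_of_nonneg_left hx hN0.le).trans_lt ?_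
    rw [mul_div_assoc', div_lt_iff₀ (by positivity)]
    nlinarith [h.pos]
  have := h.add_smul_mem hmem hz (s := N / (N + 1)) (by positivity)
    ((div_lt_one (by positivity)).2 (by linarith))
  convert this using 1
  have hx' : x = c + (N / (N + 1)) • (y - c) := by
    have : (N / (N + 1)) * (1 + 1 / N) = 1 := by field_simp
    rw [hy, dil, add_sub_cancel_left, smul_smul, this, one_smul]; module
  have h3 : (N / (N + 1)) * N + N / (N + 1) = N := by field_simp
  rw [hx']
  linear_combination (norm := module) h3 • (y - z)

/-- Composition with an expansion shrinks the support towards `c`. By `subset_of_dil` the room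
gained exceeds the mollification radius, so the support stays in the open polygon. -/
lemma isTestFunction_moll (h : E.StarBall c r) {f : Plane → ℝ} (hf : MemLp f 2 E.mE) {n : ℕ}
    {η : ContDiffBump (0 : Plane)} (hη : η.rOut = r / ((n : ℝ) + 2)) :
    IsTestFunction E.carrier
      (fun x => moll η (E.carrier.indicator f) (dil c (1 + 1 / ((n : ℝ) + 1)) x)) := by
  set A := dil c (1 + 1 / ((n : ℝ) + 1))
  have hr := h.pos
  have hε : 0 ≤ r / ((n : ℝ) + 2) := by positivity
  set K := A ⁻¹' Metric.cthickening (r / ((n : ℝ) + 2)) (closure E.carrier)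
  have hKE : K ⊆ E.carrier := fun x hx => by
    rw [mem_preimage, E.isCompact_closure.cthickening_eq_biUnion_closedBall hε] at hx
    obtain ⟨z, hz, hxz⟩ := mem_iUnion₂.1 hx
    exact h.subset_of_dil hz hxz
  have hKc : IsClosed K := Metric.isClosed_cthickening.preimage (contDiff_dil _ _).continuous
  have hsupp : tsupport (fun x => moll η (E.carrier.indicator f) (A x)) ⊆ K := by
    refine closure_minimal (fun x hx => ?_) hKc
    by_contra hxK
    refine hx ?_
    change moll η (E.carrier.indicator f) (A x) = 0
    rw [moll_indicator]
    refine setIntegral_eq_zero_of_forall_eq_zero fun t ht => ?_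
    have : η.normed volume (A x - t) = 0 := by
      by_contra hne
      have hm : A x - t ∈ Metric.ball (0 : Plane) η.rOut :=
        η.support_normed_eq (μ := volume) ▸ Function.mem_support.2 hne
      have hm' : dist (A x) t ≤ r / ((n : ℝ) + 2) := by
        rw [dist_eq_norm, ← hη]
        exact (mem_ball_zero_iff.1 hm).le
      exact hxK (mem_preimage.2 (Metric.mem_cthickening_of_dist_le _ _ _ _ (subset_closure ht) hm'))
    rw [this, zero_mul]
  refine ⟨(contDiff_moll (locallyIntegrable_of_memLp (E.memLp_indicator hf))).comp (contDiff_dil _ _),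
    ?_, hsupp.trans hKE⟩
  exact HasCompactSupport.of_support_subset_isCompact E.isCompact_closure
    ((subset_tsupport _).trans ((hsupp.trans hKE).trans subset_closure))

/-- Functions with zero trace are admissible test functions. -/
theorem integral_inner_eq_of_zeroTrace (h : E.StarBall c r) {f : Plane → ℝ} {F G : Plane → Plane}
    (hz : E.ZeroTrace f F) (hG : MemLp G 2 E.mE) {q : Poly}
    (hq : ∀ φ : Plane → ℝ, IsTestFunction E.carrier φ →
      ∫ x in E.carrier, inner ℝ (G x) (gradient φ x) = -∫ x in E.carrier, polyFun q x * φ x) :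
    ∫ x in E.carrier, inner ℝ (G x) (F x) = -∫ x in E.carrier, polyFun q x * f x := by
  have hr := h.pos
  set σ : ℕ → ℝ := fun n => 1 + 1 / ((n : ℝ) + 1)
  have hσ1 : ∀ n, 1 ≤ σ n := fun n => le_add_of_nonneg_right (by positivity)
  have hσ : Tendsto σ atTop (𝓝 1) := by
    simpa [σ] using tendsto_one_div_add_atTop_nhds_zero_nat.const_add (1 : ℝ)
  set η : ℕ → ContDiffBump (0 : Plane) := fun n =>
    ⟨r / ((n : ℝ) + 2) / 2, r / ((n : ℝ) + 2), by positivity, half_lt_self (by positivity)⟩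
  have hη : Tendsto (fun n => (η n).rOut) atTop (𝓝 0) :=
    (tendsto_natCast_atTop_atTop.atTop_add tendsto_const_nhds).const_div_atTop r
  have htest := fun n => h.isTestFunction_moll (n := n) hz.memLp (η := η n) rfl
  have hlim : ∀ {g : Plane → ℝ}, MemLp g 2 E.mE → Tendsto (fun n => l2 E.mE
      (fun x => moll (η n) (E.carrier.indicator g) (dil c (σ n) x) - g x)) atTop (𝓝 0) := fun {g} hg => by
    refine (tendsto_moll_dil (c := c) E.isBounded_carrier E.measurableSet_carrier hη hσ1 hσ
      (E.memLp_indicator hg)).congr fun n => l2_congr ?_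
    filter_upwards [ae_restrict_mem E.measurableSet_carrier] with x hx
    rw [indicator_of_mem hx]
  have hmem : ∀ {g : Plane → ℝ}, MemLp g 2 E.mE → ∀ n,
      MemLp (fun x => moll (η n) (E.carrier.indicator g) (dil c (σ n) x)) 2 E.mE := fun hg n =>
    (moll_dil_bound (hσ1 n) (E.memLp_indicator hg)).1.mono_measure Measure.restrict_le_self
  -- The chain rule produces a factor `σ n`, which tends to `1`.
  have hgrad : ∀ n x j, gradient (fun x => moll (η n) (E.carrier.indicator f) (dil c (σ n) x)) x j =
      σ n * moll (η n) (E.carrier.indicator fun x => F x j) (dil c (σ n) x) := fun n x j => by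
    have hd := ((contDiff_one (contDiff_moll (η := η n) (locallyIntegrable_of_memLp
      (E.memLp_indicator hz.memLp)))).differentiable (by norm_num)) (dil c (σ n) x)
    have hA : HasFDerivAt (dil c (σ n)) (σ n • ContinuousLinearMap.id ℝ Plane) x :=
      (((hasFDerivAt_id x).sub_const c).const_smul (σ n)).const_add c
    have hcomp := hd.hasFDerivAt.comp x hA
    rw [gradient_apply, show fderiv ℝ (fun x => moll (η n) (E.carrier.indicator f) (dil c (σ n) x)) x = _
      from hcomp.fderiv, ← hz.gradient_moll, gradient_apply]
    simp
  have key : ∀ n, ∫ x in E.carrier, inner ℝ (G x)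
      (gradient (fun x => moll (η n) (E.carrier.indicator f) (dil c (σ n) x)) x) =
      -∫ x in E.carrier, polyFun q x * moll (η n) (E.carrier.indicator f) (dil c (σ n) x) :=
    fun n => hq _ (htest n)
  have L1 : Tendsto (fun n => ∫ x in E.carrier, polyFun q x *
      moll (η n) (E.carrier.indicator f) (dil c (σ n) x)) atTop (𝓝 (∫ x in E.carrier, polyFun q x * f x)) := by
    simp only [mul_comm (polyFun q _)]
    exact tendsto_integral_mul (hmem hz.memLp) hz.memLp (memLp_polyFun E q) (hlim hz.memLp)
  have L2 : Tendsto (fun n => σ n * ∑ j, ∫ x in E.carrier,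
      moll (η n) (E.carrier.indicator fun x => F x j) (dil c (σ n) x) * G x j) atTop
      (𝓝 (1 * ∑ j, ∫ x in E.carrier, F x j * G x j)) :=
    hσ.mul (tendsto_finsetSum _ fun j _ => tendsto_integral_mul (hmem (memLp_apply hz.memLp_grad j))
      (memLp_apply hz.memLp_grad j) (memLp_apply hG j) (hlim (memLp_apply hz.memLp_grad j)))
  have e1 : ∀ n, σ n * ∑ j, ∫ x in E.carrier,
      moll (η n) (E.carrier.indicator fun x => F x j) (dil c (σ n) x) * G x j =
      -∫ x in E.carrier, polyFun q x * moll (η n) (E.carrier.indicator f) (dil c (σ n) x) := fun n => by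
    rw [← key n, ← integral_finsetSum _ fun j _ => integrable_mul (hmem (memLp_apply hz.memLp_grad j) n)
      (memLp_apply hG j), ← integral_const_mul]
    refine integral_congr_ae (ae_of_all _ fun x => ?_)
    simp only [inner_eq, Fin.sum_univ_two, hgrad]
    ring
  simp only [e1, one_mul] at L2
  have := tendsto_nhds_unique L2 L1.neg
  rw [← this, ← integral_finsetSum _ fun j _ => integrable_mul (memLp_apply hz.memLp_grad j)
    (memLp_apply hG j)]
  refine integral_congr_ae (ae_of_all _ fun x => ?_)
  simp only [inner_eq, Fin.sum_univ_two]
  ring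

end StarBall
end Polygon

end VEM

end

noncomputable section

namespace VEM

/-! ### Piecewise polynomial liftings of the traces -/

/-- The continuous linear form `cr a`. -/
def crL (a : Plane) : Plane →L[ℝ] ℝ :=
  LinearMap.toContinuousLinearMap
    { toFun := cr a
      map_add' := cr_add_right a
      map_smul' := fun s x => by rw [cr_smul_right]; rfl }

lemma crL_apply (a x : Plane) : crL a x = cr a x := rfl

lemma norm_crL_le (a : Plane) : ‖crL a‖ ≤ ‖a‖ :=
  ContinuousLinearMap.opNorm_le_bound _ (norm_nonneg _) fun x => abs_cr_le a x

lemma norm_fderiv_pow_mul_pow_le {f g : Plane → ℝ} {f' g' : Plane →L[ℝ] ℝ} {x : Plane} {K : ℝ}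
    (hf : HasFDerivAt f f' x) (hg : HasFDerivAt g g' x) (hfx : |f x| ≤ 1) (hgx : |g x| ≤ 1)
    (hf' : ‖f'‖ ≤ K) (hg' : ‖g'‖ ≤ K) (a : ℝ) (k m : ℕ) :
    ‖fderiv ℝ (fun y => a * (f y ^ k * g y ^ m)) x‖ ≤ |a| * (((k + m : ℕ) : ℝ) * K) := by
  have hK : 0 ≤ K := (norm_nonneg _).trans hf'
  have hd := ((hf.pow k).mul (hg.pow m)).const_mul a
  rw [show fderiv ℝ (fun y => a * (f y ^ k * g y ^ m)) x = _ from hd.fderiv, norm_smul, Real.norm_eq_abs]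
  refine mul_le_mul_of_nonneg_left ((norm_add_le _ _).trans ?_) (abs_nonneg a)
  have h1 : ∀ n : ℕ, |f x| ^ n ≤ 1 := fun n => pow_le_one₀ (abs_nonneg _) hfx
  have h2 : ∀ n : ℕ, |g x| ^ n ≤ 1 := fun n => pow_le_one₀ (abs_nonneg _) hgx
  have e1 : ‖f x ^ k • (m • g x ^ (m - 1)) • g'‖ ≤ m * K := by
    rw [norm_smul, norm_smul, Real.norm_eq_abs, Real.norm_eq_abs, nsmul_eq_mul, abs_mul, abs_pow, abs_pow,
      Nat.abs_cast]
    calc |f x| ^ k * (m * |g x| ^ (m - 1) * ‖g'‖) ≤ 1 * (m * 1 * K) := by gcongr <;> simp [h1, h2]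
      _ = m * K := by ring
  have e2 : ‖g x ^ m • (k • f x ^ (k - 1)) • f'‖ ≤ k * K := by
    rw [norm_smul, norm_smul, Real.norm_eq_abs, Real.norm_eq_abs, nsmul_eq_mul, abs_mul, abs_pow, abs_pow,
      Nat.abs_cast]
    calc |g x| ^ m * (k * |f x| ^ (k - 1) * ‖f'‖) ≤ 1 * (k * 1 * K) := by gcongr <;> simp [h1, h2]
      _ = k * K := by ring
  refine (add_le_add e1 e2).trans (le_of_eq ?_)
  push_cast; ring

namespace Polygon

variable {E : Polygon} {c : Plane} {r : ℝ} {u : Plane → ℝ} {ℓ : ℕ}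

/-- The barycentric coordinate on a fan triangle belonging to the second vertex of the edge. -/
def bary (E : Polygon) (c : Plane) (i : E.Idx) (x : Plane) : ℝ :=
  (E.fanDet c i)⁻¹ * crL (E.vertex i - c) (x - c)

/-- The sum of the two barycentric coordinates on a fan triangle belonging to the edge. -/
def radial (E : Polygon) (c : Plane) (i : E.Idx) (x : Plane) : ℝ :=
  -(E.fanDet c i)⁻¹ * crL (E.vertex (i + 1) - E.vertex i) (x - c)

/-- A homogeneous polynomial with given restriction to an edge. -/
def lift (E : Polygon) (c : Plane) (ℓ : ℕ) (i : E.Idx) (g : Polynomial ℝ) (x : Plane) : ℝ :=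
  ∑ k ∈ Finset.range (ℓ + 1), g.coeff k * (E.bary c i x ^ k * E.radial c i x ^ (ℓ - k))

lemma contDiff_bary (c : Plane) (i : E.Idx) : ContDiff ℝ ∞ (E.bary c i) := by unfold bary; fun_prop

lemma contDiff_radial (c : Plane) (i : E.Idx) : ContDiff ℝ ∞ (E.radial c i) := by unfold radial; fun_prop

lemma contDiff_lift (c : Plane) (i : E.Idx) (g : Polynomial ℝ) : ContDiff ℝ ∞ (E.lift c ℓ i g) := by
  have := contDiff_bary c i
  have := contDiff_radial c i
  unfold lift
  fun_prop

namespace StarBall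

lemma bary_eq (h : E.StarBall c r) (i : E.Idx) (s t : ℝ) :
    E.bary c i (c + s • (E.edgePoint i t - c)) = s * t := by
  have hD := h.fanDet_ne_zero i
  have e : cr (E.vertex i - c) (s • (E.edgePoint i t - c)) = s * t * E.fanDet c i := by
    rw [edgePoint_eq]
    simp only [cr, fanDet, PiLp.smul_apply, PiLp.sub_apply, PiLp.add_apply, smul_eq_mul]; ring
  rw [bary, add_sub_cancel_left, crL_apply, e]
  field_simp

lemma radial_eq (h : E.StarBall c r) (i : E.Idx) (s t : ℝ) :
    E.radial c i (c + s • (E.edgePoint i t - c)) = s := by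
  have hD := h.fanDet_ne_zero i
  have e : cr (E.vertex (i + 1) - E.vertex i) (s • (E.edgePoint i t - c)) = -s * E.fanDet c i := by
    rw [edgePoint_eq]
    simp only [cr, fanDet, PiLp.smul_apply, PiLp.sub_apply, PiLp.add_apply, smul_eq_mul]; ring
  rw [radial, add_sub_cancel_left, crL_apply, e]
  field_simp

/-- In collapsed coordinates the barycentric coordinate is `s t` and the radial one is `s`, so
homogenisation in degree `ℓ` produces `s ^ ℓ`. On a radial side the lifting depends only on the
value at the vertex, which is why neighbours match. -/
lemma lift_eq (h : E.StarBall c r) (i : E.Idx) {g : Polynomial ℝ} (hg : g.natDegree ≤ ℓ) (s t : ℝ) :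
    E.lift c ℓ i g (c + s • (E.edgePoint i t - c)) = s ^ ℓ * g.eval t := by
  rw [lift, Polynomial.eval_eq_sum_range' (Nat.lt_succ_of_le hg), Finset.mul_sum]
  refine Finset.sum_congr rfl fun k hk => ?_
  rw [h.bary_eq, h.radial_eq, mul_pow, ← Nat.add_sub_of_le (Nat.lt_succ_iff.1 (Finset.mem_range.1 hk)),
    Nat.add_sub_cancel_left, pow_add]
  ring

lemma lift_edgePoint (h : E.StarBall c r) (i : E.Idx) {g : Polynomial ℝ} (hg : g.natDegree ≤ ℓ) (t : ℝ) :
    E.lift c ℓ i g (E.edgePoint i t) = g.eval t := by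
  simpa using h.lift_eq i hg 1 t

lemma lift_match (h : E.StarBall c r) {g : E.Idx → Polynomial ℝ} (hg : ∀ i, (g i).natDegree ≤ ℓ)
    (i : E.Idx) (hm : (g i).eval 1 = (g (i + 1)).eval 0) (s : ℝ) :
    E.lift c ℓ i (g i) (c + s • (E.vertex (i + 1) - c)) =
      E.lift c ℓ (i + 1) (g (i + 1)) (c + s • (E.vertex (i + 1) - c)) := by
  have h1 := h.lift_eq i (hg i) s 1
  have h2 := h.lift_eq (i + 1) (hg (i + 1)) s 0
  rw [edgePoint_one] at h1
  rw [edgePoint_zero] at h2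
  rw [h1, h2, hm]

/-- On the triangle both coordinates lie in the unit interval and have gradients of norm at most
`K`; each term has total degree `ℓ`. -/
lemma lift_bound (h : E.StarBall c r) {K : ℝ} (i : E.Idx) (hK1 : ‖E.vertex i - c‖ ≤ K * |E.fanDet c i|)
    (hK2 : ‖E.vertex (i + 1) - E.vertex i‖ ≤ K * |E.fanDet c i|) (g : Polynomial ℝ) {x : Plane}
    (hx : x ∈ E.fanTri c i) :
    ‖E.lift c ℓ i g x‖ ≤ ∑ k ∈ Finset.range (ℓ + 1), |g.coeff k| ∧
      ‖gradient (E.lift c ℓ i g) x‖ ≤ ℓ * K * ∑ k ∈ Finset.range (ℓ + 1), |g.coeff k| := by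
  obtain ⟨⟨s, t⟩, ⟨hs, ht⟩, rfl⟩ := hx
  simp only [mem_Ioo] at hs ht
  have hD := abs_pos.2 (h.fanDet_ne_zero i)
  rw [duffy_fan]
  set x := c + s • (E.edgePoint i t - c)
  have hb : |E.bary c i x| ≤ 1 := by
    rw [h.bary_eq, abs_of_nonneg (mul_nonneg hs.1.le ht.1.le)]
    nlinarith
  have hr : |E.radial c i x| ≤ 1 := by
    rw [h.radial_eq, abs_of_nonneg hs.1.le]; exact hs.2.le
  have hb' : HasFDerivAt (E.bary c i) ((E.fanDet c i)⁻¹ • crL (E.vertex i - c)) x :=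
    (((crL _).hasFDerivAt.comp x ((hasFDerivAt_id x).sub_const c))).const_mul _
  have hr' : HasFDerivAt (E.radial c i)
      (-(E.fanDet c i)⁻¹ • crL (E.vertex (i + 1) - E.vertex i)) x :=
    (((crL _).hasFDerivAt.comp x ((hasFDerivAt_id x).sub_const c))).const_mul _
  have nb : ‖(E.fanDet c i)⁻¹ • crL (E.vertex i - c)‖ ≤ K := by
    rw [norm_smul, norm_inv, Real.norm_eq_abs, inv_mul_le_iff₀ hD, mul_comm]
    exact (norm_crL_le _).trans hK1
  have nr : ‖-(E.fanDet c i)⁻¹ • crL (E.vertex (i + 1) - E.vertex i)‖ ≤ K := by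
    rw [norm_smul, norm_neg, norm_inv, Real.norm_eq_abs, inv_mul_le_iff₀ hD, mul_comm]
    exact (norm_crL_le _).trans hK2
  constructor
  · refine (norm_sum_le _ _).trans (Finset.sum_le_sum fun k _ => ?_)
    rw [Real.norm_eq_abs, abs_mul, abs_mul, abs_pow, abs_pow]
    exact mul_le_of_le_one_right (abs_nonneg _) (mul_le_one₀ (pow_le_one₀ (abs_nonneg _) hb)
      (pow_nonneg (abs_nonneg _) _) (pow_le_one₀ (abs_nonneg _) hr))
  · have hdiff : ∀ k ∈ Finset.range (ℓ + 1), DifferentiableAt ℝ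
        (fun y => g.coeff k * (E.bary c i y ^ k * E.radial c i y ^ (ℓ - k))) x := fun k _ =>
      (((hb'.pow k).mul (hr'.pow (ℓ - k))).const_mul _).differentiableAt
    have hfd : fderiv ℝ (E.lift c ℓ i g) x = ∑ k ∈ Finset.range (ℓ + 1), fderiv ℝ
        (fun y => g.coeff k * (E.bary c i y ^ k * E.radial c i y ^ (ℓ - k))) x := fderiv_fun_sum hdiff
    rw [norm_gradient, hfd, Finset.mul_sum]
    refine (norm_sum_le _ _).trans (Finset.sum_le_sum fun k hk => ?_)
    refine (norm_fderiv_pow_mul_pow_le hb' hr' hb hr nb nr _ k (ℓ - k)).trans (le_of_eq ?_)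
    rw [Nat.add_sub_of_le (Nat.lt_succ_iff.1 (Finset.mem_range.1 hk))]
    ring

end StarBall

/-- The function given by `w i` on the fan triangle `i`. -/
def pw {F : Type*} [AddCommMonoid F] (E : Polygon) (c : Plane) (w : E.Idx → Plane → F) (x : Plane) : F :=
  ∑ i, (E.fanTri c i).indicator (w i) x

section pw

variable {F : Type*} [NormedAddCommGroup F] {w : E.Idx → Plane → F}

lemma StarBall.pw_eq (h : E.StarBall c r) (w : E.Idx → Plane → F) {i : E.Idx} {x : Plane}
    (hx : x ∈ E.fanTri c i) : E.pw c w x = w i x := by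
  rw [pw, Finset.sum_eq_single i, indicator_of_mem hx]
  · intro j _ hj
    exact indicator_of_notMem (fun hxj => disjoint_left.1 (h.fanTri_disjoint hj) hxj hx) _
  · simp

lemma StarBall.memLp_pw (h : E.StarBall c r) (hw : ∀ i, Continuous (w i)) : MemLp (E.pw c w) 2 E.mE :=
  memLp_finsetSum _ fun i _ =>
    (memLp_of_continuous E.isBounded_carrier (hw i)).indicator (h.measurableSet_fanTri i)

/-- At each point at most one triangle is active, so the root of the sum of squares is a pointwise
bound. With the area at most `(2 h)²`, no count of edges enters. -/
lemma StarBall.l2_pw_le (h : E.StarBall c r) {B : E.Idx → ℝ}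
    (hB : ∀ i, ∀ x ∈ E.fanTri c i, ‖w i x‖ ≤ B i) :
    l2 E.mE (E.pw c w) ≤ Real.sqrt (∑ i, B i ^ 2) * (2 * E.diam) := by
  refine l2_le_of_bound (Real.sqrt_nonneg _) (ae_of_all _ fun x => ?_) (mE_real_univ_le h)
    (by have := E.diam_pos; positivity)
  by_cases hx : ∃ i, x ∈ E.fanTri c i
  · obtain ⟨i, hi⟩ := hx
    rw [h.pw_eq w hi]
    refine Real.le_sqrt_of_sq_le ?_
    exact (pow_le_pow_left₀ (norm_nonneg _) (hB i x hi) 2).trans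
      (Finset.single_le_sum (f := fun i => B i ^ 2) (fun _ _ => sq_nonneg _) (Finset.mem_univ i))
  · push Not at hx
    rw [pw, Finset.sum_eq_zero fun i _ => indicator_of_notMem (hx i) _, norm_zero]
    exact Real.sqrt_nonneg _

end pw

namespace StarBall

/-- Subtracting the lifting of its traces from a function gives a function with zero trace. -/
lemma zeroTrace_sub_lift (h : E.StarBall c r) (hu : E.MemEnlarged ℓ u) :
    E.ZeroTrace (fun x => u x - E.pw c (fun i => E.lift c ℓ i (E.edgeTrace u i)) x)
      (fun x => weakGrad E.carrier u x -
        E.pw c (fun i => gradient (E.lift c ℓ i (E.edgeTrace u i))) x) := by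
  set w : E.Idx → Plane → ℝ := fun i => E.lift c ℓ i (E.edgeTrace u i)
  have hdeg := fun i => (h.hasEdgeTrace_edgeTrace hu i).2
  have hw : ∀ i, ContDiff ℝ ∞ (w i) := fun i => contDiff_lift c i _
  have hwg := fun i => continuous_gradient (contDiff_one (hw i))
  have hW := h.memLp_pw fun i => (hw i).continuous
  have hDW := h.memLp_pw hwg
  refine ⟨hu.1.1.sub hW, hu.1.memLp_weakGrad.sub hDW, fun ψ hψ j => ?_⟩
  have hψ1 := contDiff_one hψ
  have hψc := hψ.continuous
  have hψg := continuous_gradient hψ1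
  have mψ : MemLp ψ 2 E.mE := memLp_of_continuous E.isBounded_carrier hψc
  have mψg : MemLp (gradient ψ) 2 E.mE := memLp_of_continuous E.isBounded_carrier hψg
  have g1 := h.green_apply hu hψ1 j
  -- Agreement on the radial sides follows from the equality of the traces at the vertices. The
  -- boundary terms are those of `green_apply` for `u`, and they cancel on subtraction.
  have g2 := h.green_fan (bv j) (f := fun i x => w i x * ψ x) (fun i => (contDiff_one (hw i)).mul hψ1)
    (fun i s => by
      have := h.lift_match hdeg i (h.edgeTrace_vertex hu i) s
      simp only [w]
      rw [this])
  have e1 : ∀ i x, fderiv ℝ (fun x => w i x * ψ x) x (bv j) =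
      gradient (w i) x j * ψ x + w i x * gradient ψ x j := fun i x => by
    rw [← gradient_apply, gradient_mul ((contDiff_one (hw i)).differentiable (by norm_num)).differentiableAt
      (hψ1.differentiable (by norm_num)).differentiableAt]
    simp only [PiLp.add_apply, PiLp.smul_apply, smul_eq_mul]; ring
  have i1 := integrable_mul (memLp_apply hDW j) mψ
  have i2 := integrable_mul hW (memLp_apply mψg j)
  have e2 : ∑ i, ∫ x in E.fanTri c i, fderiv ℝ (fun x => w i x * ψ x) x (bv j) =
      (∫ x in E.carrier, E.pw c (fun i => gradient (w i)) x j * ψ x) +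
        ∫ x in E.carrier, E.pw c w x * gradient ψ x j := by
    rw [← integral_add i1 i2, h.integral_eq_sum (f := fun x => E.pw c (fun i => gradient (w i)) x j * ψ x +
      E.pw c w x * gradient ψ x j) fun i => (i1.add i2).mono_measure
      (Measure.restrict_mono (h.fanTri_subset i) le_rfl)]
    refine Finset.sum_congr rfl fun i _ => setIntegral_congr_fun (h.measurableSet_fanTri i) fun x hx => ?_
    simp only [e1, h.pw_eq _ hx]
  have e3 : ∑ i, E.fanSign c i * cr (bv j) (E.vertex (i + 1) - E.vertex i) *
      ∫ t in (0 : ℝ)..1, w i (E.edgePoint i t) * ψ (E.edgePoint i t) =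
      ∑ i, E.edgeIntegral i (fun t => (E.edgeTrace u i).eval t *
          (ψ (E.edgePoint i t) * E.outwardNormal i j)) := by
    refine Finset.sum_congr rfl fun i _ => ?_
    rw [← h.edgeLength_mul_inner_outwardNormal, real_inner_comm, inner_bv, edgeIntegral, mul_assoc]
    congr 1
    rw [← intervalIntegral.integral_const_mul]
    refine intervalIntegral.integral_congr fun t _ => ?_
    simp only [w, h.lift_edgePoint i (hdeg i)]
    ring
  rw [e2, e3] at g2
  simp only [sub_mul, mul_sub, PiLp.sub_apply]
  rw [integral_sub (integrable_mul hu.1.1 (memLp_apply mψg j)) i2,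
    integral_sub (integrable_mul mψ (memLp_apply hu.1.memLp_weakGrad j))
      (integrable_mul mψ (memLp_apply hDW j))]
  simp only [mul_comm (ψ _)]
  linarith

end StarBall

/-- A function orthogonal to polynomials is controlled by its degrees of freedom. -/
theorem exists_energy_le (ℓ : ℕ) {ρ : ℝ} (hρ : 0 < ρ) : ∃ C : ℝ, 0 < C ∧
    ∀ (E : Polygon) (c : Plane), E.StarBall c (ρ * E.diam) → (∀ i, ρ * E.diam ≤ E.edgeLength i) →
    ∀ u, E.MemEnlarged ℓ u →
      (∀ p : Poly, p.totalDegree ≤ ℓ → ∫ x in E.carrier, u x * polyFun p x = 0) →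
      l2 E.mE (weakGrad E.carrier u) ^ 2 ≤ C * ∑ d, E.dof ℓ u d ^ 2 := by
  obtain ⟨C₁, hC₁, hdiv⟩ := exists_divergence_bound ℓ hρ
  obtain ⟨C₂, hC₂, hcoef⟩ := exists_coeff_bound ℓ
  refine ⟨(2 * ℓ / ρ ^ 2 + 2 * C₁) ^ 2 * ((ℓ + 1) ^ 2 * C₂ * 2), by positivity, fun E c h hedge u hu horth => ?_⟩
  have hh := E.diam_pos
  obtain ⟨q, hqd, hq⟩ := hu.2.1
  have hdeg := fun i => (h.hasEdgeTrace_edgeTrace hu i).2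
  have hG := hu.1.memLp_weakGrad
  set G := weakGrad E.carrier u
  set A : E.Idx → ℝ := fun i => ∑ k ∈ Finset.range (ℓ + 1), |(E.edgeTrace u i).coeff k|
  have hA0 : ∀ i, 0 ≤ A i := fun i => Finset.sum_nonneg fun _ _ => abs_nonneg _
  have hqb := hdiv E c h q hqd G hG hq
  have hz := h.zeroTrace_sub_lift hu
  have hid := h.integral_inner_eq_of_zeroTrace hz hG hq
  set w : E.Idx → Plane → ℝ := fun i => E.lift c ℓ i (E.edgeTrace u i)
  have hw : ∀ i, ContDiff ℝ ∞ (w i) := fun i => contDiff_lift c i _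
  have hW := h.memLp_pw fun i => (hw i).continuous
  have hDW := h.memLp_pw fun i => continuous_gradient (contDiff_one (hw i))
  -- The determinants are at least `ρ² h²`, and all the vectors involved have length at most `h`.
  set K := 1 / (ρ ^ 2 * E.diam) with hK
  have hKD : ∀ i, E.diam ≤ K * |E.fanDet c i| := fun i => by
    have h1 := h.r_mul_edgeLength_le i
    have h2 := mul_le_mul_of_nonneg_left (hedge i) (by positivity : 0 ≤ ρ * E.diam)
    rw [hK, div_mul_eq_mul_div, one_mul, le_div_iff₀ (by positivity)]
    nlinarith
  have hb := fun i (x : Plane) (hx : x ∈ E.fanTri c i) => h.lift_bound (ℓ := ℓ) (K := K) i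
    ((h.norm_sub_le (vertex_mem_closure i)).trans (hKD i))
    (by rw [← edgeLength_eq]; exact (edgeLength_le i).trans (hKD i)) (E.edgeTrace u i) hx
  set W := E.pw c w
  set DW := E.pw c fun i => gradient (w i)
  set S := Real.sqrt (∑ i, A i ^ 2) with hS
  have hS0 : 0 ≤ S := Real.sqrt_nonneg _
  have b1 : l2 E.mE W ≤ S * (2 * E.diam) := h.l2_pw_le fun i x hx => (hb i x hx).1
  have b2 : l2 E.mE DW ≤ ℓ * K * S * (2 * E.diam) := by
    refine (h.l2_pw_le (B := fun i => ℓ * K * A i) fun i x hx => (hb i x hx).2).trans (le_of_eq ?_)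
    simp only [mul_pow, ← Finset.mul_sum]
    rw [Real.sqrt_mul (by positivity), ← mul_pow, Real.sqrt_sq (by positivity)]
  have b2' : l2 E.mE DW ≤ 2 * ℓ / ρ ^ 2 * S := b2.trans (le_of_eq (by rw [hK]; field_simp))
  -- The weak equation tested with `u - W`; the term `∫ q u` vanishes because `q` has degree at most
  -- `ℓ`.
  have hid' : l2 E.mE G ^ 2 = (∫ x in E.carrier, inner ℝ (G x) (DW x)) +
      ∫ x in E.carrier, polyFun q x * W x := by
    have h1 : ∫ x in E.carrier, inner ℝ (G x) (G x - DW x) =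
      -∫ x in E.carrier, polyFun q x * (u x - W x) := hid
    simp only [inner_sub_right, mul_sub, real_inner_self_eq_norm_sq] at h1
    rw [integral_sub (integrable_norm_sq hG) (integrable_inner hG hDW),
      integral_sub (integrable_mul (memLp_polyFun E q) hu.1.1) (integrable_mul (memLp_polyFun E q) hW)] at h1
    have h2 := horth q hqd
    simp only [mul_comm (u _)] at h2
    rw [l2_sq]
    linarith
  have k1 := (le_abs_self _).trans (abs_integral_inner_le hG hDW)
  have k2 := (le_abs_self _).trans (abs_integral_mul_le (memLp_polyFun E q) hW)
  have hG0 : 0 ≤ l2 E.mE G := l2_nonneg _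
  have k3 : l2 E.mE (polyFun q) * l2 E.mE W ≤ (C₁ / E.diam * l2 E.mE G) * (S * (2 * E.diam)) :=
    mul_le_mul hqb b1 (l2_nonneg _) (by positivity)
  have k3' : (C₁ / E.diam * l2 E.mE G) * (S * (2 * E.diam)) = l2 E.mE G * (2 * C₁ * S) := by field_simp
  -- All powers of `h` have cancelled, and one factor `‖G‖` is divided out.
  have k4 : l2 E.mE G ≤ (2 * ℓ / ρ ^ 2 + 2 * C₁) * S := by
    rcases hG0.eq_or_lt with h0 | h0
    · rw [← h0]; positivity
    · refine le_of_mul_le_mul_left (a := l2 E.mE G) ?_ h0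
      have := mul_le_mul_of_nonneg_left b2' hG0
      rw [← sq, hid']
      linarith
  have k5 : ∀ i, A i ^ 2 ≤ (ℓ + 1) ^ 2 * C₂ * ((E.edgeTrace u i).eval 0 ^ 2 +
      (E.edgeTrace u i).eval 1 ^ 2 + ∑ k : Fin (ℓ - 1), moment k (E.edgeTrace u i) ^ 2) := fun i => by
    have h1 : A i ^ 2 ≤ _ := sq_sum_le_card_mul_sum_sq
    have h2 : ∑ k ∈ Finset.range (ℓ + 1), |(E.edgeTrace u i).coeff k| ^ 2 ≤ _ :=
      Finset.sum_le_card_nsmul _ _ _ fun k _ => (sq_abs _).trans_le (hcoef _ (hdeg i) k)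
    rw [Finset.card_range, nsmul_eq_mul] at h2
    rw [Finset.card_range] at h1
    push_cast at h1 h2
    refine h1.trans ((mul_le_mul_of_nonneg_left h2 (by positivity)).trans (le_of_eq (by ring)))
  -- The end value of an edge is the initial value of the next, so the vertex degrees of freedom
  -- account for both; hence the factor `2` below.
  have k6 : ∑ i, (E.edgeTrace u i).eval 1 ^ 2 = ∑ i, (E.edgeTrace u i).eval 0 ^ 2 := by
    simp only [h.edgeTrace_vertex hu]
    exact Equiv.sum_comp (Equiv.addRight (1 : E.Idx)) fun i => (E.edgeTrace u i).eval 0 ^ 2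
  have k7 : S ^ 2 ≤ (ℓ + 1) ^ 2 * C₂ * 2 * ∑ d, E.dof ℓ u d ^ 2 := by
    rw [hS, Real.sq_sqrt (Finset.sum_nonneg fun _ _ => sq_nonneg _)]
    refine (Finset.sum_le_sum fun i _ => k5 i).trans ?_
    rw [← Finset.mul_sum, mul_assoc ((ℓ + 1) ^ 2 * C₂)]
    refine mul_le_mul_of_nonneg_left ?_ (by positivity)
    rw [sum_dofIdx, Finset.sum_add_distrib, Finset.sum_add_distrib, k6]
    simp only [dof_edgeMoment]
    have n1 : 0 ≤ ∑ a, ∑ b, E.dof ℓ u (.interiorMoment a b) ^ 2 :=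
      Finset.sum_nonneg fun _ _ => Finset.sum_nonneg fun _ _ => sq_nonneg _
    have n2 : 0 ≤ ∑ i, ∑ k : Fin (ℓ - 1), moment k (E.edgeTrace u i) ^ 2 :=
      Finset.sum_nonneg fun _ _ => Finset.sum_nonneg fun _ _ => sq_nonneg _
    have n3 : ∀ i, E.dof ℓ u (.vertexValue i) = (E.edgeTrace u i).eval 0 := fun i => rfl
    simp only [n3]
    linarith
  calc l2 E.mE G ^ 2 ≤ ((2 * ℓ / ρ ^ 2 + 2 * C₁) * S) ^ 2 := pow_le_pow_left₀ hG0 k4 2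
    _ = (2 * ℓ / ρ ^ 2 + 2 * C₁) ^ 2 * S ^ 2 := mul_pow _ _ _
    _ ≤ (2 * ℓ / ρ ^ 2 + 2 * C₁) ^ 2 * ((ℓ + 1) ^ 2 * C₂ * 2 * ∑ d, E.dof ℓ u d ^ 2) := by gcongr
    _ = _ := by ring

end Polygon
end VEM

end

noncomputable section

namespace VEM

/-! ### The nonlinearity -/

/-- The case `s = 0`, divided by `a`. Nothing is known about `κ 0`. -/
lemma mem_bounds_of_ne_zero {κ : ℝ → ℝ} {m M a : ℝ}
    (h : ∀ s t : ℝ, 0 ≤ s → s ≤ t →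
      m * (t - s) ≤ κ t * t - κ s * s ∧ κ t * t - κ s * s ≤ M * (t - s)) (ha : 0 < a) :
    m ≤ κ a ∧ κ a ≤ M := by
  obtain ⟨h1, h2⟩ := h 0 a le_rfl ha.le
  rw [sub_zero, mul_zero, sub_zero] at h1 h2
  exact ⟨le_of_mul_le_mul_right h1 ha, le_of_mul_le_mul_right h2 ha⟩

variable {H : Type*} [NormedAddCommGroup H] [InnerProductSpace ℝ H]

/-- Split both squared norms into a radial and an angular part: `|ξ - η|²` is `(|ξ| - |η|)² + 2 (|ξ|
|η| - ξ·η)`, and for the flux the angular part carries the factor `κ(|ξ|) κ(|η|) ≤ M²`. The scalar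
hypothesis handles the radial part. -/
lemma norm_flux_sub_le {κ : ℝ → ℝ} {m M : ℝ} (hm : 0 < m) (hM : 0 < M)
    (h : ∀ s t : ℝ, 0 ≤ s → s ≤ t →
      m * (t - s) ≤ κ t * t - κ s * s ∧ κ t * t - κ s * s ≤ M * (t - s)) (ξ η : H) :
    ‖κ ‖ξ‖ • ξ - κ ‖η‖ • η‖ ≤ M * ‖ξ - η‖ := by
  refine abs_le_of_sq_le_sq' ?_ (by positivity) |>.2
  rw [mul_pow, @norm_sub_sq ℝ, @norm_sub_sq ℝ, norm_smul, norm_smul, mul_pow, mul_pow, Real.norm_eq_abs,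
    Real.norm_eq_abs, sq_abs, sq_abs, RCLike.re_to_real, RCLike.re_to_real, real_inner_smul_left,
    real_inner_smul_right]
  have hle := real_inner_le_norm ξ η
  have key : ∀ a b : ℝ, 0 ≤ a → a ≤ b → (κ a * a - κ b * b) ^ 2 ≤ M ^ 2 * (a - b) ^ 2 := fun a b ha hab => by
    obtain ⟨h1, h2⟩ := h a b ha hab
    have : 0 ≤ κ b * b - κ a * a := le_trans (mul_nonneg hm.le (by linarith)) h1
    rw [← mul_pow, ← neg_sq, ← neg_sq (M * (a - b))]
    exact pow_le_pow_left₀ (by linarith) (by linarith) 2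
  have hkey : (κ ‖ξ‖ * ‖ξ‖ - κ ‖η‖ * ‖η‖) ^ 2 ≤ M ^ 2 * (‖ξ‖ - ‖η‖) ^ 2 := by
    rcases le_total ‖ξ‖ ‖η‖ with hab | hab
    · exact key _ _ (norm_nonneg _) hab
    · have := key _ _ (norm_nonneg _) hab
      linarith [sub_sq_comm (κ ‖ξ‖ * ‖ξ‖) (κ ‖η‖ * ‖η‖), sub_sq_comm ‖ξ‖ ‖η‖,
        congrArg (M ^ 2 * ·) (sub_sq_comm ‖ξ‖ ‖η‖)]
  -- The coefficients are bounded only at nonzero arguments; if one vector vanishes, so does the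
  -- angular factor.
  have hprod : 0 ≤ (M ^ 2 - κ ‖ξ‖ * κ ‖η‖) * (‖ξ‖ * ‖η‖ - inner ℝ ξ η) := by
    rcases (norm_nonneg ξ).eq_or_lt with h0 | h0
    · rw [norm_eq_zero.1 h0.symm]; simp
    rcases (norm_nonneg η).eq_or_lt with h0' | h0'
    · rw [norm_eq_zero.1 h0'.symm]; simp
    obtain ⟨a1, a2⟩ := mem_bounds_of_ne_zero h h0
    obtain ⟨b1, b2⟩ := mem_bounds_of_ne_zero h h0'
    refine mul_nonneg (sub_nonneg.2 ?_) (by linarith)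
    rw [sq]
    exact mul_le_mul a2 b2 (by linarith) hM.le
  nlinarith

/-- The same splitting: the angular part now has the coefficient `κ(|ξ|) + κ(|η|) ≥ 2 m`. -/
lemma le_inner_flux_sub {κ : ℝ → ℝ} {m M : ℝ}
    (h : ∀ s t : ℝ, 0 ≤ s → s ≤ t →
      m * (t - s) ≤ κ t * t - κ s * s ∧ κ t * t - κ s * s ≤ M * (t - s)) (ξ η : H) :
    m * ‖ξ - η‖ ^ 2 ≤ inner ℝ (κ ‖ξ‖ • ξ - κ ‖η‖ • η) (ξ - η) := by
  rw [@norm_sub_sq ℝ, RCLike.re_to_real, inner_sub_left, inner_sub_right, inner_sub_right,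
    real_inner_smul_left, real_inner_smul_left, real_inner_smul_left, real_inner_smul_left,
    real_inner_self_eq_norm_sq, real_inner_self_eq_norm_sq, real_inner_comm ξ η]
  have hle := real_inner_le_norm ξ η
  have key : ∀ a b : ℝ, 0 ≤ a → a ≤ b → m * (a - b) ^ 2 ≤ (κ a * a - κ b * b) * (a - b) := fun a b ha hab => by
    nlinarith [(h a b ha hab).1]
  have hkey : m * (‖ξ‖ - ‖η‖) ^ 2 ≤ (κ ‖ξ‖ * ‖ξ‖ - κ ‖η‖ * ‖η‖) * (‖ξ‖ - ‖η‖) := by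
    rcases le_total ‖ξ‖ ‖η‖ with hab | hab
    · exact key _ _ (norm_nonneg _) hab
    · have := key _ _ (norm_nonneg _) hab
      linarith [congrArg (m * ·) (sub_sq_comm ‖ξ‖ ‖η‖)]
  have hprod : 0 ≤ (κ ‖ξ‖ + κ ‖η‖ - 2 * m) * (‖ξ‖ * ‖η‖ - inner ℝ ξ η) := by
    rcases (norm_nonneg ξ).eq_or_lt with h0 | h0
    · rw [norm_eq_zero.1 h0.symm]; simp
    rcases (norm_nonneg η).eq_or_lt with h0' | h0'
    · rw [norm_eq_zero.1 h0'.symm]; simp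
    obtain ⟨a1, a2⟩ := mem_bounds_of_ne_zero h h0
    obtain ⟨b1, b2⟩ := mem_bounds_of_ne_zero h h0'
    exact mul_nonneg (by linarith) (by linarith)
  nlinarith

namespace Polygon

variable {E : Polygon} {c : Plane} {r : ℝ} {v w z : Plane → ℝ} {ℓ : ℕ} {P : (Plane → ℝ) → Poly}
  {Q : E.Idx → (Plane → ℝ) → Polynomial ℝ}

/-! ### Linearity of the projections -/

/-- The projection is a fixed linear combination of the degrees of freedom, which are linear on the
enlarged space. -/
lemma StarBall.valueProjection_sub (h : E.StarBall c r) (hP : E.IsValueProjection ℓ P)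
    (hv : E.MemEnlarged ℓ v) (hw : E.MemEnlarged ℓ w) : P (fun x => v x - w x) = P v - P w := by
  obtain ⟨⟨b, hb⟩, -⟩ := hP
  rw [hb _ (memEnlarged_sub hv hw), hb v hv, hb w hw, ← Finset.sum_sub_distrib]
  exact Finset.sum_congr rfl fun d _ => by rw [h.dof_sub hv hw, sub_smul]

lemma StarBall.memLocal_sub (h : E.StarBall c r) (hP : E.IsValueProjection ℓ P)
    (hv : E.MemLocal ℓ P v) (hw : E.MemLocal ℓ P w) : E.MemLocal ℓ P (fun x => v x - w x) := by
  refine ⟨memEnlarged_sub hv.1 hw.1, fun p hp hd => ?_⟩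
  have h1 := hv.2 p hp hd
  have h2 := hw.2 p hp hd
  rw [h.valueProjection_sub hP hv.1 hw.1]
  have m1 : MemLp (fun x => v x - polyFun (P v) x) 2 E.mE := hv.1.1.1.sub (memLp_polyFun E _)
  have m2 : MemLp (fun x => w x - polyFun (P w) x) 2 E.mE := hw.1.1.1.sub (memLp_polyFun E _)
  rw [← sub_zero (0 : ℝ)]
  nth_rewrite 1 [← h1]
  rw [← h2, ← integral_sub (integrable_mul m1 (memLp_polyFun E p)) (integrable_mul m2 (memLp_polyFun E p))]
  refine integral_congr_ae (ae_of_all _ fun x => ?_)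
  simp only [polyFun_sub]
  ring

lemma StarBall.dof_residual_sub (h : E.StarBall c r) (hP : E.IsValueProjection ℓ P)
    (hv : E.MemEnlarged ℓ v) (hw : E.MemEnlarged ℓ w) (d : E.DofIdx ℓ) :
    E.dof ℓ (fun x => (v x - w x) - polyFun (P fun x => v x - w x) x) d =
      E.dof ℓ (fun x => v x - polyFun (P v) x) d - E.dof ℓ (fun x => w x - polyFun (P w) x) d := by
  rw [← h.dof_sub (memEnlarged_residual hP hv) (memEnlarged_residual hP hw),
    h.valueProjection_sub hP hv hw]
  congr 1
  funext x
  rw [polyFun_sub]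
  ring

lemma ae_eq_zero_of_l2 {α F : Type*} [MeasurableSpace α] {ν : Measure α} [NormedAddCommGroup F]
    {f : α → F} (hf : MemLp f 2 ν) (h0 : l2 ν f = 0) : f =ᵐ[ν] 0 := by
  have h1 := l2_sq (ν := ν) f
  rw [h0, zero_pow two_ne_zero, eq_comm, integral_eq_zero_iff_of_nonneg (fun _ => sq_nonneg _)
    (integrable_norm_sq hf)] at h1
  filter_upwards [h1] with x hx
  simpa using hx

lemma polyField_sub (g g' : Fin 2 → Poly) (x : Plane) :
    polyField (fun j => g j - g' j) x = polyField g x - polyField g' x := by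
  ext j; simp only [PiLp.sub_apply, polyField_apply, polyFun_sub]

lemma IsFieldProjection.ae_eq {n : ℕ} {f : Plane → Plane} {g g' : Fin 2 → Poly} (hf : MemLp f 2 E.mE)
    (hg : E.IsFieldProjection n f g) (hg' : E.IsFieldProjection n f g') :
    polyField g =ᵐ[E.mE] polyField g' := by
  have h1 := (hg.sub hf hf hg').l2_le (hf.sub hf)
  have h2 : l2 E.mE (fun x => f x - f x) = 0 := by simp [l2]
  have h3 := ae_eq_zero_of_l2 (memLp_polyField E _) (le_antisymm (h1.trans h2.le) (l2_nonneg _))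
  filter_upwards [h3] with x hx
  rw [polyField_sub] at hx
  exact sub_eq_zero.1 hx

/-- `gradProj` is defined by choice, so linearity comes from uniqueness of the `L²` projection of
the weak gradient. -/
lemma StarBall.gradProj_sub (h : E.StarBall c r) (hP : E.IsValueProjection ℓ P)
    (hQ : ∀ i, E.IsEdgeProjection ℓ i (Q i)) (hw : E.MemLocal ℓ P w) (hz : E.MemLocal ℓ P z) :
    E.gradProj ℓ P Q (fun x => w x - z x) =ᵐ[E.mE]
      fun x => E.gradProj ℓ P Q w x - E.gradProj ℓ P Q z x := by
  obtain ⟨gw, ew, pw⟩ := h.exists_gradProj_eq hP hQ hw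
  obtain ⟨gz, ez, pz⟩ := h.exists_gradProj_eq hP hQ hz
  obtain ⟨gd, ed, pd⟩ := h.exists_gradProj_eq hP hQ (h.memLocal_sub hP hw hz)
  have mw := hw.1.1.memLp_weakGrad
  have mz := hz.1.1.memLp_weakGrad
  have hd : E.IsFieldProjection (ℓ - 1)
      (fun x => weakGrad E.carrier w x - weakGrad E.carrier z x) gd := by
    refine ⟨pd.1, fun p hp => (pd.2 p hp).trans (integral_congr_ae ?_)⟩
    filter_upwards [weakGrad_sub E.isOpen_carrier hw.1.1 hz.1.1] with x hx
    rw [hx]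
  rw [ew, ez, ed]
  refine (hd.ae_eq (mw.sub mz) (pw.sub mw mz pz)).trans (ae_of_all _ fun x => ?_)
  exact polyField_sub gw gz x

lemma StarBall.l2_gradProj_le (h : E.StarBall c r) (hP : E.IsValueProjection ℓ P)
    (hQ : ∀ i, E.IsEdgeProjection ℓ i (Q i)) (hv : E.MemLocal ℓ P v) :
    l2 E.mE (E.gradProj ℓ P Q v) ≤ l2 E.mE (weakGrad E.carrier v) := by
  obtain ⟨g, e, hg⟩ := h.exists_gradProj_eq hP hQ hv
  rw [e]
  exact hg.l2_le hv.1.1.memLp_weakGrad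

lemma StarBall.continuous_gradProj (h : E.StarBall c r) (hP : E.IsValueProjection ℓ P)
    (hQ : ∀ i, E.IsEdgeProjection ℓ i (Q i)) (hv : E.MemLocal ℓ P v) :
    Continuous (E.gradProj ℓ P Q v) := by
  obtain ⟨g, e, -⟩ := h.exists_gradProj_eq hP hQ hv
  rw [e]
  exact continuous_polyField g

/-- Best approximation with competitor `∇(P v)`, whose components have degree at most `ℓ - 1`. -/
lemma StarBall.l2_weakGrad_le (h : E.StarBall c r) (hP : E.IsValueProjection ℓ P)
    (hQ : ∀ i, E.IsEdgeProjection ℓ i (Q i)) (hv : E.MemLocal ℓ P v) :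
    l2 E.mE (weakGrad E.carrier v) ≤ l2 E.mE (E.gradProj ℓ P Q v) +
      2 * l2 E.mE (weakGrad E.carrier fun x => v x - polyFun (P v) x) := by
  obtain ⟨g, e, hg⟩ := h.exists_gradProj_eq hP hQ hv
  have h1 := hg.l2_sub_le hv.1.1.memLp_weakGrad (p := fun j => MvPolynomial.pderiv j (P v)) fun j =>
    (totalDegree_pderiv_le j _).trans (Nat.sub_le_sub_right (hP.2.1 v hv.1) 1)
  rw [e]
  refine h1.trans (le_of_eq ?_)
  congr 2
  refine l2_congr ?_
  filter_upwards [weakGrad_sub E.isOpen_carrier hv.1.1 (E.memH1_polyFun (P v)),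
    E.weakGrad_polyFun (P v)] with x h1 h2
  rw [h1, h2]
  congr 1
  ext j
  rw [polyField_apply, gradient_polyFun]

/-! ### Local estimates -/

variable {Ω : Set Plane} {μ : Plane → ℝ → ℝ} {m M : ℝ}

lemma memLp_flux (hμ : NonlinearityAssumption Ω μ m M) (hm : 0 < m) (hE : E.carrier ⊆ Ω)
    {g : Plane → Plane} (hg : Continuous g) : MemLp (fun x => μ x ‖g x‖ • g x) 2 E.mE := by
  refine (memLp_of_continuous E.isBounded_carrier hg).of_le_mul (c := M) ?_ ?_
  · refine (ContinuousOn.aestronglyMeasurable ?_ E.measurableSet_carrier)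
    have hκ : ContinuousOn (fun x => μ x ‖g x‖) E.carrier :=
      hμ.1.comp (f := fun x => (x, ‖g x‖)) (by fun_prop) fun x hx =>
        ⟨subset_closure (hE hx), norm_nonneg _⟩
    exact hκ.smul hg.continuousOn
  · filter_upwards [ae_restrict_mem E.measurableSet_carrier] with x hx
    rcases (norm_nonneg (g x)).eq_or_lt with h0 | h0
    · rw [norm_smul, ← h0]; simp
    · obtain ⟨h1, h2⟩ := mem_bounds_of_ne_zero (hμ.2 x (subset_closure (hE hx))) h0
      rw [norm_smul, Real.norm_eq_abs, abs_of_nonneg (hm.le.trans h1)]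
      exact mul_le_mul_of_nonneg_right h2 h0.le

/-- The stabilisation is bilinear and independent of the nonlinear argument, so only the flux
difference is nonlinear. -/
lemma localForm_sub (hμ : NonlinearityAssumption Ω μ m M) (hm : 0 < m) (hE : E.carrier ⊆ Ω)
    (h : E.StarBall c r) (hP : E.IsValueProjection ℓ P)
    (hQ : ∀ i, E.IsEdgeProjection ℓ i (Q i)) (hw : E.MemLocal ℓ P w) (hz : E.MemLocal ℓ P z)
    (hv : E.MemLocal ℓ P v) :
    E.localForm ℓ μ m M P Q w w v - E.localForm ℓ μ m M P Q z z v =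
      (∫ x in E.carrier, inner ℝ (μ x ‖E.gradProj ℓ P Q w x‖ • E.gradProj ℓ P Q w x -
        μ x ‖E.gradProj ℓ P Q z x‖ • E.gradProj ℓ P Q z x) (E.gradProj ℓ P Q v x)) +
      M * m * ∑ d, E.dof ℓ (fun x => (w x - z x) - polyFun (P fun x => w x - z x) x) d *
        E.dof ℓ (fun x => v x - polyFun (P v) x) d := by
  have cw := h.continuous_gradProj hP hQ hw
  have cz := h.continuous_gradProj hP hQ hz
  have mv := memLp_of_continuous E.isBounded_carrier (h.continuous_gradProj hP hQ hv)
  simp only [h.dof_residual_sub hP hw.1 hz.1, localForm, stab, inner_sub_left, sub_mul,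
    Finset.sum_sub_distrib]
  rw [integral_sub (integrable_inner (memLp_flux hμ hm hE cw) mv)
    (integrable_inner (memLp_flux hμ hm hE cz) mv)]
  simp only [real_inner_smul_left]
  ring

/-- The flux is `M`-Lipschitz and the gradient projection contracts; Cauchy–Schwarz on the degrees
of freedom and `exists_stab_le` control the stabilisation. -/
theorem exists_local_lipschitz (ℓ : ℕ) {ρ m M : ℝ} (hρ : 0 < ρ) (hm : 0 < m) (hM : 0 < M) :
    ∃ C : ℝ, 0 < C ∧ ∀ (Ω : Set Plane) (μ : Plane → ℝ → ℝ), NonlinearityAssumption Ω μ m M →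
    ∀ (E : Polygon) (c : Plane), E.carrier ⊆ Ω → E.StarBall c (ρ * E.diam) →
    (∀ i, ρ * E.diam ≤ E.edgeLength i) → ∀ P, E.IsValueProjection ℓ P →
    ∀ Q : E.Idx → (Plane → ℝ) → Polynomial ℝ, (∀ i, E.IsEdgeProjection ℓ i (Q i)) →
    ∀ w z v, E.MemLocal ℓ P w → E.MemLocal ℓ P z → E.MemLocal ℓ P v →
      |E.localForm ℓ μ m M P Q w w v - E.localForm ℓ μ m M P Q z z v| ≤
        C * (l2 E.mE (weakGrad E.carrier fun x => w x - z x) * l2 E.mE (weakGrad E.carrier v)) := by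
  obtain ⟨C, hC, hst⟩ := exists_stab_le ℓ hρ
  refine ⟨M + M * m * C, by positivity, fun Ω μ hμ E c hE h hedge P hP Q hQ w z v hw hz hv => ?_⟩
  have hd := h.memLocal_sub hP hw hz
  rw [localForm_sub hμ hm hE h hP hQ hw hz hv]
  have cw := h.continuous_gradProj hP hQ hw
  have cz := h.continuous_gradProj hP hQ hz
  have cv := h.continuous_gradProj hP hQ hv
  have cd := h.continuous_gradProj hP hQ hd
  have hmem : ∀ {g : Plane → Plane}, Continuous g → MemLp g 2 E.mE := fun hg =>
    memLp_of_continuous E.isBounded_carrier hg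
  set D := l2 E.mE (weakGrad E.carrier fun x => w x - z x)
  set V := l2 E.mE (weakGrad E.carrier v)
  have hD0 : 0 ≤ D := l2_nonneg _
  have hV0 : 0 ≤ V := l2_nonneg _
  have k1 := abs_integral_inner_le ((memLp_flux hμ hm hE cw).sub (memLp_flux hμ hm hE cz)) (hmem cv)
  have k2 : l2 E.mE ((fun x => μ x ‖E.gradProj ℓ P Q w x‖ • E.gradProj ℓ P Q w x) -
      fun x => μ x ‖E.gradProj ℓ P Q z x‖ • E.gradProj ℓ P Q z x) ≤ M * D := by
    have h1 : l2 E.mE ((fun x => μ x ‖E.gradProj ℓ P Q w x‖ • E.gradProj ℓ P Q w x) -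
      fun x => μ x ‖E.gradProj ℓ P Q z x‖ • E.gradProj ℓ P Q z x) ≤
        l2 E.mE (fun x => M • E.gradProj ℓ P Q (fun x => w x - z x) x) := by
      refine l2_mono ((hmem cd).const_smul M) ?_
      filter_upwards [h.gradProj_sub hP hQ hw hz, ae_restrict_mem E.measurableSet_carrier] with x hx hxE
      rw [hx, norm_smul, Real.norm_eq_abs, abs_of_pos hM]
      exact norm_flux_sub_le hm hM (hμ.2 x (subset_closure (hE hxE))) _ _
    rw [l2_smul, abs_of_pos hM] at h1
    exact h1.trans (mul_le_mul_of_nonneg_left (h.l2_gradProj_le hP hQ hd) hM.le)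
  have k3 := k1.trans (mul_le_mul k2 (h.l2_gradProj_le hP hQ hv) (l2_nonneg _) (by positivity))
  set a := fun d => E.dof ℓ (fun x => (w x - z x) - polyFun (P fun x => w x - z x) x) d
  set b := fun d => E.dof ℓ (fun x => v x - polyFun (P v) x) d
  have k4 : |∑ d, a d * b d| ≤ C * (D * V) := by
    refine abs_le_of_sq_le_sq ?_ (by positivity)
    refine (Finset.sum_mul_sq_le_sq_mul_sq _ _ _).trans ?_
    have := mul_le_mul (hst E c h hedge P hP _ hd) (hst E c h hedge P hP v hv)
      (Finset.sum_nonneg fun _ _ => sq_nonneg _) (by positivity)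
    refine this.trans (le_of_eq (by ring))
  refine (abs_add_le _ _).trans ?_
  rw [abs_mul, abs_of_pos (by positivity : 0 < M * m), add_mul]
  refine add_le_add (k3.trans (le_of_eq (by ring))) ?_
  rw [mul_assoc (M * m)]
  exact mul_le_mul_of_nonneg_left k4 (by positivity)

/-- The flux controls the projected gradient of the difference and the stabilisation controls the
gradient of its residual through `exists_energy_le`; together they control the full gradient. -/
theorem exists_local_monotone (ℓ : ℕ) {ρ m M : ℝ} (hρ : 0 < ρ) (hm : 0 < m) (hM : 0 < M) :
    ∃ C : ℝ, 0 < C ∧ ∀ (Ω : Set Plane) (μ : Plane → ℝ → ℝ), NonlinearityAssumption Ω μ m M →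
    ∀ (E : Polygon) (c : Plane), E.carrier ⊆ Ω → E.StarBall c (ρ * E.diam) →
    (∀ i, ρ * E.diam ≤ E.edgeLength i) → ∀ P, E.IsValueProjection ℓ P →
    ∀ Q : E.Idx → (Plane → ℝ) → Polynomial ℝ, (∀ i, E.IsEdgeProjection ℓ i (Q i)) →
    ∀ w z, E.MemLocal ℓ P w → E.MemLocal ℓ P z →
      C * l2 E.mE (weakGrad E.carrier fun x => w x - z x) ^ 2 ≤
        E.localForm ℓ μ m M P Q w w (fun x => w x - z x) -
          E.localForm ℓ μ m M P Q z z (fun x => w x - z x) := by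
  obtain ⟨C, hC, hen⟩ := exists_energy_le ℓ hρ
  -- From `D ≤ g + 2 u` and `u² ≤ C S` one has `D² ≤ 2 g² + 8 C S`, to be bounded by `m g² + M m S`
  -- after multiplication by the constant.
  refine ⟨min (m / 2) (M * m / (8 * C)), by positivity, fun Ω μ hμ E c hE h hedge P hP Q hQ w z hw hz => ?_⟩
  have hd := h.memLocal_sub hP hw hz
  rw [localForm_sub hμ hm hE h hP hQ hw hz hd]
  have cw := h.continuous_gradProj hP hQ hw
  have cz := h.continuous_gradProj hP hQ hz
  have cd := h.continuous_gradProj hP hQ hd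
  have hmem : ∀ {g : Plane → Plane}, Continuous g → MemLp g 2 E.mE := fun hg =>
    memLp_of_continuous E.isBounded_carrier hg
  have k1 : m * l2 E.mE (E.gradProj ℓ P Q fun x => w x - z x) ^ 2 ≤
      ∫ x in E.carrier, inner ℝ (μ x ‖E.gradProj ℓ P Q w x‖ • E.gradProj ℓ P Q w x -
        μ x ‖E.gradProj ℓ P Q z x‖ • E.gradProj ℓ P Q z x) (E.gradProj ℓ P Q (fun x => w x - z x) x) := by
    rw [l2_sq, ← integral_const_mul]
    refine integral_mono_ae ((integrable_norm_sq (hmem cd)).const_mul m) (integrable_inner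
      ((memLp_flux hμ hm hE cw).sub (memLp_flux hμ hm hE cz)) (hmem cd)) ?_
    filter_upwards [h.gradProj_sub hP hQ hw hz, ae_restrict_mem E.measurableSet_carrier] with x hx hxE
    rw [hx]
    exact le_inner_flux_sub (hμ.2 x (subset_closure (hE hxE))) _ _
  have k2 := h.l2_weakGrad_le hP hQ hd
  have k3 := hen E c h hedge _ (memEnlarged_residual hP hd.1) fun p hp => hd.integral_eq_zero hP hp
  simp only [← sq]
  set S := ∑ d, E.dof ℓ (fun x => (w x - z x) - polyFun (P fun x => w x - z x) x) d ^ 2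
  have hS0 : 0 ≤ S := Finset.sum_nonneg fun _ _ => sq_nonneg _
  set g := l2 E.mE (E.gradProj ℓ P Q fun x => w x - z x)
  set u := l2 E.mE (weakGrad E.carrier fun x => (w x - z x) - polyFun (P fun x => w x - z x) x)
  set D := l2 E.mE (weakGrad E.carrier fun x => w x - z x)
  have hD0 : 0 ≤ D := l2_nonneg _
  set κ := min (m / 2) (M * m / (8 * C))
  have hκ : 0 < κ := by positivity
  have hκ1 : κ ≤ m / 2 := min_le_left _ _
  have hκ2 : κ * (8 * C) ≤ M * m := (le_div_iff₀ (by positivity)).1 (min_le_right _ _)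
  have k4 : D ^ 2 ≤ 2 * g ^ 2 + 8 * C * S := by
    have := pow_le_pow_left₀ hD0 k2 2
    nlinarith [sq_nonneg (g - 2 * u)]
  have k5 := mul_le_mul_of_nonneg_left k4 hκ.le
  have k6 : κ * (2 * g ^ 2) ≤ m * g ^ 2 := by nlinarith [sq_nonneg g]
  have k7 : κ * (8 * C) * S ≤ M * m * S := mul_le_mul_of_nonneg_right hκ2 hS0
  linarith

end Polygon

/-! ### Global estimates -/

namespace Mesh

variable {Ω : Set Plane}

/-- The elements cover `Ω` up to their frontiers, which are null, and the weak gradient on an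
element is the restriction of the global one. -/
lemma h1Seminorm_sq (T : Mesh Ω) {v : Plane → ℝ} (hv : MemH1 Ω v) :
    h1Seminorm Ω v ^ 2 = ∑ K, l2 (T.elem K).mE (weakGrad (T.elem K).carrier v) ^ 2 := by
  have hae : Ω =ᵐ[volume] (⋃ K, (T.elem K).carrier : Set Plane) := by
    refine (ae_le_set.2 ?_).antisymm (LE.le.eventuallyLE (iUnion_subset T.subset_domain))
    refine measure_mono_null (t := ⋃ K, frontier (T.elem K).carrier) ?_
      (measure_iUnion_null fun K => (T.elem K).volume_frontier)
    rintro x ⟨hx, hxn⟩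
    have hx' := subset_closure hx
    rw [T.cover, mem_iUnion] at hx'
    obtain ⟨K, hK⟩ := hx'
    refine mem_iUnion.2 ⟨K, hK, fun hi => hxn (mem_iUnion.2 ⟨K, interior_subset hi⟩)⟩
  have hI := integrable_norm_sq hv.memLp_weakGrad
  rw [h1Seminorm_eq, l2_sq, setIntegral_congr_set hae,
    integral_iUnion_fintype (fun K => (T.elem K).measurableSet_carrier)
      (fun K L hKL => T.nonoverlapping K L hKL)
      fun K => hI.mono_measure (Measure.restrict_mono (T.subset_domain K) le_rfl)]
  refine Finset.sum_congr rfl fun K _ => ?_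
  rw [l2_congr (weakGrad_mono (T.elem K).isOpen_carrier hv (T.subset_domain K)), l2_sq]

end Mesh

end VEM

end

/-! ### Summation of the local estimates over the mesh -/

open VEM in
theorem mainTheorem6 (ℓ : ℕ) (hℓ : 1 ≤ ℓ) (ρ m M : ℝ) (hρ : 0 < ρ) (hm : 0 < m) (hM : 0 < M) :
    (∃ C : ℝ, 0 < C ∧
      ∀ (Ω : Set Plane), IsPolygonalDomain Ω →
      ∀ (μ : Plane → ℝ → ℝ), NonlinearityAssumption Ω μ m M →
      ∀ (T : Mesh Ω), T.IsRegular ρ →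
      ∀ (R : T.Projections), R.IsAdmissible ℓ →
      ∀ w ∈ R.space ℓ, ∀ z ∈ R.space ℓ, ∀ v ∈ R.space ℓ,
        |R.form ℓ μ m M w w v - R.form ℓ μ m M z z v| ≤
          C * h1Seminorm Ω (w - z) * h1Seminorm Ω v) ∧
    (∃ C : ℝ, 0 < C ∧
      ∀ (Ω : Set Plane), IsPolygonalDomain Ω →
      ∀ (μ : Plane → ℝ → ℝ), NonlinearityAssumption Ω μ m M →
      ∀ (T : Mesh Ω), T.IsRegular ρ →
      ∀ (R : T.Projections), R.IsAdmissible ℓ →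
      ∀ w ∈ R.space ℓ, ∀ z ∈ R.space ℓ,
        C * h1Seminorm Ω (w - z) ^ 2 ≤
          R.form ℓ μ m M w w (w - z) - R.form ℓ μ m M z z (w - z)) := by
  have hball : ∀ E : Polygon, E.IsRegular ρ → ∃ c, E.StarBall c (ρ * E.diam) := fun E hE => by
    obtain ⟨c, h1, h2⟩ := hE.1
    exact ⟨c, mul_pos hρ E.diam_pos, h1, h2⟩
  constructor
  · obtain ⟨C, hC, hloc⟩ := Polygon.exists_local_lipschitz ℓ hρ hm hM
    refine ⟨C, hC, fun Ω _ μ hμ T hT R hR w hw z hz v hv => ?_⟩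
    have hd : MemH1 Ω (w - z) := hw.1.1.sub hz.1.1
    set a : Fin T.size → ℝ := fun K => l2 (T.elem K).mE (weakGrad (T.elem K).carrier (w - z))
    set b : Fin T.size → ℝ := fun K => l2 (T.elem K).mE (weakGrad (T.elem K).carrier v)
    have h1 : |R.form ℓ μ m M w w v - R.form ℓ μ m M z z v| ≤ C * ∑ K, a K * b K := by
      rw [Mesh.Projections.form, Mesh.Projections.form, ← Finset.sum_sub_distrib, Finset.mul_sum]
      refine (Finset.abs_sum_le_sum_abs _ _).trans (Finset.sum_le_sum fun K _ => ?_)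
      obtain ⟨c, hc⟩ := hball _ (hT K)
      exact hloc Ω μ hμ (T.elem K) c (T.subset_domain K) hc (hT K).2 _ (hR K).1 _ (hR K).2 w z v
        (hw.2 K) (hz.2 K) (hv.2 K)
    refine h1.trans ?_
    rw [mul_assoc]
    refine mul_le_mul_of_nonneg_left ?_ hC.le
    -- Cauchy–Schwarz over the elements turns the sum of local products into the product of the
    -- global seminorms.
    have h2 := Real.sum_mul_le_sqrt_mul_sqrt Finset.univ a b
    rwa [← T.h1Seminorm_sq hd, ← T.h1Seminorm_sq hv.1.1,
      Real.sqrt_sq (show 0 ≤ h1Seminorm Ω (w - z) from Real.sqrt_nonneg _),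
      Real.sqrt_sq (show 0 ≤ h1Seminorm Ω v from Real.sqrt_nonneg _)] at h2
  · obtain ⟨C, hC, hloc⟩ := Polygon.exists_local_monotone ℓ hρ hm hM
    refine ⟨C, hC, fun Ω _ μ hμ T hT R hR w hw z hz => ?_⟩
    have hd : MemH1 Ω (w - z) := hw.1.1.sub hz.1.1
    rw [T.h1Seminorm_sq hd, Mesh.Projections.form, Mesh.Projections.form, ← Finset.sum_sub_distrib,
      Finset.mul_sum]
    refine Finset.sum_le_sum fun K _ => ?_
    obtain ⟨c, hc⟩ := hball _ (hT K)
    exact hloc Ω μ hμ (T.elem K) c (T.subset_domain K) hc (hT K).2 _ (hR K).1 _ (hR K).2 w z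
      (hw.2 K) (hz.2 K)
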